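/- **Setting.** Let $f=(f_v)_{v\in V}$ be strictly increasing functions $\mathbb R\to\mathbb R$ and $\Sigma$ a positive definite correlation matrix; $\mathrm{NPN}(f,\Sigma)$ is the law of $(f_v(Z_v))_{v\in V}$ for $Z\sim N(0,\Sigma)$. The matrix $\Sigma$ is faithful to a DAG $G$ on $V$ if for every $X\sim\mathrm{NPN}(f,\Sigma)$ and all pairwise disjoint $A,B,S\subseteq V$, $S$ d-separates $A$ and $B$ in $G$ if and only if $X_A\perp\!\!\!\perp X_B\mid X_S$. The CPDAG $C(G)$ is the graph whose edge set is the union of the edge sets of all DAGs that are Markov equivalent to $G$ (an undirected edge being a pair of opposite directed edges), and $\deg(G)$ is the maximal number of edges incident to a node. For a symmetric matrix $\Sigma$ let $$\rho_{uv|S}=-\Psi^{-1}_{uv}\big/\sqrt{\Psi^{-1}_{uu}\Psi^{-1}_{vv}},\qquad \Psi=\Sigma_{\{u,v\}\cup S,\{u,v\}\cup S}.$$ Let $c_{\min}(\Sigma,q)$ be the minimum of all non-zero $|\rho_{uv|S}|$ with $u,v\in I$, $S\subseteq I\setminus\{u,v\}$, and let $\lambda_{\min}(\Sigma,q)$ be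 the minimum of the smallest eigenvalues of $\Sigma_{I,I}$, where in both cases $I$ ranges over the subsets of $V$ with $|I|=\min(q,|V|)$. The case $u=v$, where $|\rho_{uu|S}|=1$, is allowed in $c_{\min}$, so that $0<c_{\min}(\Sigma,q)\le 1$ for $V\ne\emptyset$. Fix constants $0<A,B<\infty$ and a measurable estimator $\hat\rho$ of the correlation parameter such that $P(|\hat\rho-\rho|>\epsilon)\le A\exp(-Bn\epsilon^2)$ for every $\epsilon>0$, every $n\ge1$, and $n$ independent observations from any bivariate nonparanormal distribution with correlation parameter $\rho$. For observations $X_1,\dots,X_n$ from $\mathrm{NPN}(f,\Sigma)$ let $\hat\Sigma$ be the symmetric matrix with unit diagonal obtained by applying $\hat\rho$ to every pair of coordinates, and let $\hat\rho_{uv|S}$ be computed from $\hat\Sigma$ by the formula above. The Rank PC algorithm with level $\alpha$ is the PC algorithm (adjacency search over conditioning sets of increasing size, orientation of unshielded colliders by means of the recorded separating sets, then exhaustive application of the orientation rules R1–R3), in which $X_u\perp\!\!\!\perp X_v\mid X_S$ is accepted if and only if $$\sqrt{n-|S|-3}\;\left|\tfrac12\log\frac{1+\hat\rho_{uv|S}}{1-\hat\rho_{uv|S}}\right|\le\Phi^{-1}(1-\alpha/2)$$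 (with rejection if $|\hat\rho_{uv|S}|\ge1$), where $\Phi$ is the standard normal distribution function. Put $$\gamma(n,s,z)=\frac{\exp(z/\sqrt{n-s-3})-1}{\exp(z/\sqrt{n-s-3})+1}.$$ **Claim.** Let $(G_n)$ be a sequence of DAGs, $G_n$ with $p_n$ nodes and $q_n=\deg(G_n)+2$, and let $\Sigma_n$ be a positive definite $p_n\times p_n$ correlation matrix that is faithful to $G_n$. Let $c_n=c_{\min}(\Sigma_n,q_n)$. Suppose that there are constants $0\le a,b,d,f<1$ with $a+2b+2d+4f<1$ and $$\log p_n=O(n^a),\quad q_n=O(n^b),\quad c_n=\Omega(n^{-d}),\quad \lambda_{\min}(\Sigma_n,q_n)=\Omega(n^{-f}).$$ For every $n$ let $X_1,\dots,X_n$ be independent observations from some $\mathrm{NPN}(f^{(n)},\Sigma_n)$. Put $$z_n=\sqrt{n-3}\cdot\log\left(\frac{1+c_n/3}{1-c_n/3}\right).$$ Then there are levels $\alpha_n\in(0,1)$ with $2\Phi^{-1}(1-\alpha_n/2)=z_n$ for all sufficiently large $n$, and the following hold. 1. For all sufficiently large $n$ and all $0\le s\le q_n$: $n>s+3$; the test of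 level $\alpha_n$ with a conditioning set of size $|S|=s$ accepts if and only if $|\hat\rho_{uv|S}|\le\gamma(n,s,z_n)$; and $c_n/3\le\gamma(n,s,z_n)\le 2c_n/3$. 2. With probability tending to $1$ as $n\to\infty$, the output of the Rank PC algorithm with level $\alpha_n$ for the data $X_1,\dots,X_n$ equals $C(G_n)$. -/

import Mathlib

open MeasureTheory ProbabilityTheory Filter Topology Asymptotics

namespace RankPC

/-! ### Directed acyclic graphs, d-separation, Markov equivalence and the CPDAG -/

/-- A directed acyclic graph: a digraph without directed cycles (in particular without loops and
with at most one edge between any two nodes). -/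
structure DAG (V : Type*) extends Digraph V where
  acyclic : ∀ v, ¬ Relation.TransGen Adj v v

namespace DAG

variable {V : Type*}

/-- The skeleton: the undirected graph obtained by forgetting directions. -/
def skeleton (G : DAG V) : SimpleGraph V where
  Adj v w := v ≠ w ∧ (G.Adj v w ∨ G.Adj w v)
  symm := ⟨fun _ _ h => ⟨h.1.symm, h.2.symm⟩⟩
  loopless := ⟨fun _ h => h.1 rfl⟩

/-- Three consecutive nodes `x, y, z` of a path are blocked by `S`: either `x, y, z` form a collider
`x → y ← z` and neither `y` nor any of its descendants is in `S`, or they do not form a collider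
(so they form a chain or a fork) and `y ∈ S`. -/
def Blocks (G : DAG V) (S : Finset V) (x y z : V) : Prop :=
  ((G.Adj x y ∧ G.Adj z y) ∧ ∀ d, Relation.ReflTransGen G.Adj y d → d ∉ S) ∨
    (¬ (G.Adj x y ∧ G.Adj z y) ∧ y ∈ S)

/-- `S` d-separates `u` and `v`: every path from `u` to `v` (a sequence of distinct nodes, any two
consecutive ones joined by an edge in either direction) contains three consecutive nodes that are
blocked by `S`. -/
def DSep (G : DAG V) (u v : V) (S : Finset V) : Prop :=
  ∀ w : G.skeleton.Walk u v, w.IsPath →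
    ∃ x y z, [x, y, z] <:+: w.support ∧ G.Blocks S x y z

/-- Markov equivalence: the same d-separation relations. -/
def MarkovEquiv (G H : DAG V) : Prop :=
  ∀ (u v : V) (S : Finset V), u ≠ v → u ∉ S → v ∉ S → (G.DSep u v S ↔ H.DSep u v S)

/-- The edge set of the CPDAG `C(G)`: the union of the edge sets of all DAGs that are Markov
equivalent to `G`. An undirected edge is represented by the presence of both `(v, w)` and
`(w, v)`. -/
def cpdag (G : DAG V) : Set (V × V) :=
  {e | ∃ H : DAG V, G.MarkovEquiv H ∧ H.Adj e.1 e.2}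

/-- The degree of a DAG: the maximal number of edges incident to a node. -/
noncomputable def deg [Fintype V] (G : DAG V) : ℕ :=
  Finset.univ.sup fun v => (G.skeleton.neighborSet v).ncard

end DAG

/-! ### The PC algorithm

Partially directed graphs on `Fin p` are represented by finite sets of ordered pairs; an undirected
edge is represented by both of its orientations. The argument `test i j S` is the answer to the
query whether `i` and `j` are (conditionally) independent given `S`. -/

section PC

variable {p : ℕ}

/-- State of the skeleton phase: the current undirected graph and the recorded separating sets. -/
structure SkelState (p : ℕ) where
  edges : Finset (Fin p × Fin p)
  sep : Fin p → Fin p → Finset (Fin p)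

/-- The nodes `k` with `(i, k) ∈ E`. -/
def nbrs (E : Finset (Fin p × Fin p)) (i : Fin p) : Finset (Fin p) :=
  Finset.univ.filter fun k => (i, k) ∈ E

/-- All ordered pairs of nodes, in lexicographic order. -/
def pairs (p : ℕ) : List (Fin p × Fin p) :=
  (List.finRange p).product (List.finRange p)

/-- The subsets of `A` of cardinality `l`, as a list. -/
def subsetsOfCard (A : Finset (Fin p)) (l : ℕ) : List (Finset (Fin p)) :=
  (A.sort.sublistsLen l).map List.toFinset

/-- Visit the ordered pair `e = (i, j)` at level `l`: if `i` and `j` are adjacent in the current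
graph, query the sets `S ⊆ adj(i) \ {j}` with `|S| = l` one by one until one is found for which
independence is accepted; if there is one, delete the edge and record `S` as separating set. -/
def visitPair (test : Fin p → Fin p → Finset (Fin p) → Bool) (l : ℕ)
    (st : SkelState p) (e : Fin p × Fin p) : SkelState p :=
  if e ∈ st.edges then
    match (subsetsOfCard ((nbrs st.edges e.1).erase e.2) l).find? (test e.1 e.2) with
    | some S =>
      { edges := (st.edges.erase (e.1, e.2)).erase (e.2, e.1)
        sep := fun x y => if (x, y) = (e.1, e.2) ∨ (x, y) = (e.2, e.1) then S else st.sep x y }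
    | none => st
  else st

/-- First phase of the PC algorithm: start from the complete undirected graph and visit all ordered
pairs of nodes, at levels `l = 0, 1, 2, …`. (At levels `l ≥ p - 1` there is nothing to query.) -/
def skeletonPhase (test : Fin p → Fin p → Finset (Fin p) → Bool) : SkelState p :=
  (List.range p).foldl (fun st l => (pairs p).foldl (visitPair test l) st)
    { edges := Finset.univ.offDiag, sep := fun _ _ => ∅ }

/-- Second phase: for every pair of nonadjacent nodes `i, j` with a common neighbour `k` that is not
in the separating set of `i, j`, replace `i - k - j` by `i → k ← j`. -/
def colliderPhase (st : SkelState p) : Finset (Fin p × Fin p) :=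
  ((pairs p).product (List.finRange p)).foldl
    (fun E t =>
      let i := t.1.1
      let j := t.1.2
      let k := t.2
      if i ≠ j ∧ (i, j) ∉ st.edges ∧ (i, k) ∈ st.edges ∧ (j, k) ∈ st.edges ∧ k ∉ st.sep i j then
        (E \ {(k, i), (k, j)}) ∪ {(i, k), (j, k)}
      else E)
    st.edges

/-- The directed edge `a → b` is present. -/
def IsDir (E : Finset (Fin p × Fin p)) (a b : Fin p) : Prop := (a, b) ∈ E ∧ (b, a) ∉ E

/-- The undirected edge `a - b` is present. -/
def IsUndir (E : Finset (Fin p × Fin p)) (a b : Fin p) : Prop := (a, b) ∈ E ∧ (b, a) ∈ E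

/-- `a` and `b` are not joined by an edge. -/
def NonAdj (E : Finset (Fin p × Fin p)) (a b : Fin p) : Prop := (a, b) ∉ E ∧ (b, a) ∉ E

instance (E : Finset (Fin p × Fin p)) (a b : Fin p) : Decidable (IsDir E a b) := by
  unfold IsDir; infer_instance

instance (E : Finset (Fin p × Fin p)) (a b : Fin p) : Decidable (IsUndir E a b) := by
  unfold IsUndir; infer_instance

instance (E : Finset (Fin p × Fin p)) (a b : Fin p) : Decidable (NonAdj E a b) := by
  unfold NonAdj; infer_instance

/-- One of the three orientation rules allows to orient the undirected edge `a - b` as `a → b`: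
(R1) there is `c → a` with `c` and `b` nonadjacent;
(R2) there is a chain `a → c → b`;
(R3) there are `a - c → b` and `a - d → b` with `c ≠ d` nonadjacent. -/
def OrientRule (E : Finset (Fin p × Fin p)) (a b : Fin p) : Prop :=
  IsUndir E a b ∧
    ((∃ c, IsDir E c a ∧ NonAdj E c b) ∨
     (∃ c, IsDir E a c ∧ IsDir E c b) ∨
     (∃ c d, c ≠ d ∧ NonAdj E c d ∧ IsUndir E a c ∧ IsDir E c b ∧ IsUndir E a d ∧ IsDir E d b))

instance (E : Finset (Fin p × Fin p)) (a b : Fin p) : Decidable (OrientRule E a b) := by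
  unfold OrientRule; infer_instance

/-- One pass of the orientation rules through all ordered pairs of nodes. -/
def orientPass (E : Finset (Fin p × Fin p)) : Finset (Fin p × Fin p) :=
  (pairs p).foldl (fun E e => if OrientRule E e.1 e.2 then E.erase (e.2, e.1) else E) E

/-- The PC algorithm. The third phase applies the orientation rules until they do not change the
graph any more; `p * p` passes are enough because every pass that changes the graph removes at least
one ordered pair. -/
def pc (test : Fin p → Fin p → Finset (Fin p) → Bool) : Finset (Fin p × Fin p) :=
  orientPass^[p * p] (colliderPhase (skeletonPhase test))

end PC

/-! ### Correlation matrices and partial correlations -/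

section Corr

variable {V : Type*} [Fintype V] [DecidableEq V]

/-- Positive definite correlation matrices. -/
def IsCorrMatrix (M : Matrix V V ℝ) : Prop := M.PosDef ∧ ∀ v, M v v = 1

/-- The partial correlation `ρ_{uv|S} = - Ψ⁻¹_{uv} / √(Ψ⁻¹_{uu} Ψ⁻¹_{vv})`, where `Ψ` is the
principal submatrix of `M` for the index set `{u, v} ∪ S`. (For `u = v` it has absolute value `1`
if `M` is positive definite.) -/
noncomputable def partialCorr (M : Matrix V V ℝ) (u v : V) (S : Finset V) : ℝ :=
  let I : Finset V := insert u (insert v S)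
  let Q : Matrix I I ℝ := (M.submatrix (fun i : I => (i : V)) (fun i : I => (i : V)))⁻¹
  let u' : I := ⟨u, Finset.mem_insert_self u _⟩
  let v' : I := ⟨v, Finset.mem_insert_of_mem (Finset.mem_insert_self v S)⟩
  let num : ℝ := -Q u' v'
  num / √(Q u' u' * Q v' v')

/-- `c_min(M, q)`: the minimal magnitude of a non-zero partial correlation `ρ_{uv|S}` within a
`q × q` principal submatrix of `M` (the whole matrix if it has less than `q` rows). The set is
finite, so the infimum is a minimum as soon as there are nodes. -/
noncomputable def cMin (M : Matrix V V ℝ) (q : ℕ) : ℝ :=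
  sInf {r | ∃ I : Finset V, I.card = min q (Fintype.card V) ∧ ∃ u ∈ I, ∃ v ∈ I, ∃ S ⊆ I,
    u ∉ S ∧ v ∉ S ∧ partialCorr M u v S ≠ 0 ∧ r = |partialCorr M u v S|}

/-- `λ_min(M, q)`: the minimal eigenvalue of any `q × q` principal submatrix of `M` (of the whole
matrix if it has less than `q` rows). -/
noncomputable def lambdaMin (M : Matrix V V ℝ) (q : ℕ) : ℝ :=
  sInf {r | ∃ I : Finset V, I.card = min q (Fintype.card V) ∧
    Module.End.HasEigenvalue
      (Matrix.toLin' (M.submatrix (fun i : I => (i : V)) (fun i : I => (i : V)))) r}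

/-! ### Nonparanormal distributions and faithfulness -/

/-- The nonparanormal distribution `NPN(f, M)`: the law of `(f_v(Z_v))_v` for `Z ∼ N(0, M)`. It is
only used for strictly increasing `f_v` and positive definite correlation matrices `M`. -/
noncomputable def npn (f : V → ℝ → ℝ) (M : Matrix V V ℝ) : Measure (V → ℝ) :=
  (multivariateGaussian 0 M).map fun z v => f v (z v)

instance (f : V → ℝ → ℝ) (M : Matrix V V ℝ) : IsFiniteMeasure (npn f M) := by
  unfold npn; infer_instance

/-- Under the law `P` of a random vector `X`, `X_A` and `X_B` are conditionally independent
given `X_S`. -/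
def CondIndepVec (P : Measure (V → ℝ)) [IsFiniteMeasure P] (A B S : Finset V) : Prop :=
  CondIndepFun (MeasurableSpace.comap (S.restrict (π := fun _ => ℝ)) inferInstance)
    (Finset.measurable_restrict S).comap_le
    (A.restrict (π := fun _ => ℝ)) (B.restrict (π := fun _ => ℝ)) P

/-- The law `P` of a random vector is faithful to `G`: for all pairwise disjoint `A, B, S`, the set
`S` d-separates `A` and `B` in `G` if and only if `X_A ⊥⊥ X_B | X_S`. -/
def FaithfulLaw (G : DAG V) (P : Measure (V → ℝ)) [IsFiniteMeasure P] : Prop :=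
  ∀ A B S : Finset V, Disjoint A B → Disjoint A S → Disjoint B S →
    ((∀ a ∈ A, ∀ b ∈ B, G.DSep a b S) ↔ CondIndepVec P A B S)

/-- The correlation matrix `M` is faithful to `G`: every `NPN(f, M)` is. -/
def Faithful (G : DAG V) (M : Matrix V V ℝ) : Prop :=
  ∀ f : V → ℝ → ℝ, (∀ v, StrictMono (f v)) → FaithfulLaw G (npn f M)

end Corr

/-! ### Rank PC with Fisher z-tests -/

/-- An estimator of the correlation parameter of bivariate nonparanormal distributions (for every
sample size, a measurable function of the data) that satisfies, for independent observations from
any bivariate nonparanormal distribution with correlation `ρ`,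
`P(|ρ̂ - ρ| > ε) ≤ A exp(-B n ε²)`. -/
def IsGoodEstimator (A B : ℝ) (rhoHat : ∀ n : ℕ, (Fin n → ℝ × ℝ) → ℝ) : Prop :=
  (∀ n, Measurable (rhoHat n)) ∧
  ∀ n : ℕ, 1 ≤ n → ∀ f : Fin 2 → ℝ → ℝ, (∀ v, StrictMono (f v)) →
    ∀ M : Matrix (Fin 2) (Fin 2) ℝ, IsCorrMatrix M → ∀ ε : ℝ, 0 < ε →
      (Measure.pi fun _ : Fin n => npn f M).real
        {x | ε < |rhoHat n (fun i => (x i 0, x i 1)) - M 0 1|} ≤ A * Real.exp (-B * n * ε ^ 2)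

/-- The estimated correlation matrix: the bivariate estimator applied to every pair of
coordinates of the data `x`. -/
def corrHat (rhoHat : ∀ n : ℕ, (Fin n → ℝ × ℝ) → ℝ) {n p : ℕ} (x : Fin n → Fin p → ℝ) :
    Matrix (Fin p) (Fin p) ℝ :=
  fun u v =>
    if u = v then 1
    else if u < v then rhoHat n (fun i => (x i u, x i v))
    else rhoHat n (fun i => (x i v, x i u))

/-- The quantile function `Φ⁻¹` of the standard normal distribution. -/
noncomputable def normalQuantile (t : ℝ) : ℝ := sInf {x : ℝ | t ≤ cdf (gaussianReal 0 1) x}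

/-- The Fisher z-test of level `α` with adjusted sample size `n - s - 3` accepts independence for an
estimated partial correlation `r` given `s` variables:
`√(n - s - 3) |½ log((1 + r) / (1 - r))| ≤ Φ⁻¹(1 - α/2)`. For `|r| ≥ 1`, where the z-transform is
infinite or undefined, the test rejects. -/
def FisherAccept (n : ℕ) (α : ℝ) (s : ℕ) (r : ℝ) : Prop :=
  |r| < 1 ∧
    √((n : ℝ) - s - 3) * |1 / 2 * Real.log ((1 + r) / (1 - r))| ≤ normalQuantile (1 - α / 2)

/-- The threshold `γ(n, s, z) = (exp(z / √(n - s - 3)) - 1) / (exp(z / √(n - s - 3)) + 1)`. -/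
noncomputable def cutoff (n s : ℕ) (z : ℝ) : ℝ :=
  (Real.exp (z / √((n : ℝ) - s - 3)) - 1) / (Real.exp (z / √((n : ℝ) - s - 3)) + 1)

open Classical in
/-- The output of the Rank PC algorithm on the data `x`, with Fisher z-tests of level `α`. -/
noncomputable def rankPC (rhoHat : ∀ n : ℕ, (Fin n → ℝ × ℝ) → ℝ) (α : ℝ) {n p : ℕ}
    (x : Fin n → Fin p → ℝ) : Finset (Fin p × Fin p) :=
  pc fun u v S => decide (FisherAccept n α S.card (partialCorr (corrHat rhoHat x) u v S))

/-- The quantile sequence `z_n = √(n - 3) log((1 + c/3) / (1 - c/3))`, for `c = c_n`. -/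
noncomputable def zSeq (n : ℕ) (c : ℝ) : ℝ :=
  √((n : ℝ) - 3) * Real.log ((1 + c / 3) / (1 - c / 3))

end RankPC

/-! The proof has a deterministic and a probabilistic half.

PC with correct answers. If every query with a conditioning set of size at most `deg G` is answered
as d-separation would, PC returns `C(G)` (`pc_eq_cpdag`). Larger sets are never queried after that
level: nonadjacent nodes are d-separated by the parents of one of them, so after level `deg G` the
current graph is the skeleton and no node has enough neighbours left. Any separating set decides
whether an unshielded triple is a collider. Adjacencies and unshielded colliders determine the
Markov equivalence class (Verma and Pearl). The nontrivial direction follows Chickering: two DAGs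
with the same pattern are joined by reversals of covered edges, and such a reversal preserves
d-connection. Completeness of R1-R3 is Meek's theorem: in a graph closed under the rules, undirected
edges can be oriented along a perfect ordering that starts at any given node. This creates no cycle
and no new unshielded collider, so every remaining edge occurs in a DAG of the class.

Accuracy of the tests. For the Gaussian member of the family, conditional independence of two
coordinates means a vanishing partial correlation, so by faithfulness `ρ_{uv|S}` is zero under
d-separation and otherwise at least `c` in absolute value. If all entries of the estimated matrix
are within `c λ² / (25 q)` of the truth, perturbation of inverse matrices moves each relevant
partial correlation by at most `8c/25`. Zero ones stay below `c/3` and the others above `2c/3`,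
while the threshold `γ` lies between these two numbers; hence all tests are correct
(`rankPC_eq_cpdag`).

Probability. A union bound over the pairs of coordinates bounds the failure probability by `A p²
exp(-B n ε²)` with `ε = c λ² / (25 q)`, which is `Ω(n ^ (-(b + d + 2f)))`. It vanishes because `n
ε²` dominates `log p = O(n ^ a)` when `a + 2b + 2d + 4f < 1`. -/

namespace RankPC

/-! ### d-separation, skeletons and unshielded colliders -/

namespace DAG

variable {V : Type*} {G H : DAG V} {S : Finset V}

lemma irrefl (G : DAG V) (v : V) : ¬ G.Adj v v := fun h => G.acyclic v (.single h)

lemma ne_of_adj {x y : V} (h : G.Adj x y) : x ≠ y := by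
  rintro rfl; exact G.irrefl _ h

lemma asymm {x y : V} (h : G.Adj x y) : ¬ G.Adj y x := fun h' =>
  G.acyclic x (.tail (.single h) h')

lemma skeleton_adj {x y : V} : G.skeleton.Adj x y ↔ G.Adj x y ∨ G.Adj y x :=
  ⟨fun h => h.2, fun h => ⟨by rcases h with h | h; exacts [ne_of_adj h, (ne_of_adj h).symm], h⟩⟩

/-- `x → y ← z` with `x` and `z` distinct and not adjacent. -/
def VStruct (G : DAG V) (x y z : V) : Prop :=
  G.Adj x y ∧ G.Adj z y ∧ x ≠ z ∧ ¬ G.skeleton.Adj x z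

lemma VStruct.symm {x y z : V} (h : G.VStruct x y z) : G.VStruct z y x :=
  ⟨h.2.1, h.1, h.2.2.1.symm, fun h' => h.2.2.2 h'.symm⟩

/-- Two DAGs with the same adjacencies and the same unshielded colliders. -/
def SamePattern (G H : DAG V) : Prop :=
  (∀ x y, G.skeleton.Adj x y ↔ H.skeleton.Adj x y) ∧ ∀ x y z, G.VStruct x y z ↔ H.VStruct x y z

lemma SamePattern.symm (h : G.SamePattern H) : H.SamePattern G :=
  ⟨fun x y => (h.1 x y).symm, fun x y z => (h.2 x y z).symm⟩

lemma SamePattern.trans {K : DAG V} (h : G.SamePattern H) (h' : H.SamePattern K) :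
    G.SamePattern K :=
  ⟨fun x y => (h.1 x y).trans (h'.1 x y), fun x y z => (h.2 x y z).trans (h'.2 x y z)⟩

lemma MarkovEquiv.trans {K : DAG V} (h : G.MarkovEquiv H) (h' : H.MarkovEquiv K) :
    G.MarkovEquiv K :=
  fun u v S h1 h2 h3 => (h u v S h1 h2 h3).trans (h' u v S h1 h2 h3)

/-- No three consecutive nodes of the walk are blocked. -/
def Active (G : DAG V) (S : Finset V) {u v : V} (w : G.skeleton.Walk u v) : Prop :=
  ∀ x y z, [x, y, z] <:+: w.support → ¬ G.Blocks S x y z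

lemma not_dSep_iff {u v : V} :
    ¬ G.DSep u v S ↔ ∃ w : G.skeleton.Walk u v, w.IsPath ∧ G.Active S w := by
  simp only [DSep, Active]; push Not; rfl

lemma not_dSep_of_adj {u v : V} (h : G.skeleton.Adj u v) : ¬ G.DSep u v S := by
  rw [not_dSep_iff]
  refine ⟨h.toWalk, by simpa using h.ne, fun x y z hi => ?_⟩
  have := hi.length_le
  simp at this

lemma infix_triple {x y z a b c : V} (h : [x, y, z] <:+: [a, b, c]) : x = a ∧ y = b ∧ z = c := by
  have := h.eq_of_length rfl
  simpa using this

/-- The path consisting of two edges. -/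
lemma not_dSep_of_not_blocks {x y z : V} (hxy : G.skeleton.Adj x y) (hyz : G.skeleton.Adj y z)
    (hxz : x ≠ z) (h : ¬ G.Blocks S x y z) : ¬ G.DSep x z S := by
  rw [not_dSep_iff]
  refine ⟨.cons hxy (.cons hyz .nil), ?_, fun a b c hi => ?_⟩
  · simp [SimpleGraph.Walk.isPath_def, hxy.ne, hyz.ne, hxz]
  · obtain ⟨rfl, rfl, rfl⟩ := infix_triple (by simpa using hi)
    exact h

lemma notMem_of_dSep_of_collider {x y z : V} (hx : G.Adj x y) (hz : G.Adj z y) (hxz : x ≠ z)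
    (h : G.DSep x z S) : y ∉ S := by
  intro hy
  refine not_dSep_of_not_blocks (skeleton_adj.2 (.inl hx)) (skeleton_adj.2 (.inr hz)) hxz ?_ h
  rintro (⟨-, h⟩ | ⟨h, -⟩)
  · exact h y .refl hy
  · exact h ⟨hx, hz⟩

lemma mem_of_dSep_of_not_collider {x y z : V} (hxy : G.skeleton.Adj x y)
    (hyz : G.skeleton.Adj y z) (hxz : x ≠ z) (hc : ¬ (G.Adj x y ∧ G.Adj z y))
    (h : G.DSep x z S) : y ∈ S := by
  by_contra hy
  refine not_dSep_of_not_blocks hxy hyz hxz ?_ h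
  rintro (⟨h, -⟩ | ⟨-, h⟩)
  exacts [hc h, hy h]

/-- If a walk starts with a directed edge `x → y`, and no node of it has a descendant in `S`,
then an active walk is directed to its end. -/
lemma reflTransGen_of_active {x y v : V} (hx : G.skeleton.Adj x y) (hxy : G.Adj x y)
    (w : G.skeleton.Walk y v) (hS : ∀ d, Relation.ReflTransGen G.Adj y d → d ∉ S)
    (ha : G.Active S (.cons hx w)) : Relation.ReflTransGen G.Adj y v := by
  induction w generalizing x with
  | nil => exact .refl
  | @cons y z v hyz w ih =>
    have hyz' : G.Adj y z := by
      by_contra hn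
      have hzy : G.Adj z y := (skeleton_adj.1 hyz).resolve_left hn
      refine ha x y z ⟨[], w.support.tail, ?_⟩ (.inl ⟨⟨hxy, hzy⟩, hS⟩)
      simp only [SimpleGraph.Walk.support_cons]
      cases w <;> simp
    refine .head hyz' (ih hyz hyz' (fun d hd => hS d (.head hyz' hd)) ?_)
    intro a b c hi
    refine ha a b c ?_
    rw [SimpleGraph.Walk.support_cons]
    exact hi.trans (List.suffix_cons _ _).isInfix

/-- The parents of a node separate it from every nondescendant that is not a parent. -/
lemma dSep_parents {u v : V} (P : Finset V) (hP : ∀ x, x ∈ P ↔ G.Adj x u)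
    (hv : ¬ Relation.ReflTransGen G.Adj u v) (hvu : ¬ G.Adj v u) : G.DSep u v P := by
  by_contra hn
  obtain ⟨w, hw, ha⟩ := not_dSep_iff.1 hn
  cases w with
  | nil => exact hv .refl
  | @cons _ y _ huy w =>
    by_cases h : G.Adj u y
    · refine hv (.head h (reflTransGen_of_active huy h w ?_ ha))
      intro d hd hdP
      exact G.acyclic u (.tail' (.head h hd) ((hP d).1 hdP))
    · have hyu : G.Adj y u := (skeleton_adj.1 huy).resolve_left h
      cases w with
      | nil => exact hvu hyu
      | @cons _ z _ hyz w =>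
        refine ha u y z ⟨[], w.support.tail, ?_⟩ (.inr ⟨fun hc => h hc.1, (hP y).2 hyu⟩)
        simp only [SimpleGraph.Walk.support_cons]
        cases w <;> simp

lemma not_transGen_both {u v : V} (huv : u ≠ v) (h1 : Relation.ReflTransGen G.Adj u v)
    (h2 : Relation.ReflTransGen G.Adj v u) : False := by
  rcases Relation.reflTransGen_iff_eq_or_transGen.1 h1 with h | h
  · exact huv h.symm
  · exact G.acyclic u (h.trans_left h2)

section Symm

lemma Blocks.symm {x y z : V} (h : G.Blocks S x y z) : G.Blocks S z y x := by
  rcases h with h | h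
  · exact .inl ⟨h.1.symm, h.2⟩
  · exact .inr ⟨fun h' => h.1 h'.symm, h.2⟩

lemma DSep.symm {u v : V} (h : G.DSep u v S) : G.DSep v u S := by
  intro w hw
  obtain ⟨x, y, z, hi, hb⟩ := h w.reverse hw.reverse
  refine ⟨z, y, x, ?_, hb.symm⟩
  rw [SimpleGraph.Walk.support_reverse] at hi
  simpa using List.reverse_infix.2 hi

end Symm

open Classical in
/-- Nonadjacent nodes are d-separated by the parents of one of them. -/
lemma exists_dSep_parents [Fintype V] {u v : V} (huv : u ≠ v) (h : ¬ G.skeleton.Adj u v) :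
    G.DSep u v (Finset.univ.filter fun x => G.Adj x u) ∨
      G.DSep v u (Finset.univ.filter fun x => G.Adj x v) := by
  rw [skeleton_adj, not_or] at h
  by_cases hv : Relation.ReflTransGen G.Adj u v
  · exact .inr (dSep_parents _ (by simp) (fun h' => not_transGen_both huv hv h') h.1)
  · exact .inl (dSep_parents _ (by simp) hv h.2)

lemma exists_dSep_iff [Fintype V] {u v : V} (huv : u ≠ v) :
    (∃ S : Finset V, u ∉ S ∧ v ∉ S ∧ G.DSep u v S) ↔ ¬ G.skeleton.Adj u v := by
  classical
  refine ⟨fun ⟨S, _, _, h⟩ ha => not_dSep_of_adj ha h, fun h => ?_⟩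
  have h' := skeleton_adj.not.1 h
  rw [not_or] at h'
  rcases exists_dSep_parents huv h with h1 | h1
  · exact ⟨_, by simp [irrefl], by simp [h'.2], h1⟩
  · exact ⟨_, by simp [h'.1], by simp [irrefl], h1.symm⟩

/-- The two-edge path through `y` must itself be blocked, which forces `y ∉ S` at a collider and `y
∈ S` otherwise. Hence it does not matter which separating set PC happens to record. -/
lemma vStruct_iff_of_dSep {x y z : V} (hxy : G.skeleton.Adj x y)
    (hyz : G.skeleton.Adj z y) (hxz : x ≠ z) (h : G.DSep x z S) :
    G.VStruct x y z ↔ y ∉ S := by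
  refine ⟨fun hv => notMem_of_dSep_of_collider hv.1 hv.2.1 hxz h, fun hy => ?_⟩
  by_contra hn
  refine hy (mem_of_dSep_of_not_collider hxy hyz.symm hxz (fun hc => hn ?_) h)
  exact ⟨hc.1, hc.2, hxz, fun ha => not_dSep_of_adj ha h⟩

lemma VStruct.skeleton_adj {x y z : V} (h : G.VStruct x y z) :
    G.skeleton.Adj x y ∧ G.skeleton.Adj z y :=
  ⟨DAG.skeleton_adj.2 (.inl h.1), DAG.skeleton_adj.2 (.inl h.2.1)⟩

/-- The easy half of the Verma-Pearl theorem: adjacency means that no set separates, and colliders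
are read off from any separating set. -/
lemma MarkovEquiv.samePattern [Fintype V] (h : G.MarkovEquiv H) : G.SamePattern H := by
  have hsk : ∀ x y, G.skeleton.Adj x y ↔ H.skeleton.Adj x y := by
    intro x y
    by_cases hxy : x = y
    · subst hxy; simp
    · rw [← not_iff_not, ← exists_dSep_iff hxy, ← exists_dSep_iff hxy]
      exact exists_congr fun S => and_congr_right fun h1 => and_congr_right fun h2 =>
        h x y S hxy h1 h2
  refine ⟨hsk, fun x y z => ?_⟩
  by_cases hxz : x ≠ z ∧ ¬ G.skeleton.Adj x z
  swap
  · refine iff_of_false (fun h => hxz h.2.2) fun h => hxz ⟨h.2.2.1, ?_⟩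
    rw [hsk]; exact h.2.2.2
  by_cases hadj : G.skeleton.Adj x y ∧ G.skeleton.Adj z y
  swap
  · refine iff_of_false (fun h => hadj h.skeleton_adj) fun h => hadj ?_
    rw [hsk, hsk]; exact h.skeleton_adj
  obtain ⟨S, h1, h2, hS⟩ := (exists_dSep_iff hxz.1).2 hxz.2
  rw [vStruct_iff_of_dSep hadj.1 hadj.2 hxz.1 hS,
    vStruct_iff_of_dSep ((hsk _ _).1 hadj.1) ((hsk _ _).1 hadj.2) hxz.1
      ((h x z S hxz.1 h1 h2).1 hS)]

end DAG

/-! ### Active walks, covered edge reversals and Markov equivalence -/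

namespace DAG

variable {V : Type*} {G H : DAG V} {S : Finset V}

/-- `w` is an ancestor of a node in `S` (or in `S` itself). -/
def Anc (G : DAG V) (S : Finset V) (w : V) : Prop := ∃ d ∈ S, Relation.ReflTransGen G.Adj w d

/-- The states that can be reached from `u` by an active walk; the mark is `true` if the last edge
of the walk points to the last node. -/
inductive Reach (G : DAG V) (S : Finset V) (u : V) : V → Bool → Prop
  | start : Reach G S u u false
  | up {w p : V} : Reach G S u w false → w ∉ S → G.Adj p w → Reach G S u p false
  | down {w c : V} {m : Bool} : Reach G S u w m → w ∉ S → G.Adj w c → Reach G S u c true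
  | bounce {w p : V} : Reach G S u w true → w ∈ S → G.Adj p w → Reach G S u p false

/-- A walk that has arrived at `x` with mark `m` may go on to `z`. -/
def StepOk (G : DAG V) (S : Finset V) (m : Bool) (x z : V) : Prop :=
  (m = true ∧ G.Adj z x ∧ G.Anc S x) ∨ (¬ (m = true ∧ G.Adj z x) ∧ x ∉ S)

lemma stepOk_iff_not_blocks {x y z : V} {m : Bool} (hm : m = true ↔ G.Adj x y) :
    G.StepOk S m y z ↔ ¬ G.Blocks S x y z := by
  simp only [StepOk, hm, Blocks, Anc]
  by_cases h : G.Adj x y ∧ G.Adj z y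
  · simp only [h, true_and, not_true, false_and, or_false, not_forall, not_not]
    exact ⟨fun ⟨d, h1, h2⟩ => ⟨d, h2, h1⟩, fun ⟨d, h1, h2⟩ => ⟨d, h2, h1⟩⟩
  · simp only [h, ← and_assoc, false_and, not_false_eq_true, true_and, false_or]

/-- `bounce` needs the collider itself in `S`. If only a descendant is in `S`, the walk descends to
the first node of `S` on the directed path, bounces there and climbs back to `w`. -/
lemma Reach.turn {u w p : V} (h : G.Reach S u w true) (ha : G.Anc S w) (hp : G.Adj p w) :
    G.Reach S u p false := by
  have key : w ∈ S ∨ (G.Reach S u w false ∧ w ∉ S) := by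
    obtain ⟨d, hd, hwd⟩ := ha
    clear hp
    induction hwd using Relation.ReflTransGen.head_induction_on with
    | refl => exact .inl hd
    | @head a b hab _ ih =>
      by_cases haS : a ∈ S
      · exact .inl haS
      · right
        have hb := h.down haS hab
        refine ⟨?_, haS⟩
        rcases ih hb with h' | ⟨h', hbS⟩
        · exact hb.bounce h' hab
        · exact h'.up hbS hab
  rcases key with h' | ⟨h', hw⟩
  · exact h.bounce h' hp
  · exact h'.up hw hp

lemma Reach.step {u x z : V} {m : Bool} (h : G.Reach S u x m) (hs : G.StepOk S m x z)
    (ha : G.skeleton.Adj x z) : ∃ m', G.Reach S u z m' ∧ (m' = true ↔ G.Adj x z) := by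
  by_cases hxz : G.Adj x z
  · refine ⟨true, h.down ?_ hxz, by simp [hxz]⟩
    rcases hs with hs | hs
    · exact absurd hs.2.1 (asymm hxz)
    · exact hs.2
  · have hzx : G.Adj z x := (skeleton_adj.1 ha).resolve_left hxz
    refine ⟨false, ?_, by simp [hxz]⟩
    rcases hs with ⟨rfl, -, hs⟩ | ⟨hs, hxS⟩
    · exact h.turn hs hzx
    · have : m = false := by simpa [hzx] using hs
      subst this
      exact h.up hxS hzx

/-- The walk may be appended to a walk that has arrived with mark `m`. -/
def Compat (G : DAG V) (S : Finset V) (m : Bool) {x v : V} (w : G.skeleton.Walk x v) : Prop :=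
  ∀ z, [x, z] <+: w.support → G.StepOk S m x z

lemma cons_support {x v : V} (w : G.skeleton.Walk x v) : ∃ t, w.support = x :: t := by
  cases w <;> simp

lemma active_cons {x y v : V} {m : Bool} (h : G.skeleton.Adj x y) (w : G.skeleton.Walk y v)
    (hm : m = true ↔ G.Adj x y) :
    G.Active S (.cons h w) ↔ G.Active S w ∧ G.Compat S m w := by
  obtain ⟨t, ht⟩ := cons_support w
  constructor
  · intro ha
    refine ⟨fun a b c hi => ha a b c ?_, fun z hz => ?_⟩
    · rw [SimpleGraph.Walk.support_cons]
      exact hi.trans (List.suffix_cons _ _).isInfix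
    · refine (stepOk_iff_not_blocks hm).2 (ha x y z ?_)
      rw [SimpleGraph.Walk.support_cons]
      exact ((List.prefix_cons_inj x).2 hz).isInfix
  · rintro ⟨ha, hc⟩ a b c hi
    rw [SimpleGraph.Walk.support_cons, List.infix_cons_iff] at hi
    rcases hi with hi | hi
    · rw [List.cons_prefix_cons] at hi
      obtain ⟨rfl, hi⟩ := hi
      have hb : b = y := by
        rw [ht, List.cons_prefix_cons] at hi
        exact hi.1
      subst hb
      exact (stepOk_iff_not_blocks hm).1 (hc c hi)
    · exact ha a b c hi

lemma compat_cons {x y v : V} {m : Bool} (h : G.skeleton.Adj x y) (w : G.skeleton.Walk y v) :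
    G.Compat S m (.cons h w) ↔ G.StepOk S m x y := by
  obtain ⟨t, ht⟩ := cons_support w
  simp only [Compat, SimpleGraph.Walk.support_cons, ht, List.cons_prefix_cons, true_and,
    List.nil_prefix, and_true, forall_eq]

lemma exists_mark (x y : V) : ∃ m : Bool, m = true ↔ G.Adj x y := by
  classical exact ⟨decide (G.Adj x y), by simp⟩

lemma Reach.of_active {u x v : V} {m : Bool} (h : G.Reach S u x m) (w : G.skeleton.Walk x v)
    (ha : G.Active S w) (hc : G.Compat S m w) : ∃ m', G.Reach S u v m' := by
  induction w generalizing m with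
  | nil => exact ⟨m, h⟩
  | cons e w ih =>
    obtain ⟨m', h', hm'⟩ := h.step ((compat_cons e w).1 hc) e
    have := (active_cons e w hm').1 ha
    exact ih h' this.1 this.2

/-- If an active walk that starts into `w` along an arrow later leaves a node `u` through an arrow
`u → x` passed from `x` to `u`, it contains a collider, so `w` is an ancestor of `S`. -/
lemma anc_of_active {w v u x : V} (π : G.skeleton.Walk w v) (ha : G.Active S π)
    (hc : G.Compat S true π) (hi : [x, u] <:+: π.support) (hux : G.Adj u x) : G.Anc S w := by
  induction π with
  | nil =>
    have := hi.length_le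
    simp at this
  | @cons w y v e π ih =>
    by_cases hyw : G.Adj y w
    · rcases (compat_cons e π).1 hc with h | h
      · exact h.2.2
      · exact absurd ⟨rfl, hyw⟩ h.1
    · have hwy : G.Adj w y := (skeleton_adj.1 e).resolve_right hyw
      have h1 := (active_cons (m := true) e π (by simpa using hwy)).1 ha
      rw [SimpleGraph.Walk.support_cons, List.infix_cons_iff] at hi
      rcases hi with hi | hi
      · obtain ⟨t, ht⟩ := cons_support π
        rw [ht] at hi
        simp only [List.cons_prefix_cons, List.nil_prefix, and_true] at hi
        obtain ⟨rfl, rfl⟩ := hi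
        exact absurd hux hyw
      · obtain ⟨d, hd, hyd⟩ := ih h1.1 h1.2 hi
        exact ⟨d, hd, .head hwy hyd⟩

/-- An active path that may follow a walk which has arrived at `x` with mark `m`. -/
def Good (G : DAG V) (S : Finset V) (v x : V) (m : Bool) : Prop :=
  ∃ π : G.skeleton.Walk x v, π.IsPath ∧ G.Active S π ∧ G.Compat S m π

/-- Prepending a step to an active path may revisit `x`; the loop is then cut out. What must be
checked is that the shortened path is still unblocked at `x`, where two edges meet that were not
consecutive before. -/
lemma Good.step {v x z : V} {m m' : Bool} (hs : G.StepOk S m x z) (e : G.skeleton.Adj x z)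
    (hm' : m' = true ↔ G.Adj x z) (h : G.Good S v z m') : G.Good S v x m := by
  classical
  obtain ⟨π, hp, ha, hc⟩ := h
  by_cases hx : x ∈ π.support
  swap
  · exact ⟨.cons e π, hp.cons hx, (active_cons e π hm').2 ⟨ha, hc⟩, (compat_cons e π).2 hs⟩
  have hsp : ∃ l, π.support = l ++ (π.dropUntil x hx).support := by
    obtain ⟨l, hl⟩ := SimpleGraph.Walk.support_dropUntil_suffix_support π hx
    exact ⟨l, hl.symm⟩
  obtain ⟨l, hl⟩ := hsp
  obtain ⟨t, ht⟩ := cons_support (π.dropUntil x hx)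
  have hl0 : l ≠ [] := by
    rintro rfl
    obtain ⟨t', ht'⟩ := cons_support π
    rw [ht', List.nil_append, ht] at hl
    exact e.ne (List.cons.inj hl).1.symm
  -- `r` is the node before `x` on the old path; it exists because the path starts at `z ≠ x`.
  obtain ⟨l', r, rfl⟩ : ∃ l' r, l = l' ++ [r] :=
    ⟨_, _, (List.dropLast_append_getLast hl0).symm⟩
  refine ⟨π.dropUntil x hx, hp.dropUntil hx, fun a b c hi => ha a b c ?_, fun y hy => ?_⟩
  · rw [hl]; exact hi.trans (List.suffix_append _ _).isInfix
  have hry : [r, x, y] <:+: π.support := by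
    rw [hl, List.append_assoc]
    exact ((List.prefix_cons_inj r).2 hy).isInfix.trans (List.suffix_append _ _).isInfix
  have hrx : [r, x] <:+: π.support :=
    (show [r, x] <+: [r, x, y] from ⟨[y], rfl⟩).isInfix.trans hry
  have hnb := ha r x y hry
  obtain ⟨k, hk⟩ := exists_mark (G := G) r x
  have hok := (stepOk_iff_not_blocks hk).2 hnb
  by_cases hcol : m = true ∧ G.Adj y x
  · left
    refine ⟨hcol.1, hcol.2, ?_⟩
    rcases hok with h | ⟨h, -⟩
    · exact h.2.2
    · rcases hs with h' | h'
      · exact h'.2.2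
      -- The new collider at `x` comes from no old one: the loop leaves `x` along `x → z` and
      -- reenters it against `x → r`. It therefore contains a collider, whose descendant in `S` is
      -- also one of `x`.
      · have hxz : G.Adj x z :=
          (skeleton_adj.1 e).resolve_right fun hzx => h'.1 ⟨hcol.1, hzx⟩
        have hxr : G.Adj x r := by
          have h2 : ¬ G.Adj r x := fun h3 => h ⟨hk.2 h3, hcol.2⟩
          have h3 : G.skeleton.Adj r x := by
            have := π.isChain_adj_support
            exact (List.isChain_pair.1 (this.infix hrx))
          exact (skeleton_adj.1 h3).resolve_left h2
        rw [hm'.2 hxz] at hc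
        obtain ⟨d, hd, hzd⟩ := anc_of_active π ha hc hrx hxr
        exact ⟨d, hd, .head hxz hzd⟩
  · right
    refine ⟨hcol, ?_⟩
    cases m with
    | false =>
      rcases hs with h | h
      · exact absurd h.1 (by simp)
      · exact h.2
    | true =>
      have hyx : ¬ G.Adj y x := fun h => hcol ⟨rfl, h⟩
      rcases hok with h | h
      · exact absurd h.2.1 hyx
      · exact h.2

lemma good_of_reach {u v x : V} {m : Bool} (h : G.Reach S u x m) (hg : G.Good S v x m) :
    G.Good S v u false := by
  induction h with
  | start => exact hg
  | @up w p _ hw hp ih =>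
    exact ih (hg.step (.inr ⟨by simp, hw⟩) (skeleton_adj.2 (.inr hp)) (by simpa using asymm hp))
  | @down w c m _ hw hc ih =>
    exact ih (hg.step (.inr ⟨fun h => asymm hc h.2, hw⟩) (skeleton_adj.2 (.inl hc))
      (by simpa using hc))
  | @bounce w p _ hw hp ih =>
    exact ih (hg.step (.inl ⟨rfl, hp, ⟨w, hw, .refl⟩⟩) (skeleton_adj.2 (.inr hp))
      (by simpa using asymm hp))

/-- d-connection by paths and reachability by active walks agree. -/
lemma not_dSep_iff_reach {u v : V} (hu : u ∉ S) :
    ¬ G.DSep u v S ↔ ∃ m, G.Reach S u v m := by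
  rw [not_dSep_iff]
  constructor
  · rintro ⟨w, -, ha⟩
    exact Reach.start.of_active w ha fun z _ => .inr ⟨by simp, hu⟩
  · rintro ⟨m, h⟩
    have hv : G.Good S v v m := by
      refine ⟨.nil, by simp, ?_, ?_⟩ <;> intro a
      · intro b c hi
        have := hi.length_le
        simp at this
      · intro hi
        have := hi.length_le
        simp at this
    obtain ⟨π, hp, ha, -⟩ := good_of_reach h hv
    exact ⟨π, hp, ha⟩

/-! ### Covered edges -/

lemma eq_of_adj (h : G.Adj = H.Adj) : G = H := by
  obtain ⟨⟨A⟩, hA⟩ := G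
  obtain ⟨⟨B⟩, hB⟩ := H
  obtain rfl : A = B := h
  rfl

/-- The edge `x → y` is covered: the parents of `y` are `x` and the parents of `x`. -/
def Covered (G : DAG V) (x y : V) : Prop :=
  G.Adj x y ∧ ∀ z, z ≠ x → (G.Adj z y ↔ G.Adj z x)

/-- Reversal of the edge `x → y`. -/
def revAdj (G : DAG V) (x y : V) (a b : V) : Prop :=
  (a = y ∧ b = x) ∨ (¬ (a = x ∧ b = y) ∧ G.Adj a b)

/-- A path is cut at the first and the last use of the new edge `y → x`, so that acyclicity only
needs paths of the old graph without `x → y`. -/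
lemma transGen_of_revAdj {x y a b : V} (h : Relation.TransGen (G.revAdj x y) a b) :
    Relation.TransGen (fun a b => ¬ (a = x ∧ b = y) ∧ G.Adj a b) a b ∨
      (Relation.ReflTransGen (fun a b => ¬ (a = x ∧ b = y) ∧ G.Adj a b) a y ∧
        Relation.ReflTransGen (fun a b => ¬ (a = x ∧ b = y) ∧ G.Adj a b) x b) := by
  induction h with
  | single h =>
    rcases h with ⟨rfl, rfl⟩ | h
    · exact .inr ⟨.refl, .refl⟩
    · exact .inl (.single h)
  | tail _ h ih =>
    rcases h with ⟨rfl, rfl⟩ | h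
    · rcases ih with ih | ih
      · exact .inr ⟨ih.to_reflTransGen, .refl⟩
      · exact .inr ⟨ih.1, .refl⟩
    · rcases ih with ih | ih
      · exact .inl (ih.tail h)
      · exact .inr ⟨ih.1, ih.2.tail h⟩

/-- The DAG obtained by reversal of a covered edge. -/
def reverse (G : DAG V) (x y : V) (hc : G.Covered x y) : DAG V where
  Adj := G.revAdj x y
  acyclic := by
    intro v hv
    rcases transGen_of_revAdj hv with h | ⟨h1, h2⟩
    · exact G.acyclic v (Relation.TransGen.mono (fun _ _ h => h.2) v v h)
    · rcases Relation.reflTransGen_iff_eq_or_transGen.1 (h2.trans h1) with h | h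
      · exact ne_of_adj hc.1 h.symm
      · obtain ⟨z, hz, hzy⟩ := Relation.TransGen.tail'_iff.1 h
        have hzx : z ≠ x := fun h => hzy.1 ⟨h, rfl⟩
        have hz' : Relation.ReflTransGen G.Adj x z :=
          Relation.ReflTransGen.mono (fun _ _ h => h.2) x z hz
        exact G.acyclic x (.tail' hz' ((hc.2 z hzx).1 hzy.2))

variable {x y : V}

lemma reverse_adj (hc : G.Covered x y) {a b : V} :
    (G.reverse x y hc).Adj a b ↔ (a = y ∧ b = x) ∨ (¬ (a = x ∧ b = y) ∧ G.Adj a b) := Iff.rfl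

lemma covered_reverse (hc : G.Covered x y) : (G.reverse x y hc).Covered y x := by
  refine ⟨.inl ⟨rfl, rfl⟩, fun z hz => ?_⟩
  have hxy := ne_of_adj hc.1
  simp only [reverse_adj, hz, hxy.symm, false_or, hxy, and_false, and_true,
    not_false_eq_true, true_and]
  by_cases hzx : z = x
  · subst hzx; simp [irrefl]
  · simp [hzx, hc.2 z hzx]

lemma reverse_reverse_adj (hc : G.Covered x y) {a b : V} :
    ((G.reverse x y hc).reverse y x (covered_reverse hc)).Adj a b ↔ G.Adj a b := by
  rw [reverse_adj, reverse_adj]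
  by_cases h1 : a = x ∧ b = y
  · obtain ⟨rfl, rfl⟩ := h1; simp [hc.1]
  · by_cases h2 : a = y ∧ b = x
    · obtain ⟨rfl, rfl⟩ := h2
      simp [(ne_of_adj hc.1).symm, asymm hc.1]
    · tauto

lemma reverse_reverse (hc : G.Covered x y) :
    (G.reverse x y hc).reverse y x (covered_reverse hc) = G := by
  apply eq_of_adj
  ext a b
  exact reverse_reverse_adj hc

/-- What reachability of `(w, m)` in `G` says about `G` with the covered edge reversed. -/
def RevInv (T : V → Bool → Prop) (S : Finset V) (x y w : V) (m : Bool) : Prop :=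
  (w ≠ x → w ≠ y → T w m) ∧
  (w = x → m = false → T x false ∨ (T y false ∧ y ∉ S) ∨ (T x true ∧ T y true ∧ y ∈ S)) ∧
  (w = x → m = true → T x true ∧ T y true) ∧
  (w = y → m = false → T y false) ∧
  (w = y → m = true → (T x true ∧ T y true) ∨ (T x false ∧ x ∉ S) ∨ (T y false ∧ y ∉ S))

/-- Apart from the edge between them, `x` and `y` have the same parents, so an arrow from outside
into one can be exchanged for an arrow into the other. A walk through `x → y` is rerouted in this
way or uses `y → x`; the alternatives in `RevInv` record which detour is available. -/
lemma revInv_of_reach (hc : G.Covered x y) {u w : V} {m : Bool} (h : G.Reach S u w m) :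
    RevInv ((G.reverse x y hc).Reach S u) S x y w m := by
  have hxy := ne_of_adj hc.1
  have hyx := hxy.symm
  set T := (G.reverse x y hc).Reach S u with hT
  have hyx' : (G.reverse x y hc).Adj y x := .inl ⟨rfl, rfl⟩
  have hadj : ∀ {a b}, ¬ (a = x ∧ b = y) → G.Adj a b → (G.reverse x y hc).Adj a b :=
    fun h1 h2 => .inr ⟨h1, h2⟩
  have hpx : ∀ {a}, a ≠ x → G.Adj a y → (G.reverse x y hc).Adj a x := fun h1 h2 =>
    hadj (fun h => h1 h.1) ((hc.2 _ h1).1 h2)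
  have hpy : ∀ {a}, a ≠ x → G.Adj a x → (G.reverse x y hc).Adj a y := fun h1 h2 =>
    hadj (fun h => h1 h.1) ((hc.2 _ h1).2 h2)
  induction h with
  | start =>
    exact ⟨fun _ _ => .start, fun e _ => .inl (e ▸ .start), by simp, fun e _ => e ▸ .start,
      by simp⟩
  | @up w p _ hw hp ih =>
    obtain ⟨h0, h1, h2, h3, h4⟩ := ih
    have hpw := ne_of_adj hp
    by_cases hwx : w = x
    · subst hwx
      have hpy' : p ≠ y := fun h => asymm hc.1 (h ▸ hp)
      refine ⟨fun _ _ => ?_, fun h => absurd h hpw, by simp, fun h => absurd h hpy', by simp⟩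
      rcases h1 rfl rfl with h | h | h
      · exact h.up hw (hadj (fun h => hpw h.1) hp)
      · exact h.1.up h.2 (hpy hpw hp)
      · exact h.2.1.bounce h.2.2 (hpy hpw hp)
    by_cases hwy : w = y
    · subst hwy
      have h := h3 rfl rfl
      exact ⟨fun hpx _ => h.up hw (hadj (fun h => hpx h.1) hp), fun _ _ => .inr (.inl ⟨h, hw⟩),
        by simp, fun h => absurd h hpw, by simp⟩
    · have h := (h0 hwx hwy).up hw (hadj (fun h => hwy h.2) hp)
      exact ⟨fun _ _ => h, fun e _ => .inl (e ▸ h), by simp, fun e _ => e ▸ h, by simp⟩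
  | @down w c m _ hw hwc ih =>
    obtain ⟨h0, h1, h2, h3, h4⟩ := ih
    have hne := ne_of_adj hwc
    by_cases hwx : w = x
    · subst hwx
      refine ⟨fun _ hcy => ?_, by simp, fun h => absurd h.symm hne, by simp, fun _ _ => ?_⟩
      · have ha : (G.reverse w y hc).Adj w c := hadj (fun h => hcy h.2) hwc
        cases m with
        | false =>
          rcases h1 rfl rfl with h | h | h
          · exact h.down hw ha
          · exact (h.1.down h.2 hyx').down hw ha
          · exact h.1.down hw ha
        | true => exact (h2 rfl rfl).1.down hw ha
      · cases m with
        | false =>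
          rcases h1 rfl rfl with h | h | h
          · exact .inr (.inl ⟨h, hw⟩)
          · exact .inr (.inr h)
          · exact .inl ⟨h.1, h.2.1⟩
        | true => exact .inl (h2 rfl rfl)
    by_cases hwy : w = y
    · subst hwy
      have hcx : c ≠ x := fun h => asymm hc.1 (h ▸ hwc)
      have ha : (G.reverse x w hc).Adj w c := hadj (fun h => hxy h.1.symm) hwc
      refine ⟨fun _ _ => ?_, by simp, fun h => absurd h hcx, by simp,
        fun h => absurd h.symm hne⟩
      cases m with
      | false => exact (h3 rfl rfl).down hw ha
      | true =>
        rcases h4 rfl rfl with h | h | h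
        · exact h.2.down hw ha
        · exact (h.1.up h.2 hyx').down hw ha
        · exact h.1.down hw ha
    · have h := h0 hwx hwy
      have ha := hadj (fun h => hwx h.1) hwc
      refine ⟨fun _ _ => h.down hw ha, by simp, fun e _ => ?_, by simp, fun e _ => .inl ?_⟩
      · subst e
        exact ⟨h.down hw ha, h.down hw (hpy hwx hwc)⟩
      · subst e
        exact ⟨h.down hw (hpx hwx hwc), h.down hw ha⟩
  | @bounce w p _ hw hp ih =>
    obtain ⟨h0, h1, h2, h3, h4⟩ := ih
    have hpw := ne_of_adj hp
    by_cases hwx : w = x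
    · subst hwx
      have hpy' : p ≠ y := fun h => asymm hc.1 (h ▸ hp)
      exact ⟨fun _ _ => (h2 rfl rfl).1.bounce hw (hadj (fun h => hpw h.1) hp),
        fun h => absurd h hpw, by simp, fun h => absurd h hpy', by simp⟩
    by_cases hwy : w = y
    · subst hwy
      refine ⟨fun hpx' _ => ?_, fun _ _ => ?_, by simp, fun h => absurd h hpw, by simp⟩
      · rcases h4 rfl rfl with h | h | h
        · exact h.2.bounce hw (hadj (fun h => hpx' h.1) hp)
        · exact h.1.up h.2 (hpx hpx' hp)
        · exact absurd hw h.2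
      · rcases h4 rfl rfl with h | h | h
        · exact .inr (.inr ⟨h.1, h.2, hw⟩)
        · exact .inl h.1
        · exact absurd hw h.2
    · have h := (h0 hwx hwy).bounce hw (hadj (fun h => hwy h.2) hp)
      exact ⟨fun _ _ => h, fun e _ => .inl (e ▸ h), by simp, fun e _ => e ▸ h, by simp⟩

/-- Reversal of a covered edge does not change d-separation. -/
lemma dSep_reverse_aux (hc : G.Covered x y) {u v : V} (hu : u ∉ S)
    (h : (G.reverse x y hc).DSep u v S) : G.DSep u v S := by
  by_contra hn
  obtain ⟨m, hm⟩ := (not_dSep_iff_reach hu).1 hn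
  refine (not_dSep_iff_reach hu).2 ?_ h
  have hyx' : (G.reverse x y hc).Adj y x := .inl ⟨rfl, rfl⟩
  obtain ⟨h0, h1, h2, h3, h4⟩ := revInv_of_reach hc hm
  by_cases hvx : v = x
  · subst hvx
    cases m with
    | false =>
      rcases h1 rfl rfl with h | h | h
      · exact ⟨_, h⟩
      · exact ⟨_, h.1.down h.2 hyx'⟩
      · exact ⟨_, h.1⟩
    | true => exact ⟨_, (h2 rfl rfl).1⟩
  · by_cases hvy : v = y
    · subst hvy
      cases m with
      | false => exact ⟨_, h3 rfl rfl⟩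
      | true =>
        rcases h4 rfl rfl with h | h | h
        · exact ⟨_, h.2⟩
        · exact ⟨_, h.1.up h.2 hyx'⟩
        · exact ⟨_, h.1⟩
    · exact ⟨_, h0 hvx hvy⟩

lemma markovEquiv_reverse (hc : G.Covered x y) : G.MarkovEquiv (G.reverse x y hc) := by
  refine fun u v S _ hu _ => ⟨fun h => ?_, dSep_reverse_aux hc hu⟩
  refine dSep_reverse_aux (covered_reverse hc) hu ?_
  rwa [reverse_reverse]

lemma samePattern_reverse [Fintype V] (hc : G.Covered x y) :
    G.SamePattern (G.reverse x y hc) := (markovEquiv_reverse hc).samePattern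

lemma wellFounded_transGen [Finite V] (G : DAG V) : WellFounded (Relation.TransGen G.Adj) := by
  have : Std.Irrefl (Relation.TransGen G.Adj) := ⟨G.acyclic⟩
  exact Finite.wellFounded_of_trans_of_irrefl _

lemma wellFounded_transGen_flip [Finite V] (G : DAG V) :
    WellFounded (fun a b => Relation.TransGen G.Adj b a) := by
  have : Std.Irrefl (fun a b => Relation.TransGen G.Adj b a) := ⟨G.acyclic⟩
  have : IsTrans V (fun a b => Relation.TransGen G.Adj b a) := ⟨fun _ _ _ h1 h2 => h2.trans h1⟩
  exact Finite.wellFounded_of_trans_of_irrefl _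

/-- Two different DAGs with the same pattern differ by the orientation of a covered edge. -/
lemma SamePattern.exists_covered [Finite V] (h : G.SamePattern H) (hne : G ≠ H) :
    ∃ x y, G.Covered x y ∧ H.Adj y x := by
  have hwf := G.wellFounded_transGen
  have hwf' := G.wellFounded_transGen_flip
  have hGH : ∀ {a b}, G.Adj a b → H.Adj a b ∨ H.Adj b a := fun hab =>
    skeleton_adj.1 ((h.1 _ _).1 (skeleton_adj.2 (.inl hab)))
  have hHG : ∀ {a b}, H.Adj a b → G.Adj a b ∨ G.Adj b a := fun hab =>
    skeleton_adj.1 ((h.1 _ _).2 (skeleton_adj.2 (.inl hab)))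
  have hex : ∃ y x, G.Adj x y ∧ H.Adj y x := by
    by_contra hn
    push Not at hn
    refine hne (eq_of_adj ?_)
    ext a b
    refine ⟨fun hab => (hGH hab).resolve_right (hn b a hab), fun hab => ?_⟩
    exact (hHG hab).resolve_right fun hba => hn a b hba hab
  -- Chickering's choice: among the edges that `H` reverses, a head `y` without an earlier such
  -- head, and then the latest possible tail `x`.
  obtain ⟨y, ⟨x₀, hx₀⟩, hy⟩ := hwf.has_min {y | ∃ x, G.Adj x y ∧ H.Adj y x} hex
  obtain ⟨x, hx, hx'⟩ := hwf'.has_min {x | G.Adj x y ∧ H.Adj y x} ⟨x₀, hx₀⟩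
  have hmin : ∀ {a b}, G.Adj a b → H.Adj b a → ¬ Relation.TransGen G.Adj b y :=
    fun h1 h2 => hy _ ⟨_, h1, h2⟩
  have hxy := hx.1
  have hyx := hx.2
  refine ⟨x, y, ⟨hxy, fun z hzx => ⟨fun hzy => ?_, fun hzx' => ?_⟩⟩, hyx⟩
  · by_contra hn
    have hadj : G.skeleton.Adj z x := by
      by_contra hn'
      have := ((h.2 z y x).1 ⟨hzy, hxy, hzx, hn'⟩).2.1
      exact asymm hyx this
    have hxz := (skeleton_adj.1 hadj).resolve_left hn
    rcases hGH hzy with h1 | h1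
    · rcases hGH hxz with h2 | h2
      · exact H.acyclic x (.tail (.tail (.single h2) h1) hyx)
      · exact hmin hxz h2 (.single hzy)
    · exact hx' z ⟨hzy, h1⟩ (.single hxz)
  · have hzx2 : H.Adj z x := (hGH hzx').resolve_right fun h1 => hmin hzx' h1 (.single hxy)
    have hzy : z ≠ y := fun e => asymm hxy (e ▸ hzx')
    by_contra hn
    have hadj : G.skeleton.Adj z y := by
      by_contra hn'
      have := ((h.2 z x y).2 ⟨hzx2, hyx, hzy, by rwa [← h.1]⟩).2.1
      exact asymm hxy this
    have hyz := (skeleton_adj.1 hadj).resolve_left hn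
    exact G.acyclic y (.tail (.tail (.single hyz) hzx') hxy)

/-- DAGs with the same adjacencies and unshielded colliders are Markov equivalent. -/
theorem SamePattern.markovEquiv [Fintype V] (h : G.SamePattern H) : G.MarkovEquiv H := by
  classical
  -- Induction on the number of edges on which `G` and `H` disagree; reversing a covered one among
  -- them lowers it and stays in the equivalence class.
  obtain ⟨n, hn⟩ : ∃ n, (Finset.univ.filter fun e : V × V =>
    G.Adj e.1 e.2 ∧ H.Adj e.2 e.1).card = n := ⟨_, rfl⟩
  induction n using Nat.strong_induction_on generalizing G with
  | _ n ih =>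
    by_cases hne : G = H
    · subst hne
      exact fun _ _ _ _ _ _ => Iff.rfl
    obtain ⟨x, y, hc, hyx⟩ := h.exists_covered hne
    refine (markovEquiv_reverse hc).trans
      (ih _ ?_ ((samePattern_reverse hc).symm.trans h) rfl)
    rw [← hn]
    refine Finset.card_lt_card (Finset.ssubset_iff_of_subset ?_ |>.2 ⟨(x, y), ?_, ?_⟩)
    · intro e he
      simp only [Finset.mem_filter, Finset.mem_univ, true_and, reverse_adj] at he ⊢
      refine ⟨?_, he.2⟩
      rcases he.1 with h1 | h1
      · exact absurd he.2 (by rw [h1.1, h1.2]; exact asymm hyx)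
      · exact h1.2
    · simp [hc.1, hyx]
    · simp [reverse_adj, ne_of_adj hc.1]

end DAG

/-! ### Simplicial vertices and perfect orderings -/

section Chordal

variable {V : Type*} [DecidableEq V]

/-- The neighbours of `v` in `W` form a clique. -/
def Simplicial (U : V → V → Prop) (W : Finset V) (v : V) : Prop :=
  ∀ x ∈ W, ∀ y ∈ W, x ≠ y → U v x → U v y → U x y

/-- **Dirac's lemma**: if every nonempty induced subgraph has a simplicial vertex, then it is
complete or has two nonadjacent simplicial vertices. -/
lemma clique_or_exists_simplicial {U : V → V → Prop} (hU : ∀ x y, U x y → U y x)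
    (h : ∀ W : Finset V, W.Nonempty → ∃ v ∈ W, Simplicial U W v) (W : Finset V) :
    (∀ x ∈ W, ∀ y ∈ W, x ≠ y → U x y) ∨
      ∃ x ∈ W, ∃ y ∈ W, x ≠ y ∧ ¬ U x y ∧ Simplicial U W x ∧ Simplicial U W y := by
  obtain ⟨n, hn⟩ : ∃ n, W.card = n := ⟨_, rfl⟩
  induction n generalizing W with
  | zero =>
    left
    rw [Finset.card_eq_zero] at hn
    simp [hn]
  | succ n ih =>
    obtain ⟨v, hv, hs⟩ := h W (Finset.card_pos.1 (by omega))
    -- Adding `v` back does not enlarge the neighbourhood of a node that is not adjacent to `v`.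
    have hext : ∀ x ∈ W.erase v, ¬ U v x → Simplicial U (W.erase v) x → Simplicial U W x := by
      intro x _ hvx hx a ha b hb hab hxa hxb
      have ha' : a ≠ v := by rintro rfl; exact hvx (hU _ _ hxa)
      have hb' : b ≠ v := by rintro rfl; exact hvx (hU _ _ hxb)
      exact hx a (Finset.mem_erase.2 ⟨ha', ha⟩) b (Finset.mem_erase.2 ⟨hb', hb⟩) hab hxa hxb
    have hres : ∀ x ∈ W.erase v, ¬ U v x → Simplicial U (W.erase v) x →
        ∃ x ∈ W, ∃ y ∈ W, x ≠ y ∧ ¬ U x y ∧ Simplicial U W x ∧ Simplicial U W y :=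
      fun x hx hvx hsx => ⟨v, hv, x, Finset.mem_of_mem_erase hx,
        (Finset.ne_of_mem_erase hx).symm, hvx, hs, hext x hx hvx hsx⟩
    rcases ih (W.erase v) (by rw [Finset.card_erase_of_mem hv, hn]; rfl) with hc | hc
    · by_cases hall : ∀ x ∈ W.erase v, U v x
      · left
        intro x hx y hy hxy
        by_cases hxv : x = v
        · subst hxv
          exact hall y (Finset.mem_erase.2 ⟨hxy.symm, hy⟩)
        by_cases hyv : y = v
        · subst hyv
          exact hU _ _ (hall x (Finset.mem_erase.2 ⟨hxy, hx⟩))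
        · exact hc x (Finset.mem_erase.2 ⟨hxv, hx⟩) y (Finset.mem_erase.2 ⟨hyv, hy⟩) hxy
      · right
        push Not at hall
        obtain ⟨x, hx, hvx⟩ := hall
        exact hres x hx hvx fun a ha b hb hab _ _ => hc a ha b hb hab
    · right
      obtain ⟨x, hx, y, hy, hxy, hnxy, hsx, hsy⟩ := hc
      by_cases hvx : U v x
      · by_cases hvy : U v y
        · exact absurd (hs x (Finset.mem_of_mem_erase hx) y (Finset.mem_of_mem_erase hy) hxy
            hvx hvy) hnxy
        · exact hres y hy hvy hsy
      · exact hres x hx hvx hsx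

/-- Such a graph has an acyclic orientation (given by a ranking of the nodes) without unshielded
colliders that starts from any given node. -/
lemma exists_rank {U : V → V → Prop} (hU : ∀ x y, U x y → U y x)
    (h : ∀ W : Finset V, W.Nonempty → ∃ v ∈ W, Simplicial U W v) (a : V) (W : Finset V)
    (ha : a ∈ W) :
    ∃ r : V → ℕ, Set.InjOn r W ∧ (∀ x ∈ W, x ≠ a → r a < r x) ∧
      ∀ x ∈ W, ∀ y ∈ W, ∀ z ∈ W, x ≠ y → U x z → U y z → r x < r z → r y < r z → U x y := by
  obtain ⟨n, hn⟩ : ∃ n, W.card = n := ⟨_, rfl⟩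
  induction n generalizing W with
  | zero =>
    rw [Finset.card_eq_zero] at hn
    simp [hn] at ha
  | succ n ih =>
    by_cases h1 : W = {a}
    · subst h1
      refine ⟨fun _ => 0, by simp, by simp, by simp⟩
    -- A simplicial node other than `a` is ranked last: its earlier neighbours form a clique.
    -- Dirac's lemma supplies one that differs from `a`.
    have hv : ∃ v ∈ W, v ≠ a ∧ Simplicial U W v := by
      rcases clique_or_exists_simplicial hU h W with hc | ⟨x, hx, y, hy, hxy, -, hsx, hsy⟩
      · obtain ⟨v, hv, hva⟩ : ∃ v ∈ W, v ≠ a := by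
          by_contra! hn
          exact h1 (Finset.eq_singleton_iff_unique_mem.2 ⟨ha, hn⟩)
        exact ⟨v, hv, hva, fun x hx y hy hxy _ _ => hc x hx y hy hxy⟩
      · by_cases hxa : x = a
        · exact ⟨y, hy, fun h => hxy (hxa.trans h.symm), hsy⟩
        · exact ⟨x, hx, hxa, hsx⟩
    obtain ⟨v, hv, hva, hs⟩ := hv
    obtain ⟨r, hr1, hr2, hr3⟩ := ih (W.erase v) (Finset.mem_erase.2 ⟨hva.symm, ha⟩)
      (by rw [Finset.card_erase_of_mem hv, hn]; rfl)
    have hlt : ∀ x ∈ W, x ≠ v → r x < W.sup r + 1 := fun x hx _ =>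
      Nat.lt_succ_of_le (Finset.le_sup hx)
    have hmem : ∀ {x}, x ∈ W → x ≠ v → x ∈ W.erase v := fun hx hxv =>
      Finset.mem_erase.2 ⟨hxv, hx⟩
    refine ⟨Function.update r v (W.sup r + 1), ?_, ?_, ?_⟩
    · intro x hx y hy hxy
      by_cases hxv : x = v <;> by_cases hyv : y = v
      · rw [hxv, hyv]
      · subst hxv
        have := hlt y hy hyv
        simp [hyv] at hxy; omega
      · subst hyv
        have := hlt x hx hxv
        simp [hxv] at hxy; omega
      · simp only [ne_eq, hxv, not_false_eq_true, Function.update_of_ne, hyv] at hxy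
        exact hr1 (hmem hx hxv) (hmem hy hyv) hxy
    · intro x hx hxa
      rw [Function.update_of_ne hva.symm]
      by_cases hxv : x = v
      · subst hxv
        simpa using hlt a ha hva.symm
      · rw [Function.update_of_ne hxv]
        exact hr2 x (hmem hx hxv) hxa
    · intro x hx y hy z hz hxy hxz hyz h1 h2
      by_cases hzv : z = v
      · subst hzv
        exact hs x hx y hy hxy (hU _ _ hxz) (hU _ _ hyz)
      · rw [Function.update_of_ne hzv] at h1 h2
        have key : ∀ w ∈ W, Function.update r v (W.sup r + 1) w < r z → w ≠ v ∧ r w < r z := by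
          intro w _ hw
          by_cases hwv : w = v
          · subst hwv
            have := hlt z hz hzv
            simp at hw; omega
          · rw [Function.update_of_ne hwv] at hw
            exact ⟨hwv, hw⟩
        obtain ⟨hx', h1⟩ := key x hx h1
        obtain ⟨hy', h2⟩ := key y hy h2
        exact hr3 x (hmem hx hx') y (hmem hy hy') z (hmem hz hzv) hxy hxz hyz h1 h2

end Chordal

/-! ### Soundness and completeness of the orientation rules -/

section Meek

variable {p : ℕ} {G : DAG (Fin p)} {E : Finset (Fin p × Fin p)}

/-- The reasons for which an edge `a → b` gets its direction. -/
def Justified (G : DAG (Fin p)) (E : Finset (Fin p × Fin p)) (a b : Fin p) : Prop :=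
  (∃ d, G.VStruct a b d) ∨ (∃ d, IsDir E d a ∧ NonAdj E d b) ∨ (∃ d, IsDir E a d ∧ IsDir E d b) ∨
    ∃ d e, d ≠ e ∧ NonAdj E d e ∧ IsDir E d b ∧ IsDir E e b ∧ G.skeleton.Adj a d ∧
      G.skeleton.Adj a e ∧ ¬ (G.Adj d a ∧ G.Adj e a)

/-- The invariants of the orientation phase. -/
structure OrientInv (G : DAG (Fin p)) (E : Finset (Fin p × Fin p)) : Prop where
  sub : ∀ a b, (a, b) ∈ E → G.skeleton.Adj a b
  sound : ∀ H : DAG (Fin p), G.SamePattern H → ∀ a b, H.Adj a b → (a, b) ∈ E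
  vstruct : ∀ a b c, G.VStruct a b c → (b, a) ∉ E
  just : ∀ a b, IsDir E a b → Justified G E a b

namespace OrientInv

lemma adj_mem (h : OrientInv G E) {a b : Fin p} (hab : G.Adj a b) : (a, b) ∈ E :=
  h.sound G ⟨fun _ _ => Iff.rfl, fun _ _ _ => Iff.rfl⟩ a b hab

lemma nonAdj_iff (h : OrientInv G E) {a b : Fin p} : NonAdj E a b ↔ ¬ G.skeleton.Adj a b := by
  refine ⟨fun hn ha => ?_, fun hn => ⟨fun h' => hn (h.sub _ _ h'), fun h' =>
    hn (h.sub _ _ h').symm⟩⟩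
  rcases DAG.skeleton_adj.1 ha with h' | h'
  exacts [hn.1 (h.adj_mem h'), hn.2 (h.adj_mem h')]

lemma adj_of_isDir (h : OrientInv G E) {H : DAG (Fin p)} (hH : G.SamePattern H) {a b : Fin p}
    (hab : IsDir E a b) : H.Adj a b := by
  have := (hH.1 _ _).1 (h.sub _ _ hab.1)
  exact (DAG.skeleton_adj.1 this).resolve_right fun h' => hab.2 (h.sound H hH _ _ h')

lemma adj_of_isDir' (h : OrientInv G E) {a b : Fin p} (hab : IsDir E a b) : G.Adj a b :=
  h.adj_of_isDir ⟨fun _ _ => Iff.rfl, fun _ _ _ => Iff.rfl⟩ hab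

lemma trichotomy (h : OrientInv G E) {a b : Fin p} (hab : G.skeleton.Adj a b) :
    IsDir E a b ∨ IsDir E b a ∨ IsUndir E a b := by
  by_cases h1 : (a, b) ∈ E <;> by_cases h2 : (b, a) ∈ E
  · exact .inr (.inr ⟨h1, h2⟩)
  · exact .inl ⟨h1, h2⟩
  · exact .inr (.inl ⟨h2, h1⟩)
  · exact absurd hab (h.nonAdj_iff.1 ⟨h1, h2⟩)

/-- With `b → a`, R1 would give a new unshielded collider `c → a ← b` and R2 a cycle. In R3
acyclicity would force `c → a` and `d → a`, again an unshielded collider that should already have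
been oriented. -/
lemma not_adj_of_orientRule (h : OrientInv G E) {a b : Fin p} (hr : OrientRule E a b)
    {H : DAG (Fin p)} (hH : G.SamePattern H) : ¬ H.Adj b a := by
  intro hba
  obtain ⟨hu, ⟨c, hca, hcb⟩ | ⟨c, hac, hcb⟩ | ⟨c, d, hcd, hn, hac, hcb, had, hdb⟩⟩ := hr
  · have hne : c ≠ b := by rintro rfl; exact hca.2 hu.1
    have hv : H.VStruct c a b :=
      ⟨h.adj_of_isDir hH hca, hba, hne, by rw [← hH.1]; exact h.nonAdj_iff.1 hcb⟩
    exact h.vstruct _ _ _ ((hH.2 _ _ _).2 hv).symm hu.1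
  · exact H.acyclic a (.tail (.tail (.single (h.adj_of_isDir hH hac)) (h.adj_of_isDir hH hcb)) hba)
  · have key : ∀ e, IsUndir E a e → IsDir E e b → H.Adj e a := by
      intro e hae heb
      refine (DAG.skeleton_adj.1 ((hH.1 _ _).1 (h.sub _ _ hae.2))).resolve_right fun h' => ?_
      exact H.acyclic a (.tail (.tail (.single h') (h.adj_of_isDir hH heb)) hba)
    have hv : H.VStruct c a d :=
      ⟨key c hac hcb, key d had hdb, hcd, by rw [← hH.1]; exact h.nonAdj_iff.1 hn⟩
    exact h.vstruct _ _ _ ((hH.2 _ _ _).2 hv) hac.1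

lemma erase (h : OrientInv G E) {a b : Fin p} (hr : OrientRule E a b) :
    OrientInv G (E.erase (b, a)) := by
  have hdir : ∀ {x y}, IsDir E x y → IsDir (E.erase (b, a)) x y := by
    rintro x y ⟨h1, h2⟩
    refine ⟨Finset.mem_erase.2 ⟨?_, h1⟩, fun h' => h2 (Finset.mem_of_mem_erase h')⟩
    intro he
    obtain ⟨rfl, rfl⟩ := Prod.mk.inj he
    exact h2 hr.1.1
  have hnon : ∀ {x y}, NonAdj E x y → NonAdj (E.erase (b, a)) x y := fun ⟨h1, h2⟩ =>
    ⟨fun h' => h1 (Finset.mem_of_mem_erase h'), fun h' => h2 (Finset.mem_of_mem_erase h')⟩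
  refine ⟨fun x y hxy => h.sub x y (Finset.mem_of_mem_erase hxy), fun H hH x y hxy => ?_,
    fun x y z hv hm => h.vstruct x y z hv (Finset.mem_of_mem_erase hm), fun x y hxy => ?_⟩
  · refine Finset.mem_erase.2 ⟨fun he => ?_, h.sound H hH x y hxy⟩
    obtain ⟨rfl, rfl⟩ := Prod.mk.inj he
    exact h.not_adj_of_orientRule hr hH hxy
  · by_cases hd : IsDir E x y
    · rcases h.just x y hd with h1 | ⟨d, h1, h2⟩ | ⟨d, h1, h2⟩ | ⟨d, e, h0, h1, h2, h3, h4⟩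
      · exact .inl h1
      · exact .inr (.inl ⟨d, hdir h1, hnon h2⟩)
      · exact .inr (.inr (.inl ⟨d, hdir h1, hdir h2⟩))
      · exact .inr (.inr (.inr ⟨d, e, h0, hnon h1, hdir h2, hdir h3, h4⟩))
    · have hyx : (y, x) = (b, a) := by
        by_contra hne
        exact hd ⟨Finset.mem_of_mem_erase hxy.1, fun h' => hxy.2 (Finset.mem_erase.2 ⟨hne, h'⟩)⟩
      obtain ⟨rfl, rfl⟩ := Prod.mk.inj hyx
      obtain ⟨hu, ⟨c, hca, hcb⟩ | ⟨c, hac, hcb⟩ | ⟨c, d, hcd, hn, hac, hcb, had, hdb⟩⟩ := hr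
      · exact .inr (.inl ⟨c, hdir hca, hnon hcb⟩)
      · exact .inr (.inr (.inl ⟨c, hdir hac, hdir hcb⟩))
      -- The edges between `x` and `c`, `d` may become directed later, so only what persists is
      -- recorded: the adjacencies, and that `c`, `d` do not collide at `x`.
      · refine .inr (.inr (.inr ⟨c, d, hcd, hnon hn, hdir hcb, hdir hdb, h.sub _ _ hac.1,
          h.sub _ _ had.1, fun hc => ?_⟩))
        exact h.vstruct c x d ⟨hc.1, hc.2, hcd, h.nonAdj_iff.1 hn⟩ hac.1

lemma isUndir_symm {a b : Fin p} (h : IsUndir E a b) : IsUndir E b a := ⟨h.2, h.1⟩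

/-- **Meek's lemma**: when no orientation rule applies, `a → b` and `b - c` imply `a → c`. -/
lemma isDir_of_isDir_isUndir (h : OrientInv G E) (hcl : ∀ a b, ¬ OrientRule E a b) {a b c : Fin p}
    (hab : IsDir E a b) (hbc : IsUndir E b c) : IsDir E a c := by
  have R1 : ∀ {a b c}, IsDir E c a → IsUndir E a b → G.skeleton.Adj c b := by
    intro a b c h1 h2
    by_contra hn
    exact hcl a b ⟨h2, .inl ⟨c, h1, h.nonAdj_iff.2 hn⟩⟩
  have R2 : ∀ {a b c}, IsDir E a c → IsDir E c b → IsUndir E a b → False :=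
    fun h1 h2 h3 => hcl _ _ ⟨h3, .inr (.inl ⟨_, h1, h2⟩)⟩
  have R3 : ∀ {a b c d}, c ≠ d → ¬ G.skeleton.Adj c d → IsUndir E a c → IsDir E c b →
      IsUndir E a d → IsDir E d b → IsUndir E a b → False :=
    fun h0 h1 h2 h3 h4 h5 h6 => hcl _ _ ⟨h6, .inr (.inr ⟨_, _, h0, h.nonAdj_iff.2 h1, h2, h3, h4,
      h5⟩)⟩
  -- R1 makes `a` and `c` adjacent and R2 excludes `c → a`, so it remains to refute `a - c`.
  have reduce : ∀ {a b c}, IsDir E a b → IsUndir E b c → (IsUndir E a c → False) →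
      IsDir E a c := by
    intro a b c hab hbc hac
    rcases h.trichotomy (R1 hab hbc) with h1 | h1 | h1
    · exact h1
    · exact (R2 h1 hab (isUndir_symm hbc)).elim
    · exact (hac h1).elim
  -- Induction along the ancestors of `b` in `G`: the reasons for `a → b` involve nodes before `b`,
  -- for which the claim is already known.
  induction b using (WellFounded.induction G.wellFounded_transGen) generalizing a c with
  | _ b ih =>
  refine reduce hab hbc fun hac => ?_
  have ih' : ∀ {d e c}, G.Adj d b → IsDir E e d → IsUndir E d c → IsUndir E e c → False := by
    intro d e c hdb hed hdc hec
    exact (ih d (.single hdb) hed hdc).2 hec.2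
  rcases h.just a b hab with ⟨d, hv⟩ | ⟨d, hda, hdb⟩ | ⟨d, had, hdb⟩ |
    ⟨d, e, hde, hn, hdb, heb, had, hae, hnc⟩
  · have hdb : IsDir E d b := ⟨h.adj_mem hv.2.1, h.vstruct _ _ _ hv.symm⟩
    rcases h.trichotomy (R1 hdb hbc) with h1 | h1 | h1
    · exact hv.2.2.2 (R1 h1 (isUndir_symm hac)).symm
    · exact R2 h1 hdb (isUndir_symm hbc)
    · exact R3 hv.2.2.1 hv.2.2.2 (isUndir_symm hac) hab (isUndir_symm h1) hdb (isUndir_symm hbc)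
  · rcases h.trichotomy (R1 hda hac) with h1 | h1 | h1
    · exact h.nonAdj_iff.1 hdb (R1 h1 (isUndir_symm hbc))
    · exact R2 h1 hda (isUndir_symm hac)
    · exact ih' (h.adj_of_isDir' hab) hda hac h1
  · rcases h.trichotomy (R1 hdb hbc) with h1 | h1 | h1
    · exact R2 had h1 hac
    · exact R2 h1 hdb (isUndir_symm hbc)
    · exact ih' (h.adj_of_isDir' hdb) had h1 hac
  · have hn := h.nonAdj_iff.1 hn
    have hc : ∀ {d}, IsDir E d b → IsDir E d c ∨ IsUndir E d c := by
      intro d hdb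
      rcases h.trichotomy (R1 hdb hbc) with h1 | h1 | h1
      · exact .inl h1
      · exact (R2 h1 hdb (isUndir_symm hbc)).elim
      · exact .inr h1
    have ha : ∀ {d}, G.skeleton.Adj a d → IsDir E d c → IsDir E d a ∨ IsUndir E a d := by
      intro d had hdc
      rcases h.trichotomy had with h1 | h1 | h1
      · exact (R2 h1 hdc hac).elim
      · exact .inl h1
      · exact .inr h1
    rcases hc hdb with h1 | h1 <;> rcases hc heb with h2 | h2
    · rcases ha had h1 with h3 | h3 <;> rcases ha hae h2 with h4 | h4
      · exact hnc ⟨h.adj_of_isDir' h3, h.adj_of_isDir' h4⟩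
      · exact hn (R1 h3 h4)
      · exact hn (R1 h4 h3).symm
      · exact R3 hde hn h3 h1 h4 h2 hac
    · exact hn (R1 h1 (isUndir_symm h2))
    · exact hn (R1 h2 (isUndir_symm h1)).symm
    · exact R3 hde hn (isUndir_symm h1) hdb (isUndir_symm h2) heb (isUndir_symm hbc)

/-- The undirected part of a closed graph has simplicial nodes in all induced subgraphs. -/
lemma exists_simplicial (h : OrientInv G E) (hcl : ∀ a b, ¬ OrientRule E a b)
    (W : Finset (Fin p)) (hW : W.Nonempty) : ∃ v ∈ W, Simplicial (IsUndir E) W v := by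
  -- A node of `W` without descendants in `W`: its undirected neighbours there are parents in `G`,
  -- so nonadjacent ones would form an unshielded collider, and a directed edge between two of them
  -- would contradict Meek's lemma.
  obtain ⟨v, hv, hmax⟩ := G.wellFounded_transGen_flip.has_min (W : Set (Fin p)) hW
  refine ⟨v, hv, fun x hx y hy hxy hvx hvy => ?_⟩
  have key : ∀ z ∈ W, IsUndir E v z → G.Adj z v := fun z hz hvz =>
    (DAG.skeleton_adj.1 (h.sub _ _ hvz.2)).resolve_right fun h' => hmax z hz (.single h')
  have hadj : G.skeleton.Adj x y := by
    by_contra hn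
    exact h.vstruct x v y ⟨key x hx hvx, key y hy hvy, hxy, hn⟩ hvx.1
  rcases h.trichotomy hadj with h1 | h1 | h1
  · exact absurd hvx.1 (h.isDir_of_isDir_isUndir hcl h1 (isUndir_symm hvy)).2
  · exact absurd hvy.1 (h.isDir_of_isDir_isUndir hcl h1 (isUndir_symm hvx)).2
  · exact h1

/-- The directed edges together with the undirected ones, oriented along a ranking. -/
def rankAdj (E : Finset (Fin p × Fin p)) (r : Fin p → ℕ) (a b : Fin p) : Prop :=
  IsDir E a b ∨ (IsUndir E a b ∧ r a < r b)

/-- By Meek's lemma the last directed edge of the path absorbs the undirected one. -/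
lemma transGen_isDir_undir (h : OrientInv G E) (hcl : ∀ a b, ¬ OrientRule E a b)
    {a b c : Fin p} (hab : Relation.TransGen (IsDir E) a b) (hbc : IsUndir E b c) :
    Relation.TransGen (IsDir E) a c := by
  obtain ⟨d, had, hdb⟩ := Relation.TransGen.tail'_iff.1 hab
  exact .tail' had (h.isDir_of_isDir_isUndir hcl hdb hbc)

/-- Undirected steps after a directed one are absorbed, so all remaining undirected steps come
first. -/
lemma transGen_rankAdj (h : OrientInv G E) (hcl : ∀ a b, ¬ OrientRule E a b) {r : Fin p → ℕ}
    {a b : Fin p} (hab : Relation.TransGen (rankAdj E r) a b) :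
    Relation.TransGen (fun a b => IsUndir E a b ∧ r a < r b) a b ∨
      ∃ m, Relation.ReflTransGen (fun a b => IsUndir E a b ∧ r a < r b) a m ∧
        Relation.TransGen (IsDir E) m b := by
  induction hab with
  | single hab =>
    rcases hab with h1 | h1
    · exact .inr ⟨a, .refl, .single h1⟩
    · exact .inl (.single h1)
  | tail _ hbc ih =>
    rcases hbc with h1 | h1
    · rcases ih with h2 | ⟨m, h2, h3⟩
      · exact .inr ⟨_, h2.to_reflTransGen, .single h1⟩
      · exact .inr ⟨m, h2, h3.tail h1⟩
    · rcases ih with h2 | ⟨m, h2, h3⟩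
      · exact .inl (h2.tail h1)
      · exact .inr ⟨m, h2, h.transGen_isDir_undir hcl h3 h1.1⟩

/-- A cycle of undirected steps alone would increase the rank. Any other cycle, restarted where its
directed part begins, becomes a directed cycle, and hence a cycle of `G`. -/
lemma rankAdj_acyclic (h : OrientInv G E) (hcl : ∀ a b, ¬ OrientRule E a b) (r : Fin p → ℕ)
    (a : Fin p) : ¬ Relation.TransGen (rankAdj E r) a a := by
  intro ha
  rcases h.transGen_rankAdj hcl ha with h1 | ⟨m, h1, h2⟩
  · have key : ∀ {b}, Relation.TransGen (fun a b => IsUndir E a b ∧ r a < r b) a b →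
        r a < r b := by
      intro b hb
      induction hb with
      | single hb => exact hb.2
      | tail _ hb ih => exact ih.trans hb.2
    exact lt_irrefl _ (key h1)
  · have key : Relation.TransGen (IsDir E) m m := by
      suffices hs : ∀ {k}, Relation.ReflTransGen (fun a b => IsUndir E a b ∧ r a < r b) a k →
          Relation.TransGen (IsDir E) m k from hs h1
      intro k hk
      induction hk with
      | refl => exact h2
      | tail _ hb ih => exact h.transGen_isDir_undir hcl ih hb.1
    exact G.acyclic m (key.lift id fun _ _ h' => h.adj_of_isDir' h')

/-- Every edge of a closed graph occurs in a DAG with the given pattern. -/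
lemma exists_samePattern (h : OrientInv G E) (hcl : ∀ a b, ¬ OrientRule E a b) {a b : Fin p}
    (hab : (a, b) ∈ E) : ∃ H : DAG (Fin p), G.SamePattern H ∧ H.Adj a b := by
  -- The ranking starts at `a`, so that an undirected `a - b` is oriented as `a → b`.
  obtain ⟨r, hr1, hr2, hr3⟩ := exists_rank (fun x y hxy => isUndir_symm hxy)
    (h.exists_simplicial hcl) a Finset.univ (Finset.mem_univ a)
  let H : DAG (Fin p) := ⟨⟨rankAdj E r⟩, h.rankAdj_acyclic hcl r⟩
  have hne : ∀ {x y}, G.skeleton.Adj x y → x ≠ y := fun h' => h'.ne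
  have hsk : ∀ x y, G.skeleton.Adj x y ↔ H.skeleton.Adj x y := by
    intro x y
    rw [DAG.skeleton_adj (G := H)]
    constructor
    · intro hxy
      rcases h.trichotomy hxy with h1 | h1 | h1
      · exact .inl (.inl h1)
      · exact .inr (.inl h1)
      · rcases lt_or_gt_of_ne fun h' => hne hxy (hr1 (by simp) (by simp) h') with h2 | h2
        · exact .inl (.inr ⟨h1, h2⟩)
        · exact .inr (.inr ⟨isUndir_symm h1, h2⟩)
    · rintro ((h1 | h1) | (h1 | h1))
      · exact h.sub _ _ h1.1
      · exact h.sub _ _ h1.1.1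
      · exact (h.sub _ _ h1.1).symm
      · exact h.sub _ _ h1.1.2
  refine ⟨H, ⟨hsk, fun x y z => ⟨fun hv => ?_, fun ⟨hx, hz, hxz, hn⟩ => ?_⟩⟩, ?_⟩
  · exact ⟨.inl ⟨h.adj_mem hv.1, h.vstruct _ _ _ hv⟩,
      .inl ⟨h.adj_mem hv.2.1, h.vstruct _ _ _ hv.symm⟩, hv.2.2.1, by rw [← hsk]; exact hv.2.2.2⟩
  · rw [← hsk] at hn
    -- A collider with exactly one directed edge is shielded by Meek's lemma, one with two
    -- undirected edges by the property `hr3` of the ranking.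
    rcases hx with hx | hx <;> rcases hz with hz | hz
    · exact ⟨h.adj_of_isDir' hx, h.adj_of_isDir' hz, hxz, hn⟩
    · exact absurd (h.sub _ _ (h.isDir_of_isDir_isUndir hcl hx (isUndir_symm hz.1)).1) hn
    · exact absurd (h.sub _ _ (h.isDir_of_isDir_isUndir hcl hz (isUndir_symm hx.1)).1).symm hn
    · exact absurd (h.sub _ _ (hr3 x (by simp) z (by simp) y (by simp) hxz hx.1 hz.1 hx.2 hz.2).1)
        hn
  · by_cases hba : (b, a) ∈ E
    · exact .inr ⟨⟨hab, hba⟩, hr2 b (by simp) (hne (h.sub _ _ hab)).symm⟩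
    · exact .inl ⟨hab, hba⟩

/-- A graph that satisfies the invariants and is closed under the orientation rules is the
CPDAG. -/
theorem eq_cpdag (h : OrientInv G E) (hcl : ∀ a b, ¬ OrientRule E a b) :
    (E : Set (Fin p × Fin p)) = G.cpdag := by
  ext ⟨a, b⟩
  simp only [Finset.mem_coe, DAG.cpdag, Set.mem_ofPred_eq]
  constructor
  · intro hab
    obtain ⟨H, hH, hab'⟩ := h.exists_samePattern hcl hab
    exact ⟨H, hH.markovEquiv, hab'⟩
  · rintro ⟨H, hH, hab⟩
    exact h.sound H hH.samePattern a b hab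

end OrientInv

end Meek

/-! ### Correctness of PC when the tests are correct -/

section PCCorrect

variable {p : ℕ} {G : DAG (Fin p)}

lemma mem_pairs (e : Fin p × Fin p) : e ∈ pairs p := by
  obtain ⟨a, b⟩ := e
  exact List.pair_mem_product.2 ⟨List.mem_finRange a, List.mem_finRange b⟩

lemma mem_subsetsOfCard {A S : Finset (Fin p)} {l : ℕ} :
    S ∈ subsetsOfCard A l ↔ S ⊆ A ∧ S.card = l := by
  simp only [subsetsOfCard, List.mem_map, List.mem_sublistsLen]
  constructor
  · rintro ⟨t, ⟨ht, rfl⟩, rfl⟩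
    refine ⟨fun x hx => ?_, List.toFinset_card_of_nodup (ht.nodup (Finset.sort_nodup _ _))⟩
    simpa using ht.subset (List.mem_toFinset.1 hx)
  · rintro ⟨hS, rfl⟩
    have hf : ((A.sort).filter (· ∈ S)).toFinset = S := by
      ext x
      simp only [List.mem_toFinset, List.mem_filter, Finset.mem_sort, decide_eq_true_eq]
      exact ⟨fun h => h.2, fun h => ⟨hS h, h⟩⟩
    refine ⟨(A.sort).filter (· ∈ S), ⟨List.filter_sublist, ?_⟩, hf⟩
    rw [← List.toFinset_card_of_nodup ((Finset.sort_nodup _ _).filter _), hf]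

/-- Every node has at most `deg G` neighbours. -/
lemma card_le_deg {i : Fin p} {P : Finset (Fin p)} (h : ∀ x ∈ P, G.skeleton.Adj i x) :
    P.card ≤ G.deg := by
  refine le_trans ?_ (Finset.le_sup (f := fun v => (G.skeleton.neighborSet v).ncard)
    (Finset.mem_univ i))
  rw [← Set.ncard_coe_finset]
  exact Set.ncard_le_ncard (fun x hx => h x hx) (Set.toFinite _)

/-- Invariants of the skeleton phase. -/
structure SkelInv (G : DAG (Fin p)) (st : SkelState p) : Prop where
  ne : ∀ i j, (i, j) ∈ st.edges → i ≠ j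
  symm : ∀ i j, (i, j) ∈ st.edges → (j, i) ∈ st.edges
  sup : ∀ i j, G.skeleton.Adj i j → (i, j) ∈ st.edges
  sep : ∀ i j, i ≠ j → (i, j) ∉ st.edges → G.DSep i j (st.sep i j)

/-- The answers of `test` for sets of size at most `d` are correct. -/
def Correct (G : DAG (Fin p)) (test : Fin p → Fin p → Finset (Fin p) → Bool) (d : ℕ) : Prop :=
  ∀ i j S, i ≠ j → i ∉ S → j ∉ S → S.card ≤ d → (test i j S = true ↔ G.DSep i j S)

variable {test : Fin p → Fin p → Finset (Fin p) → Bool} {l : ℕ} {st : SkelState p}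

lemma visitPair_edges_subset (e : Fin p × Fin p) :
    (visitPair test l st e).edges ⊆ st.edges := by
  unfold visitPair
  split_ifs
  · split
    · exact (Finset.erase_subset _ _).trans (Finset.erase_subset _ _)
    · exact subset_rfl
  · exact subset_rfl

/-- Only sets of size `l ≤ deg G` are queried, so an accepted set really d-separates, and adjacent
nodes of `G` are never d-separated. -/
lemma SkelInv.visitPair (h : SkelInv G st) (ht : Correct G test G.deg) (hl : l ≤ G.deg)
    (e : Fin p × Fin p) : SkelInv G (visitPair test l st e) := by
  unfold RankPC.visitPair
  split_ifs with he
  swap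
  · exact h
  split
  swap
  · exact h
  rename_i S hS
  obtain ⟨i, j⟩ := e
  have hij := h.ne _ _ he
  obtain ⟨hsub, hcard⟩ := mem_subsetsOfCard.1 (List.mem_of_find?_eq_some hS)
  have hi : i ∉ S := fun h' => by
    have h1 := Finset.mem_of_mem_erase (hsub h')
    exact h.ne i i (Finset.mem_filter.1 h1).2 rfl
  have hj : j ∉ S := fun h' => Finset.ne_of_mem_erase (hsub h') rfl
  have hd := (ht i j S hij hi hj (hcard ▸ hl)).1 (List.find?_some hS)
  have hmem : ∀ x y, (x, y) ∈ (st.edges.erase (i, j)).erase (j, i) ↔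
      ¬ ((x, y) = (i, j) ∨ (x, y) = (j, i)) ∧ (x, y) ∈ st.edges := by
    intro x y
    rw [Finset.mem_erase, Finset.mem_erase]
    tauto
  refine ⟨fun x y hxy => h.ne x y ((hmem x y).1 hxy).2, fun x y hxy => ?_, fun x y hxy => ?_,
    fun x y hne hxy => ?_⟩
  · obtain ⟨h1, h2⟩ := (hmem x y).1 hxy
    refine (hmem y x).2 ⟨?_, h.symm _ _ h2⟩
    simp only [Prod.mk.injEq] at h1 ⊢
    tauto
  · refine (hmem x y).2 ⟨?_, h.sup _ _ hxy⟩
    simp only [Prod.mk.injEq]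
    rintro (⟨rfl, rfl⟩ | ⟨rfl, rfl⟩)
    · exact DAG.not_dSep_of_adj hxy hd
    · exact DAG.not_dSep_of_adj hxy.symm hd
  · rw [hmem] at hxy
    by_cases hc : (x, y) = (i, j) ∨ (x, y) = (j, i)
    · simp only [hc, if_true]
      simp only [Prod.mk.injEq] at hc
      rcases hc with ⟨rfl, rfl⟩ | ⟨rfl, rfl⟩
      · exact hd
      · exact hd.symm
    · simp only [hc, if_false]
      exact h.sep x y hne fun h' => hxy ⟨hc, h'⟩

/-- No edge of `G` has been deleted, so `P` still lies in the current neighbourhood of `i` and is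
among the candidates. -/
lemma SkelInv.visitPair_notMem (h : SkelInv G st) (ht : Correct G test G.deg) {i j : Fin p}
    {P : Finset (Fin p)} (hP : ∀ x ∈ P, G.skeleton.Adj i x) (hj : j ∉ P) (hd : G.DSep i j P)
    (hl : P.card = l) : (i, j) ∉ (RankPC.visitPair test l st (i, j)).edges := by
  unfold RankPC.visitPair
  split_ifs with he
  swap
  · exact he
  have hcard := card_le_deg hP
  have hmem : P ∈ subsetsOfCard ((nbrs st.edges i).erase j) l := by
    refine mem_subsetsOfCard.2 ⟨fun x hx => ?_, hl⟩
    refine Finset.mem_erase.2 ⟨fun h' => hj (h' ▸ hx), ?_⟩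
    exact Finset.mem_filter.2 ⟨Finset.mem_univ _, h.sup _ _ (hP x hx)⟩
  have hi : i ∉ P := fun h' => (hP i h').ne rfl
  have htest := (ht i j P (h.ne _ _ he) hi hj hcard).2 hd
  split
  · simp
  · rename_i hn
    exact absurd htest (List.find?_eq_none.1 hn P hmem)

lemma foldl_visitPair_edges_subset (es : List (Fin p × Fin p)) (st : SkelState p) :
    (es.foldl (visitPair test l) st).edges ⊆ st.edges := by
  induction es generalizing st with
  | nil => exact subset_rfl
  | cons e es ih => exact (ih _).trans (visitPair_edges_subset e)

lemma SkelInv.foldl (ht : Correct G test G.deg) (hl : l ≤ G.deg) (es : List (Fin p × Fin p))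
    {st : SkelState p} (h : SkelInv G st) : SkelInv G (es.foldl (RankPC.visitPair test l) st) := by
  induction es generalizing st with
  | nil => exact h
  | cons e es ih => exact ih (h.visitPair ht hl e)

lemma SkelInv.foldl_notMem (ht : Correct G test G.deg) (hl : l ≤ G.deg)
    (es : List (Fin p × Fin p)) {st : SkelState p} (h : SkelInv G st) {i j : Fin p}
    (hij : (i, j) ∈ es) {P : Finset (Fin p)} (hP : ∀ x ∈ P, G.skeleton.Adj i x) (hj : j ∉ P)
    (hd : G.DSep i j P) (hPl : P.card = l) :
    (i, j) ∉ (es.foldl (RankPC.visitPair test l) st).edges := by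
  induction es generalizing st with
  | nil => simp at hij
  | cons e es ih =>
    rcases List.mem_cons.1 hij with rfl | h'
    · exact fun h' => h.visitPair_notMem ht hP hj hd hPl
        (foldl_visitPair_edges_subset es _ h')
    · exact ih (h.visitPair ht hl e) h'

/-- All pairs that are separated by less than `k` neighbours have been deleted. -/
def SepDone (G : DAG (Fin p)) (k : ℕ) (st : SkelState p) : Prop :=
  ∀ (i j : Fin p) (P : Finset (Fin p)), P.card < k → (∀ x ∈ P, G.skeleton.Adj i x) → j ∉ P →
    G.DSep i j P → (i, j) ∉ st.edges

-- The parents of a node number at most `deg G` and less than `p`. The first bound is used when the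
-- level passes the degree, the second at the end of the loop.
open Classical in
lemma SkelInv.mem_edges_iff (h : SkelInv G st) {k : ℕ} (hs : SepDone G k st)
    (hk : G.deg < k ∨ p ≤ k) (i j : Fin p) : (i, j) ∈ st.edges ↔ G.skeleton.Adj i j := by
  refine ⟨fun hij => ?_, h.sup i j⟩
  by_contra hn
  have key : ∀ {i j : Fin p}, ¬ G.skeleton.Adj i j →
      G.DSep i j (Finset.univ.filter fun x => G.Adj x i) → (i, j) ∉ st.edges := by
    intro i j hn hd
    have hP : ∀ x ∈ Finset.univ.filter fun x => G.Adj x i, G.skeleton.Adj i x := by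
      intro x hx
      exact DAG.skeleton_adj.2 (.inr (Finset.mem_filter.1 hx).2)
    refine hs i j _ ?_ hP (fun hj => hn (hP j hj)) hd
    rcases hk with hk | hk
    · exact (card_le_deg hP).trans_lt hk
    · refine lt_of_lt_of_le ?_ hk
      have : Finset.univ.filter (fun x => G.Adj x i) ⊂ Finset.univ :=
        Finset.ssubset_univ_iff.2 fun h' => by
          have := Finset.mem_univ i
          rw [← h'] at this
          exact G.irrefl i (Finset.mem_filter.1 this).2
      simpa using Finset.card_lt_card this
  rcases DAG.exists_dSep_parents (h.ne _ _ hij) hn with h1 | h1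
  · exact key hn h1 hij
  · exact key (fun h' => hn h'.symm) h1 (h.symm _ _ hij)

/-- Once the skeleton has been reached, no neighbourhood has more than `deg G` elements. This is why
`test` may be arbitrary on larger sets. -/
lemma visitPair_eq_self (hst : ∀ i j, (i, j) ∈ st.edges → G.skeleton.Adj i j)
    (hl : G.deg < l) (e : Fin p × Fin p) : visitPair test l st e = st := by
  unfold visitPair
  split_ifs
  swap
  · rfl
  split
  swap
  · rfl
  rename_i S hS
  obtain ⟨hsub, hcard⟩ := mem_subsetsOfCard.1 (List.mem_of_find?_eq_some hS)
  have : S.card ≤ G.deg := card_le_deg (i := e.1) fun x hx =>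
    hst _ _ (Finset.mem_filter.1 (Finset.mem_of_mem_erase (hsub hx))).2
  omega

lemma foldl_visitPair_eq_self (hst : ∀ i j, (i, j) ∈ st.edges → G.skeleton.Adj i j)
    (hl : G.deg < l) (es : List (Fin p × Fin p)) : es.foldl (visitPair test l) st = st := by
  induction es with
  | nil => rfl
  | cons e es ih => rw [List.foldl_cons, visitPair_eq_self hst hl e, ih]

lemma skelInv_levels (ht : Correct G test G.deg) (k : ℕ) :
    SkelInv G ((List.range k).foldl (fun st l => (pairs p).foldl (visitPair test l) st)
      { edges := Finset.univ.offDiag, sep := fun _ _ => ∅ }) ∧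
    SepDone G k ((List.range k).foldl (fun st l => (pairs p).foldl (visitPair test l) st)
      { edges := Finset.univ.offDiag, sep := fun _ _ => ∅ }) := by
  induction k with
  | zero =>
    refine ⟨⟨by simp, ?_, ?_, by simp +contextual⟩, fun i j P hP => by simp at hP⟩
    · intro i j h
      simpa using (by simpa using h : ¬ i = j) ∘ Eq.symm
    · intro i j h
      simpa using h.ne
  | succ k ih =>
    rw [List.range_succ, List.foldl_append, List.foldl_cons, List.foldl_nil]
    obtain ⟨h1, h2⟩ := ih
    set st := (List.range k).foldl (fun st l => (pairs p).foldl (visitPair test l) st)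
      { edges := Finset.univ.offDiag, sep := fun _ _ => ∅ }
    by_cases hk : k ≤ G.deg
    · refine ⟨h1.foldl ht hk _, fun i j P hP hPi hj hd => ?_⟩
      rcases Nat.lt_succ_iff_lt_or_eq.1 hP with h | h
      · exact fun h' => h2 i j P h hPi hj hd (foldl_visitPair_edges_subset _ _ h')
      · exact h1.foldl_notMem ht hk _ (mem_pairs _) hPi hj hd h
    · push Not at hk
      have hE := h1.mem_edges_iff h2 (.inl hk)
      rw [foldl_visitPair_eq_self (fun i j h => (hE i j).1 h) hk]
      refine ⟨h1, fun i j P _ _ _ hd h' => ?_⟩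
      exact DAG.not_dSep_of_adj ((hE i j).1 h') hd

/-- With correct answers the first phase finds the skeleton and separating sets. -/
lemma skeletonPhase_correct (ht : Correct G test G.deg) :
    (∀ i j, (i, j) ∈ (skeletonPhase test).edges ↔ G.skeleton.Adj i j) ∧
      ∀ i j, i ≠ j → (i, j) ∉ (skeletonPhase test).edges →
        G.DSep i j ((skeletonPhase test).sep i j) := by
  obtain ⟨h1, h2⟩ := skelInv_levels ht p
  exact ⟨h1.mem_edges_iff h2 (.inr le_rfl), h1.sep⟩

/-- Invariants of the orientation of unshielded colliders. -/
structure CollInv (G : DAG (Fin p)) (E : Finset (Fin p × Fin p)) : Prop where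
  sub : ∀ a b, (a, b) ∈ E → G.skeleton.Adj a b
  sound : ∀ H : DAG (Fin p), G.SamePattern H → ∀ a b, H.Adj a b → (a, b) ∈ E
  just : ∀ a b, G.skeleton.Adj a b → (b, a) ∉ E → ∃ d, G.VStruct a b d

/-- One step of the second phase. -/
def colliderStep (st : SkelState p) (E : Finset (Fin p × Fin p))
    (t : (Fin p × Fin p) × Fin p) : Finset (Fin p × Fin p) :=
  if t.1.1 ≠ t.1.2 ∧ (t.1.1, t.1.2) ∉ st.edges ∧ (t.1.1, t.2) ∈ st.edges ∧
      (t.1.2, t.2) ∈ st.edges ∧ t.2 ∉ st.sep t.1.1 t.1.2 then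
    (E \ {(t.2, t.1.1), (t.2, t.1.2)}) ∪ {(t.1.1, t.2), (t.1.2, t.2)}
  else E

lemma colliderPhase_eq (st : SkelState p) :
    colliderPhase st = ((pairs p).product (List.finRange p)).foldl (colliderStep st) st.edges :=
  rfl

lemma colliderStep_eq (hE : ∀ i j, (i, j) ∈ st.edges ↔ G.skeleton.Adj i j)
    (hsep : ∀ i j, i ≠ j → (i, j) ∉ st.edges → G.DSep i j (st.sep i j))
    (E : Finset (Fin p × Fin p)) (i j k : Fin p) [Decidable (G.VStruct i k j)] :
    colliderStep st E ((i, j), k) =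
      if G.VStruct i k j then (E \ {(k, i), (k, j)}) ∪ {(i, k), (j, k)} else E := by
  have : (i ≠ j ∧ (i, j) ∉ st.edges ∧ (i, k) ∈ st.edges ∧ (j, k) ∈ st.edges ∧ k ∉ st.sep i j) ↔
      G.VStruct i k j := by
    constructor
    · rintro ⟨h1, h2, h3, h4, h5⟩
      exact (DAG.vStruct_iff_of_dSep ((hE _ _).1 h3) ((hE _ _).1 h4) h1 (hsep i j h1 h2)).2 h5
    · intro h
      have h2 : (i, j) ∉ st.edges := fun h' => h.2.2.2 ((hE _ _).1 h')
      have h3 := h.skeleton_adj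
      exact ⟨h.2.2.1, h2, (hE _ _).2 h3.1, (hE _ _).2 h3.2,
        (DAG.vStruct_iff_of_dSep h3.1 h3.2 h.2.2.1 (hsep i j h.2.2.1 h2)).1 h⟩
  unfold colliderStep
  simp only [this]

lemma CollInv.step {E : Finset (Fin p × Fin p)} (h : CollInv G E) {i j k : Fin p}
    (hv : G.VStruct i k j) : CollInv G ((E \ {(k, i), (k, j)}) ∪ {(i, k), (j, k)}) := by
  have hmem : ∀ a b, (a, b) ∈ (E \ {(k, i), (k, j)}) ∪ {(i, k), (j, k)} ↔
      ((a, b) ∈ E ∧ ¬ ((a = k ∧ b = i) ∨ (a = k ∧ b = j))) ∨ (a = i ∧ b = k) ∨ (a = j ∧ b = k) := by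
    intro a b; simp; tauto
  refine ⟨fun a b hab => ?_, fun H hH a b hab => ?_, fun a b hab hn => ?_⟩
  · rcases (hmem a b).1 hab with h1 | ⟨rfl, rfl⟩ | ⟨rfl, rfl⟩
    · exact h.sub _ _ h1.1
    · exact hv.skeleton_adj.1
    · exact hv.skeleton_adj.2
  · refine (hmem a b).2 (.inl ⟨h.sound H hH a b hab, ?_⟩)
    have hv' := (hH.2 _ _ _).1 hv
    rintro (⟨rfl, rfl⟩ | ⟨rfl, rfl⟩)
    · exact DAG.asymm hab hv'.1
    · exact DAG.asymm hab hv'.2.1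
  · rw [hmem, not_or, not_and_not_right] at hn
    by_cases hb : (b, a) ∈ E
    · rcases hn.1 hb with ⟨rfl, rfl⟩ | ⟨rfl, rfl⟩
      · exact ⟨_, hv⟩
      · exact ⟨_, hv.symm⟩
    · exact h.just a b hab hb

lemma collInv_foldl (hE : ∀ i j, (i, j) ∈ st.edges ↔ G.skeleton.Adj i j)
    (hsep : ∀ i j, i ≠ j → (i, j) ∉ st.edges → G.DSep i j (st.sep i j))
    (ts : List ((Fin p × Fin p) × Fin p)) (E : Finset (Fin p × Fin p)) (h : CollInv G E) :
    CollInv G (ts.foldl (colliderStep st) E) ∧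
      (∀ a b c, G.VStruct a b c → (b, a) ∉ E → (b, a) ∉ ts.foldl (colliderStep st) E) ∧
      ∀ a b c, G.VStruct a b c → ((a, c), b) ∈ ts → (b, a) ∉ ts.foldl (colliderStep st) E := by
  classical
  induction ts generalizing E with
  | nil => exact ⟨h, fun _ _ _ _ h => h, by simp⟩
  | cons t ts ih =>
    obtain ⟨⟨i, j⟩, k⟩ := t
    rw [List.foldl_cons]
    have hst := colliderStep_eq hE hsep E i j k
    have hinv : CollInv G (colliderStep st E ((i, j), k)) := by
      rw [hst]; split_ifs with hv
      exacts [h.step hv, h]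
    obtain ⟨h1, h2, h3⟩ := ih _ hinv
    refine ⟨h1, fun a b c hv hn => h2 a b c hv ?_, fun a b c hv ht => ?_⟩
    · rw [hst]
      split_ifs with hv'
      · simp only [Finset.mem_union, Finset.mem_sdiff, Finset.mem_insert, Finset.mem_singleton,
          Prod.mk.injEq]
        -- A later step could put `(b, a)` back only for a collider containing `b → a`, which
        -- contradicts `a → b`.
        rintro (h' | ⟨rfl, rfl⟩ | ⟨rfl, rfl⟩)
        · exact hn h'.1
        · exact DAG.asymm hv.1 hv'.1
        · exact DAG.asymm hv.1 hv'.2.1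
      · exact hn
    · rcases List.mem_cons.1 ht with he | ht
      · simp only [Prod.mk.injEq] at he
        obtain ⟨⟨rfl, rfl⟩, rfl⟩ := he
        refine h2 a b c hv ?_
        rw [hst, if_pos hv]
        have h4 := DAG.ne_of_adj hv.1
        simp [h4, h4.symm]
      · exact h3 a b c hv ht

lemma orientInv_colliderPhase (hE : ∀ i j, (i, j) ∈ st.edges ↔ G.skeleton.Adj i j)
    (hsep : ∀ i j, i ≠ j → (i, j) ∉ st.edges → G.DSep i j (st.sep i j)) :
    OrientInv G (colliderPhase st) := by
  have h0 : CollInv G st.edges := by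
    refine ⟨fun a b h => (hE a b).1 h, fun H hH a b hab => ?_, fun a b hab hn => ?_⟩
    · rw [hE, hH.1]
      exact DAG.skeleton_adj.2 (.inl hab)
    · exact absurd ((hE _ _).2 hab.symm) hn
  obtain ⟨h1, -, h2⟩ := collInv_foldl hE hsep ((pairs p).product (List.finRange p)) _ h0
  rw [← colliderPhase_eq] at h1 h2
  refine ⟨h1.sub, h1.sound, fun a b c hv => h2 a b c hv ?_, fun a b hab => ?_⟩
  · exact List.pair_mem_product.2 ⟨mem_pairs _, List.mem_finRange _⟩
  · exact .inl (h1.just a b (h1.sub _ _ hab.1) hab.2)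

/-! ### The orientation rules -/

lemma foldl_subset {α β : Type*} {f : Finset α → β → Finset α} (hf : ∀ E e, f E e ⊆ E)
    (es : List β) (E : Finset α) : es.foldl f E ⊆ E := by
  induction es generalizing E with
  | nil => exact subset_rfl
  | cons e es ih => exact (ih _).trans (hf E e)

/-- Each step can only shrink the set, so a pass that returns its input changed nothing at any step.
-/
lemma eq_of_foldl_eq {α β : Type*} {f : Finset α → β → Finset α} (hf : ∀ E e, f E e ⊆ E)
    {es : List β} {E : Finset α} (h : es.foldl f E = E) {e : β} (he : e ∈ es) : f E e = E := by
  induction es with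
  | nil => simp at he
  | cons e' es ih =>
    rw [List.foldl_cons] at h
    have h1 : f E e' = E := by
      refine (hf E e').antisymm ?_
      conv_lhs => rw [← h]
      exact foldl_subset hf es _
    rcases List.mem_cons.1 he with rfl | he
    · exact h1
    · exact ih (by rw [h1] at h; exact h) he

lemma iterate_fixed {α : Type*} {f : Finset α → Finset α} (hf : ∀ E, f E ⊆ E) (E : Finset α)
    (n : ℕ) : f (f^[n] E) = f^[n] E ∨ (f^[n] E).card + n ≤ E.card := by
  induction n with
  | zero => right; simp
  | succ n ih =>
    rw [Function.iterate_succ_apply']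
    rcases ih with h | h
    · left; rw [h, h]
    · by_cases he : f (f^[n] E) = f^[n] E
      · left; rw [he, he]
      · right
        have := Finset.card_lt_card ((hf (f^[n] E)).ssubset_of_ne he)
        omega

lemma orientStep_subset (E : Finset (Fin p × Fin p)) (e : Fin p × Fin p) :
    (if OrientRule E e.1 e.2 then E.erase (e.2, e.1) else E) ⊆ E := by
  split_ifs
  exacts [Finset.erase_subset _ _, subset_rfl]

lemma orientPass_subset (E : Finset (Fin p × Fin p)) : orientPass E ⊆ E :=
  foldl_subset orientStep_subset _ E

lemma closed_of_orientPass_eq {E : Finset (Fin p × Fin p)} (h : orientPass E = E) (a b : Fin p) :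
    ¬ OrientRule E a b := by
  intro hr
  have := eq_of_foldl_eq orientStep_subset h (mem_pairs (a, b))
  rw [if_pos hr, Finset.erase_eq_self] at this
  exact this hr.1.2

lemma OrientInv.orientPass {E : Finset (Fin p × Fin p)} (h : OrientInv G E) :
    OrientInv G (orientPass E) := by
  unfold RankPC.orientPass
  suffices hs : ∀ (es : List (Fin p × Fin p)) (E : Finset (Fin p × Fin p)), OrientInv G E →
      OrientInv G (es.foldl
        (fun E e => if OrientRule E e.1 e.2 then E.erase (e.2, e.1) else E) E) from hs _ _ h
  intro es
  induction es with
  | nil => exact fun E h => h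
  | cons e es ih =>
    intro E h
    rw [List.foldl_cons]
    apply ih
    split_ifs with hr
    exacts [h.erase hr, h]

/-- **Correctness of the PC algorithm**: if all tests with conditioning sets of size at most
`deg G` are answered correctly, the output is the CPDAG. -/
theorem pc_eq_cpdag (ht : Correct G test G.deg) :
    (pc test : Set (Fin p × Fin p)) = G.cpdag := by
  obtain ⟨hE, hsep⟩ := skeletonPhase_correct ht
  have h0 := orientInv_colliderPhase hE hsep
  have hinv : ∀ n, OrientInv G (orientPass^[n] (colliderPhase (skeletonPhase test))) := by
    intro n
    induction n with
    | zero => exact h0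
    | succ n ih =>
      rw [Function.iterate_succ_apply']
      exact ih.orientPass
  refine (hinv (p * p)).eq_cpdag (closed_of_orientPass_eq ?_)
  -- If the passes had not become stationary, each would have removed a pair, and nothing would be
  -- left to change.
  rcases iterate_fixed orientPass_subset (colliderPhase (skeletonPhase test)) (p * p) with h | h
  · exact h
  · have hcard : (colliderPhase (skeletonPhase test)).card ≤ p * p := by
      simpa using Finset.card_le_univ (colliderPhase (skeletonPhase test))
    have : orientPass^[p * p] (colliderPhase (skeletonPhase test)) = ∅ :=
      Finset.card_eq_zero.1 (by omega)
    rw [this]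
    exact Finset.subset_empty.1 (orientPass_subset ∅)

end PCCorrect

/-! ### Conditional independence through conditional distributions -/

section CondDistrib

variable {Ω γ δ β β' : Type*} {mΩ : MeasurableSpace Ω} [MeasurableSpace γ] [MeasurableSpace δ]
  [MeasurableSpace β] {μ : Measure Ω}

lemma map_id_prod_const_apply (ν : Measure δ) [IsProbabilityMeasure ν] {F : γ × δ → β}
    (hF : Measurable F) (a : γ) {s : Set β} (hs : MeasurableSet s) :
    ((Kernel.id ×ₖ Kernel.const γ ν).map F) a s = ν ((fun w => F (a, w)) ⁻¹' s) := by
  rw [Kernel.map_apply' _ hF _ hs, Kernel.prod_apply, Kernel.id_apply, Kernel.const_apply,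
    Measure.dirac_prod, Measure.map_apply measurable_prodMk_left (hF hs)]
  rfl

variable [StandardBorelSpace β] [Nonempty β] [IsProbabilityMeasure μ]

/-- The conditional distribution of `F (X, W)` given `X`, for `W` independent of `X`. -/
lemma condDistrib_ae_eq_of_indepFun {X : Ω → γ} {W : Ω → δ} {F : γ × δ → β} (hX : Measurable X)
    (hW : Measurable W) (hF : Measurable F) (h : IndepFun X W μ) :
    condDistrib (fun ω => F (X ω, W ω)) X μ =ᵐ[μ.map X]
      (Kernel.id ×ₖ Kernel.const γ (μ.map W)).map F := by
  have := Measure.isProbabilityMeasure_map hX.aemeasurable (μ := μ)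
  have := Measure.isProbabilityMeasure_map hW.aemeasurable (μ := μ)
  have : IsMarkovKernel ((Kernel.id ×ₖ Kernel.const γ (μ.map W)).map F) :=
    Kernel.IsMarkovKernel.map _ hF
  refine (condDistrib_ae_eq_iff_measure_eq_compProd X (by fun_prop) _).2 ?_
  have h1 : μ.map (fun ω => (X ω, F (X ω, W ω))) =
      ((μ.map X).prod (μ.map W)).map (fun z => (z.1, F z)) := by
    rw [← (indepFun_iff_map_prod_eq_prod_map_map hX.aemeasurable hW.aemeasurable).1 h,
      Measure.map_map (by fun_prop) (by fun_prop)]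
    rfl
  rw [h1]
  ext s hs
  rw [Measure.map_apply (by fun_prop) hs, Measure.prod_apply (by measurability),
    Measure.compProd_apply hs]
  refine lintegral_congr fun a => ?_
  rw [map_id_prod_const_apply _ hF _ (measurable_prodMk_left hs)]
  rfl

variable [StandardBorelSpace Ω] [MeasurableSpace β'] [StandardBorelSpace β'] [Nonempty β']

/-- If `W` is independent of `(k, g)`, then `F (k, W)` and `g` are conditionally independent
given `k`. -/
lemma condIndepFun_of_indepFun {k : Ω → γ} {g : Ω → β'} {W : Ω → δ} {F : γ × δ → β}
    (hk : Measurable k) (hg : Measurable g) (hW : Measurable W) (hF : Measurable F)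
    (h : IndepFun (fun ω => (k ω, g ω)) W μ) :
    CondIndepFun (MeasurableSpace.comap k inferInstance) hk.comap_le
      (fun ω => F (k ω, W ω)) g μ := by
  refine CondIndepFun.symm ?_
  rw [condIndepFun_iff_condDistrib_prod_ae_eq_prodMkRight (by fun_prop) hg hk]
  -- Given `(k, g)` or given `k` alone, the conditional law is that of `F (a, W)` at `a = k`; `g`
  -- does not enter.
  have h1 := condDistrib_ae_eq_of_indepFun (F := fun z : (γ × β') × δ => F (z.1.1, z.2))
    (hk.prodMk hg) hW (by fun_prop) h
  have h2 := condDistrib_ae_eq_of_indepFun hk hW hF (h.comp measurable_fst measurable_id)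
  have hq : Measure.QuasiMeasurePreserving (Prod.fst : γ × β' → γ)
      (μ.map fun ω => (k ω, g ω)) (μ.map k) := by
    refine ⟨measurable_fst, ?_⟩
    rw [Measure.map_map measurable_fst (hk.prodMk hg)]
    exact Measure.AbsolutelyContinuous.rfl
  filter_upwards [h1, hq.ae h2] with z hz1 hz2
  rw [hz1, Kernel.prodMkRight_apply, hz2]
  ext s hs
  have := Measure.isProbabilityMeasure_map hW.aemeasurable (μ := μ)
  rw [map_id_prod_const_apply _ hF _ hs, map_id_prod_const_apply _ (by fun_prop) _ hs]

/-- If `f` and `g` are conditionally independent given `k`, then `f` is uncorrelated with all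
functions of `(k, g)` that are centered and independent of `k`. -/
lemma integral_mul_eq_zero_of_condIndepFun {k : Ω → γ} {g : Ω → β'} {f : Ω → ℝ}
    {H : γ × β' → ℝ} (hk : Measurable k) (hg : Measurable g) (hf : Measurable f)
    (hH : Measurable H) (hfi : MemLp f 2 μ) (hHi : MemLp (fun ω => H (k ω, g ω)) 2 μ)
    (hind : IndepFun k (fun ω => H (k ω, g ω)) μ) (h0 : ∫ ω, H (k ω, g ω) ∂μ = 0)
    (h : CondIndepFun (MeasurableSpace.comap k inferInstance) hk.comap_le f g μ) :
    ∫ ω, f ω * H (k ω, g ω) ∂μ = 0 := by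
  have h1 := (condIndepFun_iff_condDistrib_prod_ae_eq_prodMkRight hf hg hk).1 h.symm
  have hkg : Measurable fun ω => (k ω, g ω) := hk.prodMk hg
  have hfint : Integrable f μ := hfi.integrable (by norm_num)
  have h2 := condExp_ae_eq_integral_condDistrib' (μ := μ) hkg hfint
  have h3 := condExp_ae_eq_integral_condDistrib' (μ := μ) hk hfint
  have h1' := ae_of_ae_map hkg.aemeasurable h1
  set m := MeasurableSpace.comap (fun ω => (k ω, g ω)) inferInstance with hm
  have hle : m ≤ mΩ := hkg.comap_le
  set mk := MeasurableSpace.comap k inferInstance with hmk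
  -- Conditional independence makes `g` irrelevant for predicting `f`. The conditional expectation
  -- is then a function of `k`, independent of the centered factor.
  have h4 : μ[f|m] =ᵐ[μ] μ[f|mk] := by
    filter_upwards [h1', h2, h3] with ω e1 e2 e3
    rw [e2, e3, e1, Kernel.prodMkRight_apply]
  have hfH : Integrable (fun ω => f ω * H (k ω, g ω)) μ := hfi.integrable_mul hHi
  have hHm : StronglyMeasurable[m] fun ω => H (k ω, g ω) :=
    (hH.comp (comap_measurable _)).stronglyMeasurable
  have h5 : μ[fun ω => f ω * H (k ω, g ω)|m] =ᵐ[μ] fun ω => (μ[f|m]) ω * H (k ω, g ω) :=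
    condExp_mul_of_stronglyMeasurable_right hHm hfH hfint
  have h6 : IndepFun (μ[f|mk]) (fun ω => H (k ω, g ω)) μ := by
    have hs : StronglyMeasurable[mk] (μ[f|mk]) := stronglyMeasurable_condExp
    obtain ⟨φ, hφ, he⟩ := hs.measurable.exists_eq_measurable_comp
    rw [he]
    exact hind.comp hφ measurable_id
  have h7 : ∫ ω, f ω * H (k ω, g ω) ∂μ = ∫ ω, (μ[f|mk]) ω * H (k ω, g ω) ∂μ := by
    rw [← integral_condExp hle (f := fun ω => f ω * H (k ω, g ω))]
    refine integral_congr_ae (h5.trans ?_)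
    filter_upwards [h4] with ω hω
    rw [hω]
  rw [h7, h6.integral_fun_mul_eq_mul_integral integrable_condExp.aestronglyMeasurable
    hHi.aestronglyMeasurable, h0, mul_zero]

end CondDistrib

/-! ### Precision matrices of principal submatrices -/

section Precision

variable {V : Type*} {M : Matrix V V ℝ}

lemma posDef_submatrix (hM : M.PosDef) (I : Finset V) :
    (M.submatrix (fun i : I => (i : V)) (fun i : I => (i : V))).PosDef :=
  hM.submatrix Subtype.coe_injective

variable [DecidableEq V]

/-- The inverse of the principal submatrix with index set `I`. -/
noncomputable def precision (M : Matrix V V ℝ) (I : Finset V) : Matrix I I ℝ :=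
  (M.submatrix (fun i : I => (i : V)) (fun i : I => (i : V)))⁻¹

lemma posDef_precision (hM : M.PosDef) (I : Finset V) : (precision M I).PosDef :=
  (posDef_submatrix hM I).inv

lemma precision_mul (hM : M.PosDef) (I : Finset V) :
    precision M I * M.submatrix (fun i : I => (i : V)) (fun i : I => (i : V)) = 1 :=
  Matrix.nonsing_inv_mul _ ((Matrix.isUnit_iff_isUnit_det _).1 (posDef_submatrix hM I).isUnit)

lemma partialCorr_eq_zero_iff (hM : M.PosDef) (u v : V) (S : Finset V) :
    partialCorr M u v S = 0 ↔ precision M (insert u (insert v S))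
      ⟨u, Finset.mem_insert_self u _⟩
      ⟨v, Finset.mem_insert_of_mem (Finset.mem_insert_self v S)⟩ = 0 := by
  have h := posDef_precision hM (insert u (insert v S))
  have h1 := h.diag_pos (i := ⟨u, Finset.mem_insert_self u _⟩)
  have h2 := h.diag_pos (i := ⟨v, Finset.mem_insert_of_mem (Finset.mem_insert_self v S)⟩)
  have h3 := Real.sqrt_pos.2 (mul_pos h1 h2)
  simp only [partialCorr]
  change -precision M (insert u (insert v S)) _ _ / √(precision M (insert u (insert v S)) _ _ *
    precision M (insert u (insert v S)) _ _) = 0 ↔ _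
  rw [div_eq_zero_iff, neg_eq_zero, or_iff_left h3.ne']

lemma abs_partialCorr_self (hM : M.PosDef) (u : V) : |partialCorr M u u ∅| = 1 := by
  have h := (posDef_precision hM (insert u (insert u ∅))).diag_pos
    (i := ⟨u, Finset.mem_insert_self u _⟩)
  set x := precision M (insert u (insert u ∅)) ⟨u, Finset.mem_insert_self u _⟩
    ⟨u, Finset.mem_insert_self u _⟩ with hx
  have : partialCorr M u u ∅ = -x / √(x * x) := rfl
  rw [this, Real.sqrt_mul_self h.le, neg_div, div_self h.ne', abs_neg, abs_one]

end Precision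

/-! ### Gaussian conditional independence and partial correlation -/

section Gaussian

variable {V : Type*} [Fintype V] {M : Matrix V V ℝ}

/-- The linear functional with coefficients `c`. -/
noncomputable def lin (c : V → ℝ) : (V → ℝ) →L[ℝ] ℝ :=
  ∑ i, c i • ContinuousLinearMap.proj i

lemma lin_apply (c x : V → ℝ) : lin c x = ∑ i, c i * x i := by simp [lin]

variable [DecidableEq V]

/-- The centered Gaussian distribution on `V → ℝ`, as a nonparanormal distribution. -/
noncomputable abbrev gaussianVec (M : Matrix V V ℝ) : Measure (V → ℝ) := npn (fun _ x => x) M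

lemma gaussianVec_eq (M : Matrix V V ℝ) :
    gaussianVec M = (multivariateGaussian 0 M).map (EuclideanSpace.equiv V ℝ) := rfl

instance : IsGaussian (gaussianVec M) := by
  rw [gaussianVec_eq]; infer_instance

lemma hasGaussianLaw_gaussianVec {F : Type*} [NormedAddCommGroup F] [NormedSpace ℝ F]
    [MeasurableSpace F] [BorelSpace F] (L : (V → ℝ) →L[ℝ] F) :
    HasGaussianLaw (fun x => L x) (gaussianVec M) :=
  (IsGaussian.hasGaussianLaw_id (μ := gaussianVec M)).map_fun L

lemma memLp_gaussianVec (L : (V → ℝ) →L[ℝ] ℝ) : MemLp (fun x => L x) 2 (gaussianVec M) :=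
  (hasGaussianLaw_gaussianVec L).memLp_two

lemma integral_gaussianVec (L : (V → ℝ) →L[ℝ] ℝ) : ∫ x, L x ∂(gaussianVec M) = 0 := by
  rw [gaussianVec_eq, integral_map (by fun_prop) (by fun_prop)]
  have := ContinuousLinearMap.integral_comp_comm
    (L.comp (EuclideanSpace.equiv V ℝ : EuclideanSpace ℝ V →L[ℝ] (V → ℝ)))
    (IsGaussian.integrable_id (μ := multivariateGaussian (0 : EuclideanSpace ℝ V) M))
  simpa using this

lemma covariance_gaussianVec (hM : M.PosSemidef) (i j : V) :
    cov[fun x => x i, fun x => x j; gaussianVec M] = M i j := by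
  rw [gaussianVec_eq, covariance_map (measurable_pi_apply i).aestronglyMeasurable
    (measurable_pi_apply j).aestronglyMeasurable (by fun_prop)]
  exact covariance_eval_multivariateGaussian hM i j

lemma covariance_lin (hM : M.PosSemidef) (c : V → ℝ) (j : V) :
    cov[fun x => lin c x, fun x => x j; gaussianVec M] = ∑ i, c i * M i j := by
  simp only [lin_apply]
  rw [covariance_fun_sum_left]
  · refine Finset.sum_congr rfl fun i _ => ?_
    rw [covariance_const_mul_left, covariance_gaussianVec hM]
  · exact fun i => (memLp_gaussianVec (ContinuousLinearMap.proj i)).const_mul _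
  · exact memLp_gaussianVec (ContinuousLinearMap.proj j)

/-- A linear functional is independent of the coordinates with which it is uncorrelated. -/
lemma indepFun_lin (hM : M.PosSemidef) (c : V → ℝ) (T : Finset V)
    (h : ∀ j ∈ T, ∑ i, c i * M i j = 0) :
    IndepFun (T.restrict (π := fun _ => ℝ)) (fun x => lin c x) (gaussianVec M) := by
  -- Both maps are linear, so they are jointly Gaussian and zero covariances suffice for
  -- independence.
  have hG : HasGaussianLaw (fun x : V → ℝ => (fun i : T => x i, fun _ : Unit => lin c x))
      (gaussianVec M) :=
    hasGaussianLaw_gaussianVec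
      ((ContinuousLinearMap.pi fun i : T => ContinuousLinearMap.proj (i : V)).prod
        (ContinuousLinearMap.pi fun _ : Unit => lin c))
  have h1 := HasGaussianLaw.indepFun_of_covariance_eval
    (X := fun (i : T) (x : V → ℝ) => x i) (Y := fun (_ : Unit) (x : V → ℝ) => lin c x) hG
    (fun i _ => by rw [covariance_comm, covariance_lin hM]; exact h i i.2)
  exact h1.comp measurable_id (measurable_pi_apply ())

/-- The row of the precision matrix, extended by zero, gives up to scaling the residual of the
regression of `X_u` on the other coordinates in `I`. -/
lemma exists_precision_row (hM : M.PosDef) {I : Finset V} {u : V} (hu : u ∈ I) :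
    ∃ c : V → ℝ, (∀ w ∉ I, c w = 0) ∧ (∀ w (hw : w ∈ I), c w = precision M I ⟨u, hu⟩ ⟨w, hw⟩) ∧
      ∀ j ∈ I, ∑ i, c i * M i j = if u = j then 1 else 0 := by
  refine ⟨fun w => if hw : w ∈ I then precision M I ⟨u, hu⟩ ⟨w, hw⟩ else 0,
    fun w hw => by simp [hw], fun w hw => by simp [hw], fun j hj => ?_⟩
  have h := congrFun (congrFun (precision_mul hM I) ⟨u, hu⟩) ⟨j, hj⟩
  rw [Matrix.mul_apply, Matrix.one_apply] at h
  simp only [Matrix.submatrix_apply, Subtype.mk.injEq] at h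
  rw [← h, ← Finset.sum_subset (Finset.subset_univ I)]
  · rw [← Finset.sum_coe_sort I]
    exact Finset.sum_congr rfl fun i _ => by simp
  · intro x _ hx
    simp [hx]

/-- Conditional independence of two coordinates of a Gaussian vector means that the entry of the
precision matrix vanishes. -/
lemma condIndepVec_of_coeff_eq_zero (hM : M.PosSemidef) {u v : V} {S : Finset V} {c : V → ℝ}
    (huv : u ≠ v) (hc : ∀ w ∉ insert u S, c w = 0) (hu : u ∉ S) (hcu : c u ≠ 0)
    (hcM : ∀ j ∈ insert v S, ∑ i, c i * M i j = 0) :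
    CondIndepVec (gaussianVec M) {u} {v} S := by
  have h1 := indepFun_lin hM c _ hcM
  let r : (↥(insert v S) → ℝ) → (S → ℝ) × (↥({v} : Finset V) → ℝ) := fun y =>
    (fun i => y ⟨(i : V), Finset.mem_insert_of_mem i.2⟩,
      fun i => y ⟨(i : V), Finset.mem_insert.2 (.inl (Finset.mem_singleton.1 i.2))⟩)
  have hr : Measurable r := by fun_prop
  have h2 := h1.comp hr measurable_id
  -- The equation `W = c · X` is solved for `X_u`, since `c u ≠ 0`: `X_u` becomes a function of
  -- `X_S` and `W`, and `W` is independent of `(X_S, X_v)`.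
  let F : (S → ℝ) × ℝ → (↥({u} : Finset V) → ℝ) := fun z _ =>
    (z.2 - ∑ i : S, c i * z.1 i) / c u
  have hF : Measurable F := by fun_prop
  have h3 := condIndepFun_of_indepFun (k := S.restrict (π := fun _ => ℝ))
    (g := Finset.restrict (π := fun _ => ℝ) {v}) (W := fun x => lin c x) (F := F)
    (Finset.measurable_restrict S) (Finset.measurable_restrict _) (by fun_prop) hF h2
  have he : (fun x => F (S.restrict (π := fun _ => ℝ) x, lin c x)) =
      Finset.restrict (π := fun _ => ℝ) {u} := by
    ext x ⟨i, hi⟩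
    obtain rfl : i = u := Finset.mem_singleton.1 hi
    have hl : lin c x = c i * x i + ∑ j : S, c j * x j := by
      rw [lin_apply, ← Finset.sum_subset (Finset.subset_univ (insert i S)),
        Finset.sum_insert hu, ← Finset.sum_coe_sort S]
      intro w _ hw
      rw [hc w hw, zero_mul]
    simp only [F, hl, Finset.restrict]
    rw [add_sub_cancel_right, mul_div_cancel_left₀ _ hcu]
  rw [he] at h3
  exact h3

/-- The combination `d · X` is a scaled residual of `X_v` given `X_S`, hence independent of `X_S`,
and conditional independence makes it uncorrelated with `X_u`. Evaluating `cᵀ M d` from either side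
then gives `c v = d u = 0`. -/
lemma coeff_eq_zero_of_condIndepVec (hM : M.PosSemidef) {u v : V} {S : Finset V} {c d : V → ℝ}
    (huv : u ≠ v) (hu : u ∉ S) (hc : ∀ w ∉ insert u (insert v S), c w = 0)
    (hd : ∀ w ∉ insert v S, d w = 0)
    (hcM : ∀ j ∈ insert u (insert v S), ∑ i, c i * M i j = if u = j then 1 else 0)
    (hdM : ∀ j ∈ insert v S, ∑ i, d i * M i j = if v = j then 1 else 0) (hv : v ∉ S)
    (h : CondIndepVec (gaussianVec M) {u} {v} S) : c v = 0 := by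
  have h1 : CondIndepFun (MeasurableSpace.comap (S.restrict (π := fun _ => ℝ)) inferInstance)
      (Finset.measurable_restrict S).comap_le (fun x : V → ℝ => x u) (fun x : V → ℝ => x v)
      (gaussianVec M) :=
    CondIndepFun.comp (φ := fun y : ↥({u} : Finset V) → ℝ => y ⟨u, Finset.mem_singleton_self u⟩)
      (ψ := fun y : ↥({v} : Finset V) → ℝ => y ⟨v, Finset.mem_singleton_self v⟩)
      h (by fun_prop) (by fun_prop)
  let H : (S → ℝ) × ℝ → ℝ := fun z => d v * z.2 + ∑ i : S, d i * z.1 i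
  have hH : (fun x : V → ℝ => H (S.restrict (π := fun _ => ℝ) x, x v)) = fun x => lin d x := by
    ext x
    rw [lin_apply, ← Finset.sum_subset (Finset.subset_univ (insert v S)),
      Finset.sum_insert hv, ← Finset.sum_coe_sort S]
    · rfl
    · intro w _ hw
      rw [hd w hw, zero_mul]
  have hind : IndepFun (S.restrict (π := fun _ => ℝ)) (fun x => lin d x) (gaussianVec M) :=
    indepFun_lin hM d S fun j hj => by
      rw [hdM j (Finset.mem_insert_of_mem hj), if_neg]
      rintro rfl
      exact hv hj
  have h2 := integral_mul_eq_zero_of_condIndepFun (μ := gaussianVec M) (H := H)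
    (Finset.measurable_restrict S) (measurable_pi_apply v) (measurable_pi_apply u)
    (by fun_prop) (memLp_gaussianVec (ContinuousLinearMap.proj u))
    (by rw [hH]; exact memLp_gaussianVec (lin d)) (by rw [hH]; exact hind)
    (by rw [hH]; exact integral_gaussianVec (lin d)) h1
  simp only [congrFun hH] at h2
  have h3 : ∑ i, d i * M i u = 0 := by
    have h4 := covariance_eq_sub (memLp_gaussianVec (M := M) (lin d))
      (memLp_gaussianVec (ContinuousLinearMap.proj u))
    rw [integral_gaussianVec, zero_mul, sub_zero] at h4
    rw [← covariance_lin hM d u, ← h2]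
    refine h4.trans (integral_congr_ae (.of_forall fun x => ?_))
    simp [mul_comm]
  have hsym : ∀ i j, M i j = M j i := fun i j => by
    have := hM.isHermitian.apply i j
    simpa using this.symm
  have h4 : ∑ i, ∑ j, c i * M i j * d j = d u := by
    rw [Finset.sum_comm]
    simp_rw [← Finset.sum_mul]
    rw [Finset.sum_eq_single u]
    · rw [hcM u (Finset.mem_insert_self _ _)]; simp
    · intro j _ hj
      by_cases hjS : j ∈ insert v S
      · rw [hcM j (Finset.mem_insert_of_mem hjS), if_neg hj.symm, zero_mul]
      · rw [hd j hjS, mul_zero]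
    · simp
  have h5 : ∑ i, ∑ j, c i * M i j * d j = c v := by
    have : ∀ i, ∑ j, c i * M i j * d j = c i * ∑ j, d j * M j i := fun i => by
      rw [Finset.mul_sum]
      exact Finset.sum_congr rfl fun j _ => by rw [hsym i j]; ring
    simp_rw [this]
    rw [Finset.sum_eq_single v]
    · rw [hdM v (Finset.mem_insert_self _ _)]; simp
    · intro i _ hi
      by_cases hiu : i = u
      · rw [hiu, h3, mul_zero]
      by_cases hiS : i ∈ insert v S
      · rw [hdM i hiS, if_neg (Ne.symm hi), mul_zero]
      · rw [hc i, zero_mul]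
        simp only [Finset.mem_insert] at hiS ⊢
        tauto
    · simp
  rw [← h5, h4]
  exact hd u (by simp [huv, hu])

/-- Conditional independence of two coordinates of a Gaussian vector means that the partial
correlation vanishes. -/
theorem condIndepVec_gaussianVec_iff (hM : M.PosDef) {u v : V} {S : Finset V} (huv : u ≠ v)
    (hu : u ∉ S) (hv : v ∉ S) :
    CondIndepVec (gaussianVec M) {u} {v} S ↔ partialCorr M u v S = 0 := by
  rw [partialCorr_eq_zero_iff hM]
  obtain ⟨c, hc, hcQ, hcM⟩ := exists_precision_row hM (Finset.mem_insert_self u (insert v S))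
  obtain ⟨d, hd, hdQ, hdM⟩ := exists_precision_row hM (Finset.mem_insert_self v S)
  have hv' : v ∈ insert u (insert v S) := Finset.mem_insert_of_mem (Finset.mem_insert_self v S)
  rw [← hcQ v hv']
  constructor
  · exact coeff_eq_zero_of_condIndepVec hM.posSemidef huv hu hc hd hcM hdM hv
  · intro h0
    refine condIndepVec_of_coeff_eq_zero hM.posSemidef (c := c) huv (fun w hw => ?_) hu ?_ ?_
    · by_cases hwv : w = v
      · rw [hwv, h0]
      · refine hc w ?_
        simp only [Finset.mem_insert] at hw ⊢
        tauto
    · rw [hcQ u (Finset.mem_insert_self _ _)]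
      exact ((posDef_precision hM _).diag_pos).ne'
    · intro j hj
      rw [hcM j (Finset.mem_insert_of_mem hj), if_neg]
      rintro rfl
      simp [huv, hu] at hj

end Gaussian

/-! ### Perturbation of inverse matrices -/

section Perturbation

open Matrix

variable {ι : Type*} [Fintype ι] {A A' E : Matrix ι ι ℝ} {ε l : ℝ}

lemma sum_abs_le (x : ι → ℝ) : ∑ i, |x i| ≤ √(Fintype.card ι) * √(x ⬝ᵥ x) := by
  rw [← Real.sqrt_mul (Nat.cast_nonneg _)]
  refine Real.le_sqrt_of_sq_le ?_
  have h := sq_sum_le_card_mul_sum_sq (s := Finset.univ) (f := fun i => |x i|)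
  simpa [dotProduct, sq_abs, ← sq] using h

lemma abs_bilin_le (hE : ∀ i j, |E i j| ≤ ε) (hε : 0 ≤ ε) (x y : ι → ℝ) :
    |x ⬝ᵥ E *ᵥ y| ≤ Fintype.card ι * ε * (√(x ⬝ᵥ x) * √(y ⬝ᵥ y)) := by
  calc |x ⬝ᵥ E *ᵥ y| = |∑ i, ∑ j, x i * (E i j * y j)| := by
        simp only [dotProduct, mulVec, Finset.mul_sum]
    _ ≤ ∑ i, ∑ j, |x i| * (ε * |y j|) := by
        refine (Finset.abs_sum_le_sum_abs _ _).trans (Finset.sum_le_sum fun i _ => ?_)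
        refine (Finset.abs_sum_le_sum_abs _ _).trans (Finset.sum_le_sum fun j _ => ?_)
        rw [abs_mul, abs_mul]
        have := hE i j
        gcongr
    _ = ε * ((∑ i, |x i|) * ∑ j, |y j|) := by
        rw [Finset.sum_mul_sum, Finset.mul_sum]
        refine Finset.sum_congr rfl fun i _ => ?_
        rw [Finset.mul_sum]
        exact Finset.sum_congr rfl fun j _ => by ring
    _ ≤ ε * ((√(Fintype.card ι) * √(x ⬝ᵥ x)) * (√(Fintype.card ι) * √(y ⬝ᵥ y))) := by
        have h1 := sum_abs_le x
        have h2 := sum_abs_le y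
        have h3 : 0 ≤ ∑ j, |y j| := Finset.sum_nonneg fun j _ => abs_nonneg _
        gcongr
    _ = _ := by
        have := Real.mul_self_sqrt (Nat.cast_nonneg (α := ℝ) (Fintype.card ι))
        linear_combination ε * √(x ⬝ᵥ x) * √(y ⬝ᵥ y) * this

lemma dotProduct_self_nonneg' (x : ι → ℝ) : 0 ≤ x ⬝ᵥ x :=
  Finset.sum_nonneg fun _ _ => mul_self_nonneg _

/-- A lower bound for the quadratic form. -/
def QuadLe (l : ℝ) (A : Matrix ι ι ℝ) : Prop := ∀ x : ι → ℝ, l * (x ⬝ᵥ x) ≤ x ⬝ᵥ A *ᵥ x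

lemma QuadLe.perturb (h : QuadLe l A) (hA : ∀ i j, |A' i j - A i j| ≤ ε) (hε : 0 ≤ ε)
    (hk : Fintype.card ι * ε ≤ l / 2) : QuadLe (l / 2) A' := by
  intro x
  have h1 := abs_bilin_le (E := A' - A) hA hε x x
  rw [Real.mul_self_sqrt (dotProduct_self_nonneg' x), sub_mulVec, dotProduct_sub] at h1
  have h2 := (abs_le.1 h1).1
  have h3 := h x
  have h4 := mul_le_mul_of_nonneg_right hk (dotProduct_self_nonneg' x)
  linarith

lemma QuadLe.posDef (h : QuadLe l A) (hl : 0 < l) (hA : A.IsHermitian) : A.PosDef := by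
  refine PosDef.of_dotProduct_mulVec_pos hA fun x hx => ?_
  rw [star_trivial]
  refine lt_of_lt_of_le (mul_pos hl ?_) (h x)
  exact lt_of_le_of_ne (dotProduct_self_nonneg' x) fun h0 => hx (dotProduct_self_eq_zero.1 h0.symm)

variable [DecidableEq ι]

/-- For `y = Q e_j` one has `l |y|² ≤ y · A y = y_j ≤ |y|`. -/
lemma QuadLe.norm_col_inv_le (h : QuadLe l A) (hl : 0 < l) {Q : Matrix ι ι ℝ} (hQ : A * Q = 1)
    (j : ι) : √((fun i => Q i j) ⬝ᵥ (fun i => Q i j)) ≤ 1 / l := by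
  set y : ι → ℝ := fun i => Q i j with hy
  have h1 : A *ᵥ y = Pi.single j 1 := by
    ext i
    have := congrFun (congrFun hQ i) j
    rw [Matrix.mul_apply, Matrix.one_apply] at this
    rw [mulVec, dotProduct, Pi.single_apply]
    exact this
  have h2 := h y
  rw [h1, dotProduct_single_one] at h2
  have h0 := dotProduct_self_nonneg' y
  have h3 : y j ≤ √(y ⬝ᵥ y) := by
    refine Real.le_sqrt_of_sq_le ?_
    rw [sq, dotProduct]
    exact Finset.single_le_sum (f := fun i => y i * y i) (fun i _ => mul_self_nonneg _)
      (Finset.mem_univ j)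
  set N := √(y ⬝ᵥ y)
  have hN : N * N = y ⬝ᵥ y := Real.mul_self_sqrt h0
  rw [le_div_iff₀ hl]
  by_contra! hlt
  have hN0 : 0 < N := by
    by_contra! hle
    nlinarith
  rw [← hN] at h2
  nlinarith

/-- Entrywise perturbation bound for inverse matrices. -/
lemma QuadLe.abs_inv_sub_le (h : QuadLe l A) (hl : 0 < l) (hAs : A.IsHermitian)
    (hA's : A'.IsHermitian) (hA : ∀ i j, |A' i j - A i j| ≤ ε) (hε : 0 ≤ ε)
    (hk : Fintype.card ι * ε ≤ l / 2) (i j : ι) :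
    |A'⁻¹ i j - A⁻¹ i j| ≤ 2 * (Fintype.card ι * ε) / l ^ 2 := by
  have h' := h.perturb hA hε hk
  have hl' : 0 < l / 2 := by linarith
  have hu := (isUnit_iff_isUnit_det _).1 (h.posDef hl hAs).isUnit
  have hu' := (isUnit_iff_isUnit_det _).1 (h'.posDef hl' hA's).isUnit
  -- The resolvent identity turns an entry of the difference into a bilinear form in columns of
  -- norms at most `2 / l` and `1 / l`.
  have e1 : A'⁻¹ - A⁻¹ = A'⁻¹ * (A - A') * A⁻¹ := by
    rw [mul_sub, sub_mul, nonsing_inv_mul _ hu', one_mul, mul_assoc, mul_nonsing_inv _ hu, mul_one]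
  have e2 : (A'⁻¹ - A⁻¹) i j = (fun k => A'⁻¹ k i) ⬝ᵥ (A - A') *ᵥ (fun k => A⁻¹ k j) := by
    have hs : ∀ k, A'⁻¹ k i = A'⁻¹ i k := fun k => by
      have := hA's.inv.apply k i
      simpa using this.symm
    rw [e1, mul_assoc, Matrix.mul_apply]
    simp only [hs, dotProduct, mulVec, Matrix.mul_apply]
  rw [← Matrix.sub_apply, e2]
  refine (abs_bilin_le (E := A - A') (fun i j => ?_) hε _ _).trans ?_
  · rw [Matrix.sub_apply, abs_sub_comm]; exact hA i j
  have n1 := h'.norm_col_inv_le hl' (mul_nonsing_inv _ hu') i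
  have n2 := h.norm_col_inv_le hl (mul_nonsing_inv _ hu) j
  calc _ ≤ Fintype.card ι * ε * (1 / (l / 2) * (1 / l)) := by gcongr
    _ = _ := by field_simp

/-- The diagonal entries of the inverse of a correlation matrix are at least `1`. -/
lemma one_le_inv_diag (hA : A.PosDef) {i : ι} (h1 : A i i = 1) : 1 ≤ A⁻¹ i i := by
  have hu := (isUnit_iff_isUnit_det _).1 hA.isUnit
  set y : ι → ℝ := fun k => A⁻¹ k i with hy
  have e1 : A *ᵥ y = Pi.single i 1 := by
    ext k
    have := congrFun (congrFun (mul_nonsing_inv _ hu) k) i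
    rw [Matrix.mul_apply, Matrix.one_apply] at this
    rw [mulVec, dotProduct, Pi.single_apply]
    exact this
  have hs : y ⬝ᵥ A *ᵥ Pi.single i 1 = 1 := by
    rw [dotProduct_mulVec, ← mulVec_transpose]
    have : Aᵀ = A := by simpa using hA.isHermitian.eq
    rw [this, e1]; simp
  -- With `y = A⁻¹ e_i`, the form at `e_i - y` equals `A⁻¹ i i - 1`.
  have h0 := hA.posSemidef.dotProduct_mulVec_nonneg (Pi.single i 1 - y)
  rw [star_trivial, mulVec_sub, e1, sub_dotProduct, dotProduct_sub, dotProduct_sub, hs] at h0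
  simp [h1] at h0
  exact h0

lemma abs_inv_le_sqrt (hA : A.PosDef) (i j : ι) : |A⁻¹ i j| ≤ √(A⁻¹ i i * A⁻¹ j j) := by
  have hQ := hA.inv
  set Q := A⁻¹
  have hs : Q j i = Q i j := by simpa using hQ.isHermitian.apply i j
  refine Real.abs_le_sqrt ?_
  -- On this vector the form is `Q j j` times the `2 × 2` minor.
  have h0 := hQ.posSemidef.dotProduct_mulVec_nonneg (Q j j • Pi.single i 1 - Q i j • Pi.single j 1)
  have hj := hQ.diag_pos (i := j)
  simp [mulVec_sub, sub_dotProduct, dotProduct_sub, mulVec_smul] at h0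
  rw [hs] at h0
  have h2 : 0 ≤ Q j j * (Q i i * Q j j - Q i j ^ 2) := by linarith
  have := nonneg_of_mul_nonneg_right h2 hj
  linarith

/-- Stability of the normalization in the definition of partial correlations. -/
lemma abs_div_sqrt_sub_le {a b c a' b' c' δ : ℝ} (hb : 1 ≤ b) (hc : 1 ≤ c)
    (hab : |a| ≤ √(b * c)) (ha' : |a' - a| ≤ δ) (hb' : |b' - b| ≤ δ) (hc' : |c' - c| ≤ δ)
    (hδ : δ ≤ 1 / 2) : |a' / √(b' * c') - a / √(b * c)| ≤ 4 * δ := by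
  have hδ0 : 0 ≤ δ := (abs_nonneg _).trans ha'
  obtain ⟨hb1, hb2⟩ := abs_le.1 hb'
  obtain ⟨hc1, hc2⟩ := abs_le.1 hc'
  -- Since `b, c ≥ 1`, absolute errors `δ` are also relative ones; the square root of the product is
  -- then off by a factor within `1 ± δ`.
  have hb3 : b * (1 - δ) ≤ b' := by nlinarith
  have hc3 : c * (1 - δ) ≤ c' := by nlinarith
  have hb4 : b' ≤ b * (1 + δ) := by nlinarith
  have hc4 : c' ≤ c * (1 + δ) := by nlinarith
  have hb0 : 0 ≤ b' := by nlinarith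
  have hc0 : 0 ≤ c' := by nlinarith
  set s := √(b * c) with hs
  set t := √(b' * c') with ht
  have hs1 : 1 ≤ s := Real.one_le_sqrt.2 (by nlinarith)
  have hbc : 0 ≤ b * c := by nlinarith
  have ht1 : s * (1 - δ) ≤ t := by
    refine Real.le_sqrt_of_sq_le ?_
    rw [mul_pow, Real.sq_sqrt hbc]
    calc b * c * (1 - δ) ^ 2 = (b * (1 - δ)) * (c * (1 - δ)) := by ring
      _ ≤ b' * c' := mul_le_mul hb3 hc3 (by nlinarith) hb0
  have ht2 : t ≤ s * (1 + δ) := by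
    refine Real.sqrt_le_iff.2 ⟨by nlinarith, ?_⟩
    rw [mul_pow, Real.sq_sqrt hbc]
    calc b' * c' ≤ (b * (1 + δ)) * (c * (1 + δ)) := mul_le_mul hb4 hc4 hc0 (by nlinarith)
      _ = b * c * (1 + δ) ^ 2 := by ring
  have hst : |s - t| ≤ s * δ := abs_le.2 ⟨by nlinarith, by nlinarith⟩
  have htp : s / 2 ≤ t := by nlinarith
  have ht0 : 0 < t := by linarith
  have hs0 : 0 < s := by linarith
  have e : a' / t - a / s = (a' - a) / t + a * (s - t) / (s * t) := by field_simp; ring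
  rw [e]
  refine (abs_add_le _ _).trans ?_
  have h1 : |(a' - a) / t| ≤ 2 * δ := by
    rw [abs_div, abs_of_pos ht0, div_le_iff₀ ht0]
    nlinarith
  have h2 : |a * (s - t) / (s * t)| ≤ 2 * δ := by
    rw [abs_div, abs_of_pos (mul_pos hs0 ht0), div_le_iff₀ (mul_pos hs0 ht0), abs_mul]
    calc |a| * |s - t| ≤ s * (s * δ) := mul_le_mul hab hst (abs_nonneg _) hs0.le
      _ ≤ 2 * δ * (s * t) := by nlinarith [mul_nonneg hδ0 hs0.le]
  linarith

/-- A lower bound for the eigenvalues bounds the quadratic form. -/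
lemma quadLe_of_eigenvalues (hA : A.IsHermitian)
    (h : ∀ r, Module.End.HasEigenvalue (Matrix.toLin' A) r → l ≤ r) : QuadLe l A := by
  -- Subtracting `l` times the identity shifts the spectrum, reducing the bound to positive
  -- semidefiniteness.
  have hB : (A - l • (1 : Matrix ι ι ℝ)).IsHermitian := by
    refine hA.sub ?_
    rw [IsHermitian, conjTranspose_smul, conjTranspose_one, star_trivial]
  have hp : (A - l • (1 : Matrix ι ι ℝ)).PosSemidef := by
    rw [hB.posSemidef_iff_eigenvalues_nonneg]
    intro i
    have h1 := hB.mulVec_eigenvectorBasis i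
    have h2 : Module.End.HasEigenvalue (Matrix.toLin' A) (hB.eigenvalues i + l) := by
      refine Module.End.hasEigenvalue_of_hasEigenvector
        (x := ⇑(hB.eigenvectorBasis i)) ⟨?_, ?_⟩
      · rw [Module.End.mem_eigenspace_iff, toLin'_apply, add_smul, ← h1, sub_mulVec, smul_mulVec,
          one_mulVec, sub_add_cancel]
      · intro h0
        have := hB.eigenvectorBasis.orthonormal.ne_zero i
        exact this (by ext k; exact congrFun h0 k)
    have := h _ h2
    change 0 ≤ hB.eigenvalues i
    linarith
  intro x
  have h0 := hp.dotProduct_mulVec_nonneg x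
  rw [star_trivial, sub_mulVec, smul_mulVec, one_mulVec, dotProduct_sub, dotProduct_smul,
    smul_eq_mul] at h0
  linarith

end Perturbation

/-! ### Stability of partial correlations; bounds on `cMin` and `lambdaMin` -/

section CorrPerturb

open Matrix

variable {V : Type*} [Fintype V] {q : ℕ} {ε l : ℝ}

lemma sum_coe_eq_sum {I : Finset V} {F : V → ℝ} (h : ∀ w ∉ I, F w = 0) :
    ∑ i : I, F i = ∑ i, F i := by
  rw [Finset.sum_coe_sort I F]
  exact Finset.sum_subset (Finset.subset_univ I) fun w _ hw => h w hw

lemma exists_superset_card {I : Finset V} (h : I.card ≤ q) :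
    ∃ J : Finset V, I ⊆ J ∧ J.card = min q (Fintype.card V) := by
  obtain ⟨J, h1, -, h3⟩ := Finset.exists_subsuperset_card_eq (Finset.subset_univ I)
    (le_min h (Finset.card_le_univ I)) (by rw [Finset.card_univ]; exact min_le_right _ _)
  exact ⟨J, h1, h3⟩

variable [DecidableEq V] {M M' : Matrix V V ℝ}

/-- Quadratic forms of principal submatrices, in terms of vectors supported on the index set. -/
lemma quadLe_submatrix_iff (I : Finset V) :
    QuadLe l (M.submatrix (fun i : I => (i : V)) (fun i : I => (i : V))) ↔
      ∀ x : V → ℝ, (∀ w ∉ I, x w = 0) → l * (x ⬝ᵥ x) ≤ x ⬝ᵥ M *ᵥ x := by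
  have key : ∀ x : V → ℝ, (∀ w ∉ I, x w = 0) →
      (fun i : I => x i) ⬝ᵥ (fun i : I => x i) = x ⬝ᵥ x ∧
      (fun i : I => x i) ⬝ᵥ (M.submatrix (fun i : I => (i : V)) (fun i : I => (i : V))) *ᵥ
        (fun i : I => x i) = x ⬝ᵥ M *ᵥ x := by
    intro x hx
    simp only [dotProduct, mulVec, submatrix_apply]
    constructor
    · exact sum_coe_eq_sum (F := fun i => x i * x i) fun w hw => by rw [hx w hw, zero_mul]
    · rw [← sum_coe_eq_sum (F := fun i => x i * ∑ j, M i j * x j) fun w hw => by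
        rw [hx w hw, zero_mul]]
      refine Finset.sum_congr rfl fun i _ => ?_
      rw [sum_coe_eq_sum (F := fun j => M i j * x j) fun w hw => by rw [hx w hw, mul_zero]]
  constructor
  · intro h x hx
    rw [← (key x hx).1, ← (key x hx).2]
    exact h _
  · intro h x
    let y : V → ℝ := fun w => if hw : w ∈ I then x ⟨w, hw⟩ else 0
    have hy : ∀ w ∉ I, y w = 0 := fun w hw => by simp [y, hw]
    have hxy : (fun i : I => y i) = x := by ext i; simp [y]
    have := h y hy
    rwa [← (key y hy).1, ← (key y hy).2, hxy] at this

lemma hasEigenvalue_nonneg {ι : Type*} [Fintype ι] [DecidableEq ι] {A : Matrix ι ι ℝ}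
    (hA : A.PosSemidef) {r : ℝ} (h : Module.End.HasEigenvalue (Matrix.toLin' A) r) : 0 ≤ r := by
  obtain ⟨x, hx⟩ := h.exists_hasEigenvector
  have h1 : A *ᵥ x = r • x := by simpa using hx.apply_eq_smul
  have h2 := hA.dotProduct_mulVec_nonneg x
  rw [star_trivial, h1, dotProduct_smul, smul_eq_mul] at h2
  have h3 : 0 < x ⬝ᵥ x := lt_of_le_of_ne (dotProduct_self_nonneg' x) fun h0 =>
    hx.2 (dotProduct_self_eq_zero.1 h0.symm)
  exact nonneg_of_mul_nonneg_left h2 h3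

/-- `lambdaMin` only looks at index sets of size `min q (card V)`; vectors on a smaller set are
extended by zero to one of these. -/
lemma quadLe_lambdaMin (hM : M.PosDef) {I : Finset V} (h : I.card ≤ q) :
    QuadLe (lambdaMin M q) (M.submatrix (fun i : I => (i : V)) (fun i : I => (i : V))) := by
  obtain ⟨J, hIJ, hJ⟩ := exists_superset_card h
  rw [quadLe_submatrix_iff]
  intro x hx
  refine (quadLe_submatrix_iff J).1 (quadLe_of_eigenvalues (posDef_submatrix hM J).isHermitian
    fun r hr => ?_) x fun w hw => hx w fun h' => hw (hIJ h')
  refine csInf_le ⟨0, ?_⟩ ⟨J, hJ, hr⟩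
  rintro r ⟨K, -, hK⟩
  exact hasEigenvalue_nonneg (posDef_submatrix hM K).posSemidef hK

lemma lambdaMin_le_one (hM : IsCorrMatrix M) (hq : 1 ≤ q) (u : V) : lambdaMin M q ≤ 1 := by
  have h := (quadLe_submatrix_iff {u}).1 (quadLe_lambdaMin hM.1 (I := {u}) (by simpa using hq))
    (Pi.single u 1) fun w hw => by
      rw [Pi.single_eq_of_ne]; simpa using hw
  simpa [hM.2] using h

/-- Perturbation bound for partial correlations. -/
lemma abs_partialCorr_sub_le (hM : IsCorrMatrix M) (hM' : M'.IsHermitian)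
    (h : ∀ i j, |M' i j - M i j| ≤ ε) (hε : 0 ≤ ε) {u v : V} {S : Finset V}
    (hS : S.card + 2 ≤ q) (hl : 0 < lambdaMin M q) (hq : q * ε ≤ lambdaMin M q / 2)
    (hδ : 2 * (q * ε) / lambdaMin M q ^ 2 ≤ 1 / 2) :
    |partialCorr M' u v S - partialCorr M u v S| ≤ 8 * (q * ε) / lambdaMin M q ^ 2 := by
  set I : Finset V := insert u (insert v S) with hI
  have hcard : I.card ≤ q := by
    have h1 := Finset.card_insert_le u (insert v S)
    have h2 := Finset.card_insert_le v S
    rw [hI]; omega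
  have hk : (Fintype.card I : ℝ) * ε ≤ q * ε := by
    rw [Fintype.card_coe]
    gcongr
  have hpd := posDef_submatrix hM.1 I
  have hherm : (M'.submatrix (fun i : I => (i : V)) (fun i : I => (i : V))).IsHermitian :=
    hM'.submatrix _
  have hQ := fun i j => (quadLe_lambdaMin hM.1 hcard).abs_inv_sub_le hl hpd.isHermitian hherm
    (fun i j => h i j) hε (hk.trans hq) i j
  have hQ' : ∀ i j : I, |precision M' I i j - precision M I i j| ≤
      2 * (q * ε) / lambdaMin M q ^ 2 := fun i j => (hQ i j).trans (by gcongr)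
  have hu : u ∈ I := Finset.mem_insert_self u _
  have hv : v ∈ I := Finset.mem_insert_of_mem (Finset.mem_insert_self v S)
  have key := abs_div_sqrt_sub_le (a := -precision M I ⟨u, hu⟩ ⟨v, hv⟩)
    (a' := -precision M' I ⟨u, hu⟩ ⟨v, hv⟩)
    (one_le_inv_diag hpd (i := ⟨u, hu⟩) (hM.2 u)) (one_le_inv_diag hpd (i := ⟨v, hv⟩) (hM.2 v))
    (by rw [abs_neg]; exact abs_inv_le_sqrt hpd _ _)
    (by rw [neg_sub_neg, abs_sub_comm]; exact hQ' _ _) (hQ' ⟨u, hu⟩ ⟨u, hu⟩)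
    (hQ' ⟨v, hv⟩ ⟨v, hv⟩) hδ
  refine key.trans (le_of_eq ?_)
  ring

lemma bddBelow_cMin : BddBelow {r | ∃ I : Finset V, I.card = min q (Fintype.card V) ∧
    ∃ u ∈ I, ∃ v ∈ I, ∃ S ⊆ I, u ∉ S ∧ v ∉ S ∧ partialCorr M u v S ≠ 0 ∧
      r = |partialCorr M u v S|} := by
  refine ⟨0, ?_⟩
  rintro r ⟨I, -, u, -, v, -, S, -, -, -, -, rfl⟩
  exact abs_nonneg _

/-- The bound `|S| + 2 ≤ q` leaves room for `u` and `v`: the set `{u, v} ∪ S` extends to an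
admissible index set. -/
lemma cMin_le {u v : V} {S : Finset V} (hS : S.card + 2 ≤ q) (hu : u ∉ S) (hv : v ∉ S)
    (h : partialCorr M u v S ≠ 0) : cMin M q ≤ |partialCorr M u v S| := by
  have hcard : (insert u (insert v S)).card ≤ q := by
    have h1 := Finset.card_insert_le u (insert v S)
    have h2 := Finset.card_insert_le v S
    omega
  obtain ⟨J, hIJ, hJ⟩ := exists_superset_card hcard
  refine csInf_le bddBelow_cMin ⟨J, hJ, u, hIJ (by simp), v, hIJ (by simp), S, ?_, hu, hv, h, rfl⟩
  exact fun w hw => hIJ (by simp [hw])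

lemma cMin_le_one (hM : M.PosDef) (hq : 2 ≤ q) (u : V) : cMin M q ≤ 1 := by
  have h := abs_partialCorr_self hM u
  rw [← h]
  refine cMin_le (by simpa using hq) (by simp) (by simp) fun h0 => ?_
  rw [h0] at h
  simp at h

/-- The infimum of the empty set is `0` by convention, so `c > 0` excludes graphs without nodes. -/
lemma cMin_of_isEmpty [IsEmpty V] : cMin M q = 0 := by
  rw [cMin, ← Real.sInf_empty]
  congr 1
  refine Set.eq_empty_of_forall_notMem ?_
  rintro r ⟨I, -, u, -⟩
  exact isEmptyElim u

end CorrPerturb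

/-! ### Marginals of nonparanormal distributions -/

section Marginal

open Matrix

variable {V W : Type*} {M : Matrix V V ℝ}

/-- Selection of coordinates. -/
noncomputable def selectCLM (e : W → V) : EuclideanSpace ℝ V →L[ℝ] EuclideanSpace ℝ W :=
  ((EuclideanSpace.equiv W ℝ).symm : (W → ℝ) →L[ℝ] EuclideanSpace ℝ W).comp
    ((ContinuousLinearMap.pi fun k => ContinuousLinearMap.proj (e k)).comp
      (EuclideanSpace.equiv V ℝ : EuclideanSpace ℝ V →L[ℝ] (V → ℝ)))

lemma selectCLM_apply (e : W → V) (x : EuclideanSpace ℝ V) (k : W) :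
    selectCLM e x k = x (e k) := rfl

lemma isCorrMatrix_submatrix (hM : IsCorrMatrix M) {e : W → V} (he : Function.Injective e) :
    IsCorrMatrix (M.submatrix e e) :=
  ⟨hM.1.submatrix he, fun k => hM.2 (e k)⟩

variable [Fintype V] [DecidableEq V] [Fintype W] [DecidableEq W]

/-- A Gaussian measure is determined by its mean and covariance, and both are those of the selected
coordinates. -/
lemma map_selectCLM_multivariateGaussian (hM : M.PosSemidef) (e : W → V) :
    (multivariateGaussian 0 M).map (selectCLM e) = multivariateGaussian 0 (M.submatrix e e) := by
  apply IsGaussian.ext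
  · simp only [id_eq, integral_id_multivariateGaussian]
    rw [ContinuousLinearMap.integral_id_map, integral_id_multivariateGaussian, map_zero]
    exact IsGaussian.integrable_id
  rw [← ContinuousLinearMap.toBilinForm_inj]
  refine LinearMap.BilinForm.ext_basis (EuclideanSpace.basisFun W ℝ).toBasis fun i j => ?_
  rw [ContinuousLinearMap.toBilinForm_apply, ContinuousLinearMap.toBilinForm_apply,
    covarianceBilin_apply_eq_cov, covariance_map]
  · have (i : W) : (fun u => inner ℝ ((EuclideanSpace.basisFun W ℝ).toBasis i) u) ∘
        selectCLM e = fun u => u (e i) := by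
      ext x; simp [PiLp.inner_apply, selectCLM_apply]
    simp_rw [this, covariance_eval_multivariateGaussian hM,
      covarianceBilin_multivariateGaussian (hM.submatrix _)]
    simp
  any_goals exact Measurable.aestronglyMeasurable (by fun_prop)
  · fun_prop
  · exact IsGaussian.memLp_two_id

lemma map_select_npn (hM : M.PosSemidef) {f : V → ℝ → ℝ} (hf : ∀ v, StrictMono (f v))
    (e : W → V) : (npn f M).map (fun x k => x (e k)) = npn (fun k => f (e k)) (M.submatrix e e) := by
  have hm : ∀ v, Measurable (f v) := fun v => (hf v).monotone.measurable
  unfold npn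
  rw [← map_selectCLM_multivariateGaussian hM, Measure.map_map (by fun_prop) (by fun_prop),
    Measure.map_map (by fun_prop) (by fun_prop)]
  rfl

end Marginal

/-! ### Concentration of the estimated correlation matrix -/

section Concentration

variable {A B : ℝ} {rhoHat : ∀ n : ℕ, (Fin n → ℝ × ℝ) → ℝ} {n p : ℕ}
  {M : Matrix (Fin p) (Fin p) ℝ} {g : Fin p → ℝ → ℝ} {Ω : Type*} [MeasurableSpace Ω]
  {P : Measure Ω} [IsProbabilityMeasure P] {X : Fin n → Ω → Fin p → ℝ}

/-- Two coordinates of a nonparanormal vector are bivariate nonparanormal with the corresponding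
correlation, so the assumption on the estimator applies to each pair. -/
lemma measureReal_rhoHat_le (hrho : IsGoodEstimator A B rhoHat) (hn : 1 ≤ n)
    (hM : IsCorrMatrix M) (hg : ∀ v, StrictMono (g v))
    (hX : ∀ i, HasLaw (X i) (npn g M) P) (hindep : iIndepFun X P) {u v : Fin p} (huv : u ≠ v)
    {ε : ℝ} (hε : 0 < ε) :
    P.real {ω | ε < |rhoHat n (fun i => (X i ω u, X i ω v)) - M u v|} ≤
      A * Real.exp (-B * n * ε ^ 2) := by
  have he : Function.Injective ![u, v] := by
    intro i j
    fin_cases i <;> fin_cases j <;> simp [huv, huv.symm]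
  let φ : (Fin p → ℝ) → Fin 2 → ℝ := fun x k => x (![u, v] k)
  have hφ : Measurable φ := by fun_prop
  have hY : ∀ i, AEMeasurable (fun ω => φ (X i ω)) P := fun i =>
    hφ.comp_aemeasurable (hX i).aemeasurable
  have hlaw : P.map (fun ω i => φ (X i ω)) = Measure.pi fun _ : Fin n =>
      npn (fun k => g (![u, v] k)) (M.submatrix ![u, v] ![u, v]) := by
    have h1 : iIndepFun (fun i ω => φ (X i ω)) P := hindep.comp (fun _ => φ) fun _ => hφ
    rw [(iIndepFun_iff_map_fun_eq_pi_map hY).1 h1]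
    congr 1
    ext1 i
    rw [← map_select_npn hM.1.posSemidef hg, ← (hX i).map_eq,
      AEMeasurable.map_map_of_aemeasurable hφ.aemeasurable (hX i).aemeasurable]
    rfl
  have h2 := hrho.2 n hn (fun k => g (![u, v] k)) (fun k => hg _) _
    (isCorrMatrix_submatrix hM he) ε hε
  rw [← hlaw, map_measureReal_apply_of_aemeasurable (aemeasurable_pi_iff.2 hY)] at h2
  · exact h2
  · refine measurableSet_lt measurable_const ?_
    have := hrho.1 n
    fun_prop

/-- With high probability all entries of the estimated correlation matrix are accurate. -/
lemma measureReal_corrHat_le (hA : 0 ≤ A) (hrho : IsGoodEstimator A B rhoHat) (hn : 1 ≤ n)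
    (hM : IsCorrMatrix M) (hg : ∀ v, StrictMono (g v))
    (hX : ∀ i, HasLaw (X i) (npn g M) P) (hindep : iIndepFun X P) {ε : ℝ} (hε : 0 < ε) :
    P.real {ω | ∃ u v, ε < |corrHat rhoHat (fun i => X i ω) u v - M u v|} ≤
      (p : ℝ) ^ 2 * (A * Real.exp (-B * n * ε ^ 2)) := by
  have hsym : ∀ i j, M i j = M j i := fun i j => by
    have := hM.1.isHermitian.apply i j
    simpa using this.symm
  have hone : ∀ e : Fin p × Fin p,
      P.real {ω | ε < |corrHat rhoHat (fun i => X i ω) e.1 e.2 - M e.1 e.2|} ≤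
        A * Real.exp (-B * n * ε ^ 2) := by
    rintro ⟨u, v⟩
    by_cases huv : u = v
    · subst huv
      have : {ω | ε < |corrHat rhoHat (fun i => X i ω) u u - M u u|} = ∅ := by
        ext ω
        simp [corrHat, hM.2, hε.le]
      rw [this, measureReal_empty]
      positivity
    · by_cases hlt : u < v
      · simp only [corrHat, huv, if_false, hlt, if_true]
        exact measureReal_rhoHat_le hrho hn hM hg hX hindep huv hε
      · simp only [corrHat, huv, if_false, hlt]
        rw [hsym u v]
        exact measureReal_rhoHat_le hrho hn hM hg hX hindep (Ne.symm huv) hε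
  have hset : {ω | ∃ u v, ε < |corrHat rhoHat (fun i => X i ω) u v - M u v|} =
      ⋃ e ∈ (Finset.univ : Finset (Fin p × Fin p)),
        {ω | ε < |corrHat rhoHat (fun i => X i ω) e.1 e.2 - M e.1 e.2|} := by
    ext ω; simp
  rw [hset]
  refine (measureReal_biUnion_finset_le _ _).trans
    ((Finset.sum_le_sum fun e _ => hone e).trans (le_of_eq ?_))
  rw [Finset.sum_const, Finset.card_univ, Fintype.card_prod, Fintype.card_fin, nsmul_eq_mul]
  push_cast
  ring

lemma corrHat_isHermitian (x : Fin n → Fin p → ℝ) : (corrHat rhoHat x).IsHermitian := by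
  ext i j
  simp only [Matrix.conjTranspose_apply, star_trivial, corrHat]
  rcases lt_trichotomy i j with h | h | h
  · simp [h.ne, h.ne', h, h.not_gt]
  · simp [h]
  · simp [h.ne, h.ne', h, h.not_gt]

end Concentration

/-! ### The normal quantile function -/

section Quantile

lemma cdf_gaussian_eq (x : ℝ) : cdf (gaussianReal 0 1) x = (gaussianReal 0 1).real (Set.Iic x) :=
  cdf_eq_real _ _

lemma strictMono_cdf_gaussian : StrictMono (cdf (gaussianReal 0 1)) := by
  intro x y hxy
  rw [cdf_gaussian_eq, cdf_gaussian_eq, ← Set.Iic_union_Ioc_eq_Iic hxy.le,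
    measureReal_union (by
      rw [Set.disjoint_left]
      exact fun a ha hb => absurd hb.1 (not_lt.2 ha)) measurableSet_Ioc]
  have h : 0 < (gaussianReal 0 1).real (Set.Ioc x y) := by
    rw [measureReal_def, ENNReal.toReal_pos_iff]
    refine ⟨?_, measure_lt_top _ _⟩
    refine pos_iff_ne_zero.2 fun h0 => ?_
    have h1 := gaussianReal_absolutelyContinuous' 0 one_ne_zero h0
    rw [Real.volume_Ioc, ENNReal.ofReal_eq_zero] at h1
    linarith
  linarith

lemma half_lt_cdf_gaussian {x : ℝ} (hx : 0 < x) : 1 / 2 < cdf (gaussianReal 0 1) x := by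
  have h1 : (gaussianReal 0 1).real (Set.Iic x) + (gaussianReal 0 1).real (Set.Ioi x) = 1 := by
    rw [← Set.compl_Iic, measureReal_add_measureReal_compl measurableSet_Iic]
    simp
  have h2 : (gaussianReal 0 1).real (Set.Ioi x) ≤ (gaussianReal 0 1).real (Set.Iic (-x)) := by
    have h3 : (gaussianReal 0 1).map (fun y => -y) = gaussianReal 0 1 := by
      rw [gaussianReal_map_neg, neg_zero]
    calc (gaussianReal 0 1).real (Set.Ioi x)
        = ((gaussianReal 0 1).map (fun y => -y)).real (Set.Ioi x) := by rw [h3]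
      _ = (gaussianReal 0 1).real ((fun y => -y) ⁻¹' Set.Ioi x) :=
          map_measureReal_apply measurable_neg measurableSet_Ioi
      _ ≤ _ := measureReal_mono fun y hy => by
          simp only [Set.mem_preimage, Set.mem_Ioi, Set.mem_Iic] at hy ⊢
          linarith
  have h3 := strictMono_cdf_gaussian (show -x < x by linarith)
  rw [cdf_gaussian_eq, cdf_gaussian_eq] at h3
  rw [cdf_gaussian_eq]
  linarith

lemma normalQuantile_cdf (x : ℝ) : normalQuantile (cdf (gaussianReal 0 1) x) = x := by
  have : {y : ℝ | cdf (gaussianReal 0 1) x ≤ cdf (gaussianReal 0 1) y} = Set.Ici x := by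
    ext y
    exact strictMono_cdf_gaussian.le_iff_le
  rw [normalQuantile, this, csInf_Ici]

/-- Every positive number is the critical value of some level. -/
lemma exists_level {z : ℝ} (hz : 0 < z) :
    ∃ α ∈ Set.Ioo (0 : ℝ) 1, 2 * normalQuantile (1 - α / 2) = z := by
  have h1 := half_lt_cdf_gaussian (half_pos hz)
  have h2 : cdf (gaussianReal 0 1) (z / 2) < 1 :=
    (strictMono_cdf_gaussian (show z / 2 < z by linarith)).trans_le (cdf_le_one _ _)
  -- The level is `2 (1 - Φ(z/2))`, which is in `(0, 1)` because `1/2 < Φ(z/2) < 1`.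
  refine ⟨2 * (1 - cdf (gaussianReal 0 1) (z / 2)), ⟨by linarith, by linarith⟩, ?_⟩
  rw [show 1 - 2 * (1 - cdf (gaussianReal 0 1) (z / 2)) / 2 = cdf (gaussianReal 0 1) (z / 2) by
    ring, normalQuantile_cdf]
  ring

end Quantile

/-! ### The threshold of the Fisher test -/

section Cutoff

open Real

lemma cutoff_lt_one (n s : ℕ) (z : ℝ) : cutoff n s z < 1 := by
  unfold cutoff
  have := exp_pos (z / √((n : ℝ) - s - 3))
  rw [div_lt_one (by linarith)]
  linarith

/-- Fisher's z-transform is increasing. -/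
lemma abs_log_div_le_iff {r y : ℝ} (hr : |r| < 1) :
    |log ((1 + r) / (1 - r))| ≤ y ↔ |r| ≤ (exp y - 1) / (exp y + 1) := by
  obtain ⟨h1, h2⟩ := abs_lt.1 hr
  have hp : 0 < 1 + r := by linarith
  have hm : 0 < 1 - r := by linarith
  have hd := div_pos hp hm
  have he := exp_pos y
  rw [abs_le, abs_le, ← exp_le_exp, ← exp_le_exp (x := log _), exp_log hd, exp_neg,
    div_le_iff₀ hm, le_div_iff₀ hm, ← neg_div, div_le_iff₀ (by linarith),
    le_div_iff₀ (by linarith), inv_mul_le_iff₀ he]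
  constructor <;> rintro ⟨h3, h4⟩ <;> constructor <;> nlinarith

/-- The factor `1/2` of the z-transform cancels the `2` in front of the quantile. For `|r| ≥ 1` both
sides fail, since the threshold is below `1`. -/
lemma fisherAccept_iff {n s : ℕ} {α z : ℝ} (hn : s + 3 < n)
    (hz : 2 * normalQuantile (1 - α / 2) = z) (r : ℝ) :
    FisherAccept n α s r ↔ |r| ≤ cutoff n s z := by
  have hm : 0 < (n : ℝ) - s - 3 := by
    have : ((s + 3 : ℕ) : ℝ) < n := by exact_mod_cast hn
    push_cast at this
    linarith
  have hs := sqrt_pos.2 hm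
  by_cases hr : |r| < 1
  · rw [FisherAccept, and_iff_right hr, cutoff, ← abs_log_div_le_iff hr, le_div_iff₀ hs, abs_mul,
      abs_of_pos (by norm_num : (0 : ℝ) < 1 / 2), ← hz]
    constructor <;> intro h <;> nlinarith
  · refine iff_of_false (fun h => hr h.1) fun h => hr (h.trans_lt (cutoff_lt_one n s z))

lemma log_ratio_pos {t : ℝ} (h0 : 0 < t) (h1 : t < 1) : 0 < log ((1 + t) / (1 - t)) :=
  log_pos (by rw [lt_div_iff₀ (by linarith)]; linarith)

lemma zSeq_pos {n : ℕ} {c : ℝ} (hn : 3 < n) (h0 : 0 < c) (h1 : c ≤ 1) : 0 < zSeq n c := by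
  have : (3 : ℝ) < n := by exact_mod_cast hn
  exact mul_pos (sqrt_pos.2 (by linarith)) (log_ratio_pos (by linarith) (by linarith))

/-- The bounds `c/3 ≤ γ(n, s, z_n) ≤ 2c/3`. -/
lemma cutoff_bounds {n s : ℕ} {c : ℝ} (hn : 4 * s + 9 ≤ 3 * n) (hn' : s + 3 < n) (h0 : 0 < c)
    (h1 : c ≤ 1) : c / 3 ≤ cutoff n s (zSeq n c) ∧ cutoff n s (zSeq n c) ≤ 2 * c / 3 := by
  have hm : 0 < (n : ℝ) - s - 3 := by
    have : ((s + 3 : ℕ) : ℝ) < n := by exact_mod_cast hn'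
    push_cast at this
    linarith
  have hn4 : (4 : ℝ) * s + 9 ≤ 3 * n := by exact_mod_cast hn
  have hs0 : (0 : ℝ) ≤ s := Nat.cast_nonneg s
  have hsq := sqrt_pos.2 hm
  set t := c / 3 with ht
  have ht0 : 0 < t := by positivity
  have ht1 : t ≤ 1 / 3 := by linarith
  have hL := log_ratio_pos ht0 (by linarith)
  set L := log ((1 + t) / (1 - t)) with hLdef
  have hm' : 0 < 1 - t := by linarith
  have heL : exp L = (1 + t) / (1 - t) := exp_log (div_pos (by linarith) hm')
  set y := zSeq n c / √((n : ℝ) - s - 3) with hy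
  -- The threshold is `tanh(y/2)`, while `t = tanh(L/2)`. The hypothesis `4s + 9 ≤ 3n` says `n - 3 ≤
  -- 4 (n - s - 3)`, so `L ≤ y ≤ 2L`, and `tanh L = 2t / (1 + t²) ≤ 2t`.
  have hy1 : L ≤ y := by
    rw [hy, le_div_iff₀ hsq, zSeq, ← ht, ← hLdef, mul_comm]
    exact mul_le_mul_of_nonneg_right (sqrt_le_sqrt (by linarith)) hL.le
  have hy2 : y ≤ L + L := by
    rw [hy, div_le_iff₀ hsq, zSeq, ← ht, ← hLdef]
    have : √((n : ℝ) - 3) ≤ 2 * √((n : ℝ) - s - 3) := by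
      rw [sqrt_le_iff]
      refine ⟨by positivity, ?_⟩
      rw [mul_pow, sq_sqrt hm.le]
      linarith
    nlinarith
  have he1 : (1 + t) / (1 - t) ≤ exp y := heL ▸ exp_le_exp.2 hy1
  have he2 : exp y ≤ ((1 + t) / (1 - t)) * ((1 + t) / (1 - t)) := by
    rw [← heL, ← exp_add]
    exact exp_le_exp.2 hy2
  have he0 := exp_pos y
  rw [div_le_iff₀ hm'] at he1
  rw [div_mul_div_comm, le_div_iff₀ (mul_pos hm' hm')] at he2
  have hc : 2 * c / 3 = 2 * t := by rw [ht]; ring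
  rw [hc]
  change t ≤ (exp y - 1) / (exp y + 1) ∧ (exp y - 1) / (exp y + 1) ≤ 2 * t
  rw [le_div_iff₀ (by linarith), div_le_iff₀ (by linarith)]
  constructor
  · linarith
  · by_contra! hlt
    have h5 : 1 + 2 * t < exp y * (1 - 2 * t) := by linarith
    have h6 : (1 + 2 * t) * ((1 - t) * (1 - t)) < (1 + t) * (1 + t) * (1 - 2 * t) := by
      calc (1 + 2 * t) * ((1 - t) * (1 - t))
          < exp y * (1 - 2 * t) * ((1 - t) * (1 - t)) := by
            exact mul_lt_mul_of_pos_right h5 (mul_pos hm' hm')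
        _ = (exp y * ((1 - t) * (1 - t))) * (1 - 2 * t) := by ring
        _ ≤ (1 + t) * (1 + t) * (1 - 2 * t) :=
            mul_le_mul_of_nonneg_right he2 (by linarith)
    nlinarith [pow_pos ht0 3]

end Cutoff

/-! ### Accurate correlations give a correct output -/

section Algorithm

variable {A B : ℝ} {rhoHat : ∀ n : ℕ, (Fin n → ℝ × ℝ) → ℝ} {n p q : ℕ}
  {M : Matrix (Fin p) (Fin p) ℝ} {G : DAG (Fin p)}

/-- Faithfulness concerns all monotone transformations; the identity, which gives the Gaussian law
itself, is enough. -/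
lemma dSep_iff_partialCorr (hM : IsCorrMatrix M) (hG : Faithful G M) {u v : Fin p}
    {S : Finset (Fin p)} (huv : u ≠ v) (hu : u ∉ S) (hv : v ∉ S) :
    G.DSep u v S ↔ partialCorr M u v S = 0 := by
  rw [← condIndepVec_gaussianVec_iff hM.1 huv hu hv,
    ← hG (fun _ x => x) (fun _ => strictMono_id) {u} {v} S (by simpa using huv) (by simpa using hu)
      (by simpa using hv)]
  simp

/-- If the estimated correlation matrix is accurate, Rank PC finds the CPDAG. -/
lemma rankPC_eq_cpdag {α : ℝ} (hM : IsCorrMatrix M) (hG : Faithful G M) (hq : q = G.deg + 2)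
    (hc : 0 < cMin M q) (hl : 0 < lambdaMin M q) (u₀ : Fin p)
    (hα : ∀ s ≤ q, ∃ γ, (∀ r, FisherAccept n α s r ↔ |r| ≤ γ) ∧ cMin M q / 3 ≤ γ ∧
      γ ≤ 2 * cMin M q / 3) (x : Fin n → Fin p → ℝ)
    (hx : ∀ u v, |corrHat rhoHat x u v - M u v| ≤ cMin M q * lambdaMin M q ^ 2 / (25 * q)) :
    (rankPC rhoHat α x : Set (Fin p × Fin p)) = G.cpdag := by
  have hq2 : 2 ≤ q := by omega
  have hq0 : (0 : ℝ) < q := by exact_mod_cast (by omega : 0 < q)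
  have hc1 := cMin_le_one hM.1 hq2 u₀
  have hl1 := lambdaMin_le_one hM (by omega : 1 ≤ q) u₀
  set c := cMin M q
  set l := lambdaMin M q
  have hqε : q * (c * l ^ 2 / (25 * q)) = c * l ^ 2 / 25 := by field_simp
  refine pc_eq_cpdag fun i j S hij hi hj hS => ?_
  rw [dSep_iff_partialCorr hM hG hij hi hj]
  refine (@decide_eq_true_iff _ (Classical.propDecidable _)).trans ?_
  obtain ⟨γ, hγ, h1, h2⟩ := hα S.card (by omega)
  have h3 := abs_partialCorr_sub_le (q := q) hM (corrHat_isHermitian x) hx (by positivity)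
    (u := i) (v := j) (S := S) (by omega) hl
    (by rw [hqε]; change _ ≤ l / 2; nlinarith [mul_pos hc hl])
    (by
      rw [hqε]
      change 2 * (c * l ^ 2 / 25) / l ^ 2 ≤ 1 / 2
      rw [div_le_iff₀ (by positivity)]
      nlinarith [pow_pos hl 2])
  rw [hqε] at h3
  -- The constant `25` is chosen so that `8/25 < 1/3` and `1 - 8/25 > 2/3`, which separates zero
  -- from nonzero partial correlations strictly.
  have h4 : 8 * (c * l ^ 2 / 25) / l ^ 2 = 8 * c / 25 := by field_simp
  change |partialCorr (corrHat rhoHat x) i j S - partialCorr M i j S| ≤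
    8 * (c * l ^ 2 / 25) / l ^ 2 at h3
  rw [h4] at h3
  rw [hγ]
  constructor
  · intro h5
    by_contra h6
    have h7 : c ≤ |partialCorr M i j S| := cMin_le (by omega) hi hj h6
    have h8 := abs_sub_abs_le_abs_sub (partialCorr M i j S) (partialCorr (corrHat rhoHat x) i j S)
    rw [abs_sub_comm] at h8
    linarith
  · intro h5
    rw [h5, sub_zero] at h3
    linarith

end Algorithm

/-! ### Asymptotics of the failure probability -/

section Limits

open Real

variable {Ω : ℕ → Type*} [∀ n, MeasurableSpace (Ω n)]

/-- Events that contain the complements of events of vanishing probability have probability tending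
to one. -/
lemma tendsto_measureReal_one {P : ∀ n, Measure (Ω n)} [∀ n, IsProbabilityMeasure (P n)]
    {good bad : ∀ n, Set (Ω n)} {δ : ℕ → ℝ} (hδ : Tendsto δ atTop (𝓝 0))
    (hbad : ∀ᶠ n in atTop, (P n).real (bad n) ≤ δ n)
    (hgood : ∀ᶠ n in atTop, ∀ ω, ω ∉ bad n → ω ∈ good n) :
    Tendsto (fun n => (P n).real (good n)) atTop (𝓝 1) := by
  have h1 : Tendsto (fun n => 1 - δ n) atTop (𝓝 1) := by simpa using hδ.const_sub 1
  refine tendsto_of_tendsto_of_tendsto_of_le_of_le' h1 tendsto_const_nhds ?_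
    (Eventually.of_forall fun n => measureReal_le_one)
  filter_upwards [hbad, hgood] with n hb hg
  have h2 : (Set.univ : Set (Ω n)) = good n ∪ bad n := by
    ext ω
    simpa using (em (ω ∈ bad n)).elim Or.inr fun h => Or.inl (hg ω h)
  -- Subadditivity needs no measurability, so that of the output event is never required.
  have h3 := measureReal_union_le (μ := P n) (good n) (bad n)
  rw [← h2, probReal_univ] at h3
  linarith

lemma isLittleO_rpow_rpow_natCast {r s : ℝ} (h : r < s) :
    (fun n : ℕ => (n : ℝ) ^ r) =o[atTop] fun n : ℕ => (n : ℝ) ^ s := by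
  have h1 : Tendsto (fun n : ℕ => (n : ℝ) ^ (-(s - r))) atTop (𝓝 0) :=
    (tendsto_rpow_neg_atTop (sub_pos.2 h)).comp tendsto_natCast_atTop_atTop
  refine (isLittleO_iff_tendsto' ?_).2 (h1.congr' ?_)
  · filter_upwards [eventually_gt_atTop 0] with n hn h0
    have : (0 : ℝ) < n := by exact_mod_cast hn
    exact absurd h0 (by positivity)
  · filter_upwards [eventually_gt_atTop 0] with n hn
    have : (0 : ℝ) < n := by exact_mod_cast hn
    rw [← rpow_sub this, neg_sub]

/-- A natural-valued sequence of order `n ^ b` with `b < 1` is eventually dominated by `n`. -/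
lemma eventually_mul_add_le {q : ℕ → ℕ} {b : ℝ} (hb : b < 1)
    (hq : (fun n => (q n : ℝ)) =O[atTop] fun n : ℕ => (n : ℝ) ^ b) :
    ∀ᶠ n in atTop, 4 * q n + 12 ≤ n := by
  have h1 : (fun n : ℕ => (n : ℝ) ^ b) =o[atTop] fun n : ℕ => (n : ℝ) := by
    simpa using isLittleO_rpow_rpow_natCast hb
  have h2 := (hq.trans_isLittleO h1).bound (show (0 : ℝ) < 1 / 8 by norm_num)
  filter_upwards [h2, eventually_ge_atTop 24] with n h3 h4
  rw [norm_of_nonneg (Nat.cast_nonneg _), norm_of_nonneg (Nat.cast_nonneg _)] at h3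
  have h5 : (24 : ℝ) ≤ n := by exact_mod_cast h4
  have : ((4 * q n + 12 : ℕ) : ℝ) ≤ n := by
    push_cast
    linarith
  exact_mod_cast this

lemma eventually_le_mul_of_isBigO {u : ℕ → ℝ} {d : ℝ} (hu : ∀ n, 0 ≤ u n)
    (h : (fun n : ℕ => (n : ℝ) ^ (-d)) =O[atTop] u) :
    ∃ C > 0, ∀ᶠ n : ℕ in atTop, C * (n : ℝ) ^ (-d) ≤ u n := by
  obtain ⟨K, hK, hb⟩ := h.exists_pos
  refine ⟨K⁻¹, inv_pos.2 hK, ?_⟩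
  filter_upwards [hb.bound] with n hn
  rw [norm_of_nonneg (by positivity), norm_of_nonneg (hu n)] at hn
  rwa [inv_mul_le_iff₀ hK]

/-- The tail bound `A p² exp(- B n ε²)` vanishes if `log p = O(n ^ a)`, `ε = Ω(n ^ (- e))` and
`a + 2 e < 1`. -/
lemma tendsto_tail_zero {A B a e C : ℝ} (hA : 0 < A) (hB : 0 < B) (hC : 0 < C) (ha : 0 ≤ a)
    (hae : a + 2 * e < 1) {p : ℕ → ℕ} {ε : ℕ → ℝ}
    (hp : (fun n => log (p n)) =O[atTop] fun n : ℕ => (n : ℝ) ^ a)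
    (hε : ∀ᶠ n : ℕ in atTop, C * (n : ℝ) ^ (-e) ≤ ε n) :
    Tendsto (fun n : ℕ => (p n : ℝ) ^ 2 * (A * exp (-B * n * ε n ^ 2))) atTop (𝓝 0) := by
  obtain ⟨K, hK, hpK⟩ := hp.exists_pos
  have hθ : a < 1 - 2 * e := by linarith
  have hlim : Tendsto (fun n : ℕ => A * exp (-(B * C ^ 2 / 2) * (n : ℝ) ^ (1 - 2 * e))) atTop
      (𝓝 0) := by
    have h1 : Tendsto (fun n : ℕ => (n : ℝ) ^ (1 - 2 * e)) atTop atTop :=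
      (tendsto_rpow_atTop (by linarith)).comp tendsto_natCast_atTop_atTop
    have h2 := tendsto_exp_atBot.comp
      (h1.const_mul_atTop_of_neg (show -(B * C ^ 2 / 2) < 0 by
        have : 0 < B * C ^ 2 := by positivity
        linarith))
    simpa using h2.const_mul A
  -- The factor `p²` contributes at most `2 K n ^ a` to the exponent, eventually no more than half
  -- of the decay; the other half remains.
  have hsmall : ∀ᶠ n : ℕ in atTop,
      2 * K * (n : ℝ) ^ a ≤ B * C ^ 2 / 2 * (n : ℝ) ^ (1 - 2 * e) := by
    have h2 := (isLittleO_rpow_rpow_natCast hθ).bound (show 0 < B * C ^ 2 / 2 / (2 * K) by positivity)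
    filter_upwards [h2] with n h3
    rw [norm_of_nonneg (by positivity), norm_of_nonneg (by positivity), div_mul_eq_mul_div,
      le_div_iff₀ (by positivity)] at h3
    linarith
  refine squeeze_zero' (Eventually.of_forall fun n => by positivity) ?_ hlim
  filter_upwards [hpK.bound, hε, hsmall, eventually_gt_atTop 0] with n h1 h2 h3 h4
  have hn : (0 : ℝ) < n := by exact_mod_cast h4
  rw [norm_of_nonneg (log_natCast_nonneg _), norm_of_nonneg (by positivity)] at h1
  have h5 : (p n : ℝ) ^ 2 ≤ exp (2 * K * (n : ℝ) ^ a) := by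
    -- `p n = 0` is treated apart because `exp (log 0) = 1` for the convention `log 0 = 0`.
    rcases Nat.eq_zero_or_pos (p n) with h | h
    · rw [h]
      simp [exp_nonneg]
    · have : (0 : ℝ) < p n := by exact_mod_cast h
      rw [← exp_log this, ← exp_nat_mul, exp_le_exp]
      push_cast
      linarith
  have h6 : C ^ 2 * (n : ℝ) ^ (1 - 2 * e) ≤ n * ε n ^ 2 := by
    have h7 : (n : ℝ) ^ (1 - 2 * e) = n * ((n : ℝ) ^ (-e)) ^ 2 := by
      rw [← rpow_natCast, ← rpow_mul hn.le]
      nth_rewrite 2 [← rpow_one (n : ℝ)]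
      rw [← rpow_add hn]
      congr 1
      push_cast
      ring
    have h8 : (C * (n : ℝ) ^ (-e)) ^ 2 ≤ ε n ^ 2 := pow_le_pow_left₀ (by positivity) h2 2
    rw [h7]
    calc C ^ 2 * (n * ((n : ℝ) ^ (-e)) ^ 2) = n * (C * (n : ℝ) ^ (-e)) ^ 2 := by ring
      _ ≤ _ := mul_le_mul_of_nonneg_left h8 hn.le
  calc (p n : ℝ) ^ 2 * (A * exp (-B * n * ε n ^ 2))
      ≤ exp (2 * K * (n : ℝ) ^ a) * (A * exp (-B * n * ε n ^ 2)) := by gcongr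
    _ = A * exp (2 * K * (n : ℝ) ^ a + -B * n * ε n ^ 2) := by rw [exp_add]; ring
    _ ≤ _ := by
        refine mul_le_mul_of_nonneg_left (exp_le_exp.2 ?_) hA.le
        have := mul_le_mul_of_nonneg_left h6 hB.le
        linarith

/-- The admissible error is `Ω(n ^ (- (d + 2 f + b)))`. -/
lemma eventually_le_error {b d f C₁ C₂ K : ℝ} (h1 : 0 < C₁) (h2 : 0 < C₂) (hK : 0 < K)
    {q : ℕ → ℕ} {c l : ℕ → ℝ} (hq0 : ∀ n, 0 < q n)
    (hc : ∀ᶠ n : ℕ in atTop, C₁ * (n : ℝ) ^ (-d) ≤ c n)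
    (hl : ∀ᶠ n : ℕ in atTop, C₂ * (n : ℝ) ^ (-f) ≤ l n)
    (hq : ∀ᶠ n : ℕ in atTop, (q n : ℝ) ≤ K * (n : ℝ) ^ b) :
    ∀ᶠ n : ℕ in atTop, C₁ * C₂ ^ 2 / (25 * K) * (n : ℝ) ^ (-(d + 2 * f + b)) ≤
      c n * l n ^ 2 / (25 * q n) := by
  filter_upwards [hc, hl, hq, eventually_gt_atTop 0] with n h3 h4 h5 h6
  have hn : (0 : ℝ) < n := by exact_mod_cast h6
  have hqn : (0 : ℝ) < q n := by exact_mod_cast hq0 n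
  have h7 : (n : ℝ) ^ (-(d + 2 * f + b)) =
      (n : ℝ) ^ (-d) * ((n : ℝ) ^ (-f)) ^ 2 * ((n : ℝ) ^ b)⁻¹ := by
    rw [← rpow_natCast, ← rpow_mul hn.le, ← rpow_neg hn.le, ← rpow_add hn, ← rpow_add hn]
    congr 1
    push_cast
    ring
  have hc0 : 0 < c n := lt_of_lt_of_le (by positivity) h3
  calc C₁ * C₂ ^ 2 / (25 * K) * (n : ℝ) ^ (-(d + 2 * f + b))
      = (C₁ * (n : ℝ) ^ (-d)) * (C₂ * (n : ℝ) ^ (-f)) ^ 2 / (25 * (K * (n : ℝ) ^ b)) := by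
        rw [h7]
        field_simp
    _ ≤ _ := by gcongr

end Limits

lemma cMin_nonneg {V : Type*} [Fintype V] [DecidableEq V] (M : Matrix V V ℝ) (q : ℕ) :
    0 ≤ cMin M q :=
  Real.sInf_nonneg (by rintro _ ⟨I, -, u, -, v, -, S, -, -, -, -, rfl⟩; exact abs_nonneg _)

lemma lambdaMin_nonneg {V : Type*} [Fintype V] [DecidableEq V] {M : Matrix V V ℝ}
    (hM : M.PosDef) (q : ℕ) : 0 ≤ lambdaMin M q := by
  refine Real.sInf_nonneg ?_
  rintro r ⟨I, -, hr⟩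
  exact hasEigenvalue_nonneg (posDef_submatrix hM I).posSemidef hr

end RankPC

/-! ### The consistency theorem -/

open RankPC in
theorem mainTheorem3
    (A B : ℝ) (hA : 0 < A) (hB : 0 < B)
    (rhoHat : ∀ n : ℕ, (Fin n → ℝ × ℝ) → ℝ) (hrho : RankPC.IsGoodEstimator A B rhoHat)
    (p : ℕ → ℕ) (G : ∀ n, RankPC.DAG (Fin (p n)))
    (q : ℕ → ℕ) (hq : ∀ n, q n = (G n).deg + 2)
    (M : ∀ n, Matrix (Fin (p n)) (Fin (p n)) ℝ)
    (hM : ∀ n, RankPC.IsCorrMatrix (M n))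
    (hfaith : ∀ n, RankPC.Faithful (G n) (M n))
    (c : ℕ → ℝ) (hc : ∀ n, c n = RankPC.cMin (M n) (q n))
    (a b d f : ℝ)
    (ha : 0 ≤ a ∧ a < 1) (hb : 0 ≤ b ∧ b < 1) (hd : 0 ≤ d ∧ d < 1) (hf : 0 ≤ f ∧ f < 1)
    (hpn : (fun n => Real.log (p n)) =O[atTop] fun n : ℕ => (n : ℝ) ^ a)
    (hqn : (fun n => (q n : ℝ)) =O[atTop] fun n : ℕ => (n : ℝ) ^ b)
    (hcn : (fun n : ℕ => (n : ℝ) ^ (-d)) =O[atTop] c)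
    (hln : (fun n : ℕ => (n : ℝ) ^ (-f)) =O[atTop] fun n => RankPC.lambdaMin (M n) (q n))
    (habdf : a + 2 * b + 2 * d + 4 * f < 1)
    (g : ∀ n, Fin (p n) → ℝ → ℝ) (hg : ∀ n v, StrictMono (g n v))
    {Ω : ℕ → Type*} [∀ n, MeasurableSpace (Ω n)]
    (P : ∀ n, Measure (Ω n)) [∀ n, IsProbabilityMeasure (P n)]
    (X : ∀ n, Fin n → Ω n → Fin (p n) → ℝ)
    (hX : ∀ n i, HasLaw (X n i) (RankPC.npn (g n) (M n)) (P n))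
    (hindep : ∀ n, iIndepFun (X n) (P n)) :
    ∃ α : ℕ → ℝ,
      (∀ n, α n ∈ Set.Ioo (0 : ℝ) 1) ∧
      (∀ᶠ n in atTop, 2 * RankPC.normalQuantile (1 - α n / 2) = RankPC.zSeq n (c n)) ∧
      (∀ᶠ n in atTop, ∀ s ≤ q n, s + 3 < n ∧
        (∀ r : ℝ, RankPC.FisherAccept n (α n) s r ↔ |r| ≤ RankPC.cutoff n s (RankPC.zSeq n (c n))) ∧
        c n / 3 ≤ RankPC.cutoff n s (RankPC.zSeq n (c n)) ∧
        RankPC.cutoff n s (RankPC.zSeq n (c n)) ≤ 2 * c n / 3) ∧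
      Tendsto
        (fun n => (P n).real
          {ω | (RankPC.rankPC rhoHat (α n) (fun i => X n i ω) : Set (Fin (p n) × Fin (p n)))
            = (G n).cpdag})
        atTop (𝓝 1) := by
  have hc0 : ∀ n, 0 ≤ c n := fun n => hc n ▸ cMin_nonneg _ _
  have hl0 : ∀ n, 0 ≤ lambdaMin (M n) (q n) := fun n => lambdaMin_nonneg (hM n).1 _
  have hq0 : ∀ n, 0 < q n := fun n => by rw [hq]; omega
  obtain ⟨C₁, hC₁, hc1⟩ := eventually_le_mul_of_isBigO hc0 hcn
  obtain ⟨C₂, hC₂, hl1⟩ := eventually_le_mul_of_isBigO hl0 hln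
  obtain ⟨K, hK, hqK⟩ := hqn.exists_pos
  have hq1 : ∀ᶠ n : ℕ in atTop, (q n : ℝ) ≤ K * (n : ℝ) ^ b := by
    filter_upwards [hqK.bound] with n hn
    rwa [Real.norm_of_nonneg (by positivity), Real.norm_of_nonneg (by positivity)] at hn
  have hcpos : ∀ᶠ n in atTop, 0 < c n := by
    filter_upwards [hc1, eventually_gt_atTop 0] with n h1 h2
    have : (0 : ℝ) < n := by exact_mod_cast h2
    exact lt_of_lt_of_le (by positivity) h1
  have hlpos : ∀ᶠ n in atTop, 0 < lambdaMin (M n) (q n) := by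
    filter_upwards [hl1, eventually_gt_atTop 0] with n h1 h2
    have : (0 : ℝ) < n := by exact_mod_cast h2
    exact lt_of_lt_of_le (by positivity) h1
  have hpt : ∀ n, 0 < c n → Nonempty (Fin (p n)) := fun n h => by
    by_contra h1
    have := not_nonempty_iff.1 h1
    rw [hc, cMin_of_isEmpty] at h
    exact h.false
  have hcle : ∀ n, 0 < c n → c n ≤ 1 := fun n h =>
    hc n ▸ cMin_le_one (hM n).1 (by rw [hq]; omega) (hpt n h).some
  have hlarge := eventually_mul_add_le hb.2 hqn
  have hlevel : ∀ n, ∃ α ∈ Set.Ioo (0 : ℝ) 1,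
      0 < zSeq n (c n) → 2 * normalQuantile (1 - α / 2) = zSeq n (c n) := fun n => by
    by_cases hz : 0 < zSeq n (c n)
    · obtain ⟨α, h1, h2⟩ := exists_level hz
      exact ⟨α, h1, fun _ => h2⟩
    · exact ⟨1 / 2, by norm_num, fun h => absurd h hz⟩
  choose α hα hαz using hlevel
  have hz : ∀ᶠ n in atTop, 2 * normalQuantile (1 - α n / 2) = zSeq n (c n) := by
    filter_upwards [hcpos, hlarge] with n h1 h2
    exact hαz n (zSeq_pos (by omega) h1 (hcle n h1))
  have htest : ∀ᶠ n in atTop, ∀ s ≤ q n, s + 3 < n ∧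
      (∀ r : ℝ, FisherAccept n (α n) s r ↔ |r| ≤ cutoff n s (zSeq n (c n))) ∧
      c n / 3 ≤ cutoff n s (zSeq n (c n)) ∧ cutoff n s (zSeq n (c n)) ≤ 2 * c n / 3 := by
    filter_upwards [hz, hcpos, hlarge] with n h1 h2 h3 s hs
    have hn : s + 3 < n := by omega
    exact ⟨hn, fisherAccept_iff hn h1, cutoff_bounds (by omega) hn h2 (hcle n h2)⟩
  refine ⟨α, hα, hz, htest, ?_⟩
  have herr := eventually_le_error hC₁ hC₂ hK hq0 hc1 hl1 hq1
  -- Here the error exponent is `e = d + 2f + b`, so `a + 2e < 1` is the assumption on the rates.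
  refine tendsto_measureReal_one
    (tendsto_tail_zero hA hB (by positivity) ha.1 (by linarith) hpn herr)
    (bad := fun n => {ω | ∃ u v, c n * lambdaMin (M n) (q n) ^ 2 / (25 * q n) <
      |corrHat rhoHat (fun i => X n i ω) u v - M n u v|}) ?_ ?_
  · filter_upwards [hcpos, hlpos, eventually_ge_atTop 1] with n h1 h2 h3
    have := hq0 n
    exact measureReal_corrHat_le hA.le hrho h3 (hM n) (hg n) (hX n) (hindep n) (by positivity)
  · filter_upwards [hcpos, hlpos, htest] with n h1 h2 h3 ω hω
    simp only [not_exists, not_lt] at hω ⊢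
    rw [hc] at hω h1 h3
    exact rankPC_eq_cpdag (hM n) (hfaith n) (hq n) h1 h2 (hpt n (hc n ▸ h1)).some
      (fun s hs => ⟨_, (h3 s hs).2⟩) _ hω
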